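/- **Setting.** Let $\mathcal X$ be a Polish space, $\mathcal Y$, $\mathcal H_1$ real separable Hilbert spaces, and $\mathcal H_2$ a separable reproducing kernel Hilbert space of functions $\mathcal X\to\mathcal Y$ with kernel operators $K_x=S_x^*:\mathcal Y\to\mathcal H_2$, where $S_x g=g(x)$; assume $\sup_x \mathrm{Tr}(K_x^*K_x)\le\kappa_0^2$ and that $(x,x')\mapsto\langle K_xy,K_{x'}y'\rangle$ is measurable for all $y,y'$. Let $\rho$ be a Borel probability measure on $\mathcal X\times\mathcal Y$ with marginal $\mu$ on $\mathcal X$ and conditional distributions $\rho(\cdot|x)$, let $S:\mathcal H_2\to L^2(\mathcal X,\mu;\mathcal Y)$ be the inclusion and $L=S^*S$. Let $A:\mathcal D(A)\subseteq\mathcal H_1\to\mathcal H_2$ be a (nonlinear) operator, $f^\dagger\in\mathcal H_1$, $d>0$, and let $B_d(f^\dagger)$ be the open ball of radius $d$ around $f^\dagger$, which is assumed to be contained in $\mathcal D(A)$. Assume: 1. $\int y\,\rho(dy|x)$ exists and equals $[A(f^\dagger)](x)$ for $\mu$-almost all $x$; 2. for $\mu$-almost all $x$ and all integers $l\ge2$: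 $\int\|y-[A(f^\dagger)](x)\|^l\,\rho(dy|x)\le\frac12\,l!\,\Sigma^2M^{l-2}$; 3. $A$ is Fréchet differentiable on $B_d(f^\dagger)$ with $\|A'(f)\|\le\ell$ there; 4. for some $\alpha\in(0,\frac12)$ and all $f,\tilde f\in B_d(f^\dagger)$: $\|S(A(f)-A(\tilde f)-A'(\tilde f)(f-\tilde f))\|_{L^2}\le\alpha\|S(A(f)-A(\tilde f))\|_{L^2}$; 5. there are bounded operators $R_f$ on $L^2(\mathcal X,\mu;\mathcal Y)$ with $SA'(f)=R_fSA'(f^\dagger)$, $\|R_f\|\le\tilde C_R$ and $\|R_f-I\|\le C_R\|f-f^\dagger\|$ for all $f\in B_d(f^\dagger)$; 6. with $T=(SA'(f^\dagger))^*SA'(f^\dagger)$, the initial point $g_1\in\mathcal D(A)$ satisfies $f^\dagger-g_1=T^rg$ for some $g\in\mathcal H_1$ with $\|g\|\le D$, where $r>0$; 7. $\mathcal N(\lambda)=\mathrm{Tr}((L+\lambda I)^{-1}L)\le C_\nu^2\lambda^{-\nu}$ for all $\lambda>0$, where $0<\nu<1$; 8. $0<\eta<1/(\kappa_0\ell)^2$.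 For data $(x_1,y_1),\dots,(x_n,y_n)$ drawn i.i.d. from $\rho$ let $$g_{t+1}=g_t-\frac\eta n\sum_{j=1}^n\big(S_{x_j}A'(g_t)\big)^*\big([A(g_t)](x_j)-y_j\big),\qquad t\ge1 .$$ **Theorem.** Let $\kappa_0,\ell,\tilde C_R,C_R,C_\nu,D>0$ and $M,\Sigma\ge0$. There is a constant $c>0$ depending only on $r,\nu,\eta,\kappa_0,\ell,\alpha,\tilde C_R,C_R,C_\nu$ such that the following holds with $$C_\star=c\,\max\{1,d\}\,(D+M+\Sigma),\qquad \delta_0=6\exp\Big(-\frac d{C_\star}\,\eta^{\min\{r,1/2\}}\Big),\qquad T_n=\Big\lfloor\eta^{-1}n^{\frac1{\min\{2r,1\}+\nu+1}}\Big\rfloor .$$ For all $n\ge n_0$, where $n_0$ depends only on the constants above and on $d,D,M,\Sigma$, and for all $\delta\in[\delta_0,1]$: with probability at least $1-\delta$, for all $1\le t\le T_n$ one has $g_t\in B_d(f^\dagger)\cap\mathcal D(A)$ and, for both $u\in\{0,\frac12\}$, $$\|T^u(g_t-f^\dagger)\|_{\mathcal H_1}\le C_\star\,(\eta t)^{-(\min\{r,1/2\}+u)}\,\log\frac6\delta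 .$$ (The interval $[\delta_0,1]$ is non-empty if and only if $C_\star\log 6\le d\,\eta^{\min\{r,1/2\}}$, that is, if $D$, $M$ and $\Sigma$ are small enough in relation to the radius $d$.) -/

import Mathlib

open MeasureTheory ProbabilityTheory
open scoped ENNReal InnerProductSpace

noncomputable section

namespace InverseLearning

/-! ### Operators on a real Hilbert space -/

section Operators

variable {H : Type*} [NormedAddCommGroup H] [InnerProductSpace ℝ H] [CompleteSpace H]

/-- The trace `∑ i, ⟪b i, P (b i)⟫` of a positive operator with respect to a Hilbert basis `b`
(for a positive operator the value, possibly `∞`, does not depend on the basis). -/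
def opTrace (P : H →L[ℝ] H) : ℝ≥0∞ :=
  ∑' i, ENNReal.ofReal
    ⟪(exists_hilbertBasis ℝ H).choose_spec.choose i,
      P ((exists_hilbertBasis ℝ H).choose_spec.choose i)⟫_ℝ

/-- The value `T ^ s x = ∑ μ, μ ^ s • P_μ x` of the power of a compact positive self-adjoint
operator `T`, where `P_μ` is the orthogonal projection onto `ker (T - μ I)`, the eigenspace of
`T` for `μ` (it is `0` if `μ` is not an eigenvalue). In particular `T ^ 0` is the identity. -/
def opPow (T : H →L[ℝ] H) (s : ℝ) (x : H) : H :=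
  ∑' μ : ℝ, μ ^ s • (LinearMap.ker
    ((T - μ • ContinuousLinearMap.id ℝ H : H →L[ℝ] H) : H →ₗ[ℝ] H)).starProjection x

end Operators

/-- A Hilbert basis of a separable space is countable. -/
theorem countable_hilbertBasis {H : Type*} [NormedAddCommGroup H]
    [InnerProductSpace ℝ H] [SecondCountableTopology H] {ι : Type*} (b : HilbertBasis ι ℝ H) :
    Countable ι := by
  have hdist : ∀ i j, i ≠ j → 1 < ‖b i - b j‖ := by
    intro i j hij
    have h : ‖b i - b j‖ ^ 2 = 2 := by
      rw [norm_sub_sq_real, b.orthonormal.1 i, b.orthonormal.1 j, b.orthonormal.2 hij]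
      norm_num
    nlinarith [norm_nonneg (b i - b j)]
  have hdisj : (Set.univ : Set ι).PairwiseDisjoint fun i => Metric.ball (b i) (1 / 2) := by
    intro i _ j _ hij
    refine Metric.ball_disjoint_ball ?_
    rw [dist_eq_norm]
    linarith [hdist i j hij]
  exact Set.countable_univ_iff.mp (hdisj.countable_of_isOpen (fun i _ => Metric.isOpen_ball)
    (fun i _ => ⟨b i, Metric.mem_ball_self (by norm_num)⟩))

/-! ### The vector-valued reproducing kernel space and its inclusion into `L²` -/

section Kernel

variable {X Y : Type*} [MeasurableSpace X]
  [NormedAddCommGroup Y] [InnerProductSpace ℝ Y] [CompleteSpace Y]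
  (H₂ : Type*) [NormedAddCommGroup H₂] [InnerProductSpace ℝ H₂] [CompleteSpace H₂]
  [RKHS ℝ H₂ X Y]

/-- The operators `K_x : Y → H₂` are Hilbert-Schmidt with `sup_x Tr (K_x* K_x) ≤ κ₀ ^ 2`, and
`(x, x') ↦ ⟪K_x y, K_x' y'⟫` is measurable for all `y, y'`. -/
structure KernelCondition (κ₀ : ℝ) : Prop where
  trace_le : ⨆ x : X, opTrace ((RKHS.kerFun H₂ x).adjoint ∘L RKHS.kerFun H₂ x)
    ≤ ENNReal.ofReal (κ₀ ^ 2)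
  measurable_kernel : ∀ y y' : Y, Measurable fun p : X × X =>
    ⟪RKHS.kerFun H₂ p.1 y, RKHS.kerFun H₂ p.2 y'⟫_ℝ

/-- Point evaluation `S_x : H₂ → Y` as a bounded operator. -/
def evalCLM (x : X) : H₂ →L[ℝ] Y :=
  ContinuousLinearMap.proj (R := ℝ) (φ := fun _ : X => Y) x ∘L RKHS.coeCLM (H := H₂) ℝ

variable {H₂}

theorem KernelCondition.norm_apply_le {κ₀ : ℝ} (hK : KernelCondition H₂ κ₀) (g : H₂) (x : X) :
    ‖g x‖ ≤ |κ₀| * ‖g‖ := by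
  set b := (exists_hilbertBasis ℝ Y).choose_spec.choose with hb
  have h1 : ∑' i, ENNReal.ofReal (‖RKHS.kerFun H₂ x (b i)‖ ^ 2) ≤ ENNReal.ofReal (κ₀ ^ 2) := by
    refine le_trans (le_of_eq ?_) ((le_iSup _ x).trans hK.trace_le)
    unfold opTrace
    refine tsum_congr fun i => ?_
    rw [← hb, ContinuousLinearMap.comp_apply, ContinuousLinearMap.adjoint_inner_right,
      real_inner_self_eq_norm_sq]
  have h2 : HasSum (fun i => ⟪b i, g x⟫_ℝ ^ 2) (‖g x‖ ^ 2) := by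
    have h := b.hasSum_inner_mul_inner (g x) (g x)
    rw [real_inner_self_eq_norm_sq] at h
    simpa only [real_inner_comm (b _) (g x), ← sq] using h
  have h3 : ∀ i, ⟪b i, g x⟫_ℝ ^ 2 ≤ ‖RKHS.kerFun H₂ x (b i)‖ ^ 2 * ‖g‖ ^ 2 := by
    intro i
    rw [← RKHS.kerFun_inner, ← mul_pow]
    exact sq_le_sq' (by linarith [neg_abs_le ⟪RKHS.kerFun H₂ x (b i), g⟫_ℝ,
      abs_real_inner_le_norm (RKHS.kerFun H₂ x (b i)) g]) (real_inner_le_norm _ _)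
  have h4 : ENNReal.ofReal (‖g x‖ ^ 2) ≤ ENNReal.ofReal (κ₀ ^ 2 * ‖g‖ ^ 2) := by
    rw [← h2.tsum_eq, ENNReal.ofReal_tsum_of_nonneg (fun i => sq_nonneg _) h2.summable,
      ENNReal.ofReal_mul (sq_nonneg _)]
    calc _ ≤ ∑' i, ENNReal.ofReal (‖RKHS.kerFun H₂ x (b i)‖ ^ 2) * ENNReal.ofReal (‖g‖ ^ 2) :=
          ENNReal.tsum_le_tsum fun i => by
            rw [← ENNReal.ofReal_mul (sq_nonneg _)]
            exact ENNReal.ofReal_le_ofReal (h3 i)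
      _ = (∑' i, ENNReal.ofReal (‖RKHS.kerFun H₂ x (b i)‖ ^ 2)) * ENNReal.ofReal (‖g‖ ^ 2) :=
          ENNReal.tsum_mul_right
      _ ≤ _ := by gcongr
  have h5 : ‖g x‖ ^ 2 ≤ (|κ₀| * ‖g‖) ^ 2 := by
    rw [mul_pow, sq_abs]
    exact (ENNReal.ofReal_le_ofReal_iff (by positivity)).mp h4
  exact le_of_sq_le_sq h5 (by positivity)

variable [SecondCountableTopology Y] [MeasurableSpace Y] [BorelSpace Y]

/-- The functions in the reproducing kernel space are measurable. -/
theorem KernelCondition.measurable_coe {κ₀ : ℝ} (hK : KernelCondition H₂ κ₀) (g : H₂) :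
    Measurable (g : X → Y) := by
  have hweak : ∀ y : Y, Measurable fun x => ⟪y, g x⟫_ℝ := by
    intro y
    have hmem : g ∈ (Submodule.span ℝ {RKHS.kerFun H₂ x v | (x) (v)}).topologicalClosure := by
      rw [RKHS.kerFun_dense]; trivial
    have hspan : ∀ h ∈ Submodule.span ℝ {RKHS.kerFun H₂ x v | (x : X) (v : Y)},
        Measurable fun x => ⟪y, h x⟫_ℝ := by
      intro h hh
      induction hh using Submodule.span_induction with
      | mem h hh =>
        obtain ⟨x', v, rfl⟩ := hh
        have heq : (fun x => ⟪y, RKHS.kerFun H₂ x' v x⟫_ℝ) =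
            fun x => ⟪RKHS.kerFun H₂ x y, RKHS.kerFun H₂ x' v⟫_ℝ :=
          funext fun x => (RKHS.kerFun_inner x y (RKHS.kerFun H₂ x' v)).symm
        rw [heq]
        have hm : Measurable fun x : X => (x, x') := measurable_prodMk_right
        have hc := (hK.measurable_kernel y v).comp hm
        simp only [Function.comp_def] at hc
        exact hc
      | zero =>
        have heq : (fun x : X => ⟪y, (0 : H₂) x⟫_ℝ) = fun _ => 0 := funext fun x => by
          rw [RKHS.coe_zero]; exact inner_zero_right y
        rw [heq]
        exact measurable_const
      | add a c _ _ ha hc =>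
        have heq : (fun x : X => ⟪y, (a + c) x⟫_ℝ) = fun x => ⟪y, a x⟫_ℝ + ⟪y, c x⟫_ℝ :=
          funext fun x => by rw [RKHS.coe_add]; exact inner_add_right y _ _
        rw [heq]
        exact ha.add hc
      | smul r a _ ha =>
        have heq : (fun x : X => ⟪y, (r • a) x⟫_ℝ) = fun x => r * ⟪y, a x⟫_ℝ :=
          funext fun x => by rw [RKHS.coe_smul]; exact real_inner_smul_right y _ _
        rw [heq]
        exact ha.const_mul r
    rw [← SetLike.mem_coe, Submodule.topologicalClosure_coe, mem_closure_iff_seq_limit] at hmem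
    obtain ⟨u, hu, hlim⟩ := hmem
    refine measurable_of_tendsto_metrizable (fun k => hspan (u k) (hu k)) ?_
    rw [tendsto_pi_nhds]
    intro x
    exact Filter.Tendsto.inner tendsto_const_nhds
      (((RKHS.continuous_eval x).tendsto g).comp hlim)
  obtain ⟨w, b, -⟩ := exists_hilbertBasis ℝ Y
  have : Countable w := countable_hilbertBasis b
  refine measurable_of_tendsto_metrizable' (f := fun (s : Finset w) x => ∑ i ∈ s, ⟪b i, g x⟫_ℝ • b i)
    Filter.atTop (fun s => Finset.measurable_fun_sum s fun i _ => (hweak (b i)).smul_const (b i)) ?_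
  rw [tendsto_pi_nhds]
  intro x
  have := b.hasSum_repr (g x)
  simp_rw [b.repr_apply_apply] at this
  exact this

theorem KernelCondition.memLp {κ₀ : ℝ} (hK : KernelCondition H₂ κ₀) (μ : Measure X)
    [IsProbabilityMeasure μ] (g : H₂) : MemLp (g : X → Y) 2 μ :=
  MemLp.of_bound (hK.measurable_coe g).aestronglyMeasurable (|κ₀| * ‖g‖)
    (Filter.Eventually.of_forall fun x => hK.norm_apply_le g x)

/-- The inclusion `S : H₂ → L²(X, μ; Y)`. -/
def inclusion {κ₀ : ℝ} (hK : KernelCondition H₂ κ₀) (μ : Measure X) [IsProbabilityMeasure μ] :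
    H₂ →L[ℝ] Lp Y 2 μ :=
  LinearMap.mkContinuous
    { toFun := fun g => (hK.memLp μ g).toLp g
      map_add' := fun g h => by
        rw [← MemLp.toLp_add]
        exact MemLp.toLp_congr _ _ (by simp)
      map_smul' := fun c g => by
        rw [RingHom.id_apply, ← MemLp.toLp_const_smul]
        exact MemLp.toLp_congr _ _ (by simp) }
    |κ₀| fun g => by
      refine (Lp.norm_le_of_ae_bound (C := |κ₀| * ‖g‖) (by positivity) ?_).trans ?_
      · filter_upwards [(hK.memLp μ g).coeFn_toLp] with x hx
        simp only [LinearMap.coe_mk, AddHom.coe_mk]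
        rw [hx]
        exact hK.norm_apply_le g x
      · simp [measureUnivNNReal]

end Kernel

/-! ### The inverse problem -/

section Problem

variable {X Y : Type*} [MeasurableSpace X]
  [NormedAddCommGroup Y] [InnerProductSpace ℝ Y] [CompleteSpace Y]
  [SecondCountableTopology Y] [MeasurableSpace Y] [BorelSpace Y]
  {H₁ : Type*} [NormedAddCommGroup H₁] [InnerProductSpace ℝ H₁] [CompleteSpace H₁]
  {H₂ : Type*} [NormedAddCommGroup H₂] [InnerProductSpace ℝ H₂] [CompleteSpace H₂]
  [RKHS ℝ H₂ X Y]

/-- `L = S* S`. -/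
def covOp {κ₀ : ℝ} (hK : KernelCondition H₂ κ₀) (μ : Measure X) [IsProbabilityMeasure μ] :
    H₂ →L[ℝ] H₂ :=
  (inclusion hK μ).adjoint ∘L inclusion hK μ

/-- `B = S A'(f†)`. -/
def linOp {κ₀ : ℝ} (hK : KernelCondition H₂ κ₀) (μ : Measure X) [IsProbabilityMeasure μ]
    (A : H₁ → H₂) (fdag : H₁) : H₁ →L[ℝ] Lp Y 2 μ :=
  inclusion hK μ ∘L fderiv ℝ A fdag

/-- `T = B* B`, the integral operator of the tangent kernel at `f†`. -/
def tangentOp {κ₀ : ℝ} (hK : KernelCondition H₂ κ₀) (μ : Measure X) [IsProbabilityMeasure μ]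
    (A : H₁ → H₂) (fdag : H₁) : H₁ →L[ℝ] H₁ :=
  (linOp hK μ A fdag).adjoint ∘L linOp hK μ A fdag

/-- The regression function is `A f†`. -/
def TrueSolution (ρ : Measure (X × Y)) [IsFiniteMeasure ρ] (A : H₁ → H₂) (fdag : H₁) : Prop :=
  ∀ᵐ x ∂ρ.fst, Integrable (fun y => y) (ρ.condKernel x) ∧
    A fdag x = ∫ y, y ∂(ρ.condKernel x)

/-- Bernstein moment condition on the noise. -/
def NoiseCondition (ρ : Measure (X × Y)) [IsFiniteMeasure ρ] (A : H₁ → H₂) (fdag : H₁)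
    (M σ : ℝ) : Prop :=
  ∀ᵐ x ∂ρ.fst, ∀ l : ℕ, 2 ≤ l →
    ∫⁻ y, ‖y - A fdag x‖ₑ ^ l ∂(ρ.condKernel x)
      ≤ ENNReal.ofReal (1 / 2 * (l.factorial : ℝ) * σ ^ 2 * M ^ (l - 2))

/-- `A` is Fréchet differentiable near `f†` with derivative bounded by `ℓ`. -/
def FrechetCondition (A : H₁ → H₂) (dom : Set H₁) (fdag : H₁) (d ℓ : ℝ) : Prop :=
  ∀ f ∈ Metric.ball fdag d ∩ dom, DifferentiableAt ℝ A f ∧ ‖fderiv ℝ A f‖ ≤ ℓ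

/-- Local tangential cone condition with constant `α`, in the norm of `L²(X, μ; Y)`. -/
def TangentialCone {κ₀ : ℝ} (hK : KernelCondition H₂ κ₀) (μ : Measure X) [IsProbabilityMeasure μ]
    (A : H₁ → H₂) (dom : Set H₁) (fdag : H₁) (d α : ℝ) : Prop :=
  ∀ f ∈ Metric.ball fdag d ∩ dom, ∀ f' ∈ Metric.ball fdag d ∩ dom,
    ‖inclusion hK μ (A f - A f' - fderiv ℝ A f' (f - f'))‖
      ≤ α * ‖inclusion hK μ (A f - A f')‖

/-- Range invariance: `S A'(f) = R_f S A'(f†)` with `‖R_f‖ ≤ CRt` and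
`‖R_f - I‖ ≤ CR ‖f - f†‖`. -/
def RangeInvariance {κ₀ : ℝ} (hK : KernelCondition H₂ κ₀) (μ : Measure X) [IsProbabilityMeasure μ]
    (A : H₁ → H₂) (dom : Set H₁) (fdag : H₁) (d CRt CR : ℝ) : Prop :=
  ∃ R : H₁ → Lp Y 2 μ →L[ℝ] Lp Y 2 μ, ∀ f ∈ Metric.ball fdag d ∩ dom,
    inclusion hK μ ∘L fderiv ℝ A f = R f ∘L inclusion hK μ ∘L fderiv ℝ A fdag ∧
      ‖R f‖ ≤ CRt ∧ ‖R f - ContinuousLinearMap.id ℝ (Lp Y 2 μ)‖ ≤ CR * ‖f - fdag‖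

/-- Hölder source condition `f† - g₁ = T ^ r g` with `‖g‖ ≤ D`. -/
def SourceCondition (T : H₁ →L[ℝ] H₁) (fdag g₁ : H₁) (r D : ℝ) : Prop :=
  ∃ g : H₁, fdag - g₁ = opPow T r g ∧ ‖g‖ ≤ D

/-- Effective dimension `Tr ((L + lam I)⁻¹ L)`. -/
def effDim (L : H₂ →L[ℝ] H₂) (lam : ℝ) : ℝ≥0∞ :=
  opTrace (Ring.inverse (L + lam • ContinuousLinearMap.id ℝ H₂) * L)

/-- Polynomial decay of the effective dimension. -/
def EffDimCondition (L : H₂ →L[ℝ] H₂) (ν Cν : ℝ) : Prop :=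
  ∀ lam : ℝ, 0 < lam → effDim L lam ≤ ENNReal.ofReal (Cν ^ 2 * lam ^ (-ν))

/-- The gradient step
`f - η (Ŝ A'(f))* (Ŝ A(f) - y) = f - (η / n) ∑ j, (S_{x_j} A'(f))* (A(f)(x_j) - y_j)`, where
`Yⁿ` carries the inner product `n⁻¹ ∑ j, ⟪y_j, y'_j⟫`. -/
def gdStep (A : H₁ → H₂) (η : ℝ) {n : ℕ} (z : Fin n → X × Y) (f : H₁) : H₁ :=
  f - η • ((n : ℝ)⁻¹ • ∑ j, (evalCLM H₂ (z j).1 ∘L fderiv ℝ A f).adjoint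
    (A f (z j).1 - (z j).2))

/-- The gradient descent iterates `g_1, g_2, …` for the data `z`; the index `0` is not used. -/
def gdIter (A : H₁ → H₂) (η : ℝ) (g₁ : H₁) {n : ℕ} (z : Fin n → X × Y) : ℕ → H₁
  | 0 => g₁
  | 1 => g₁
  | t + 2 => gdStep A η z (gdIter A η g₁ z (t + 1))

end Problem

/-- The threshold `T_n = ⌊η⁻¹ n ^ (1 / (min {2r, 1} + ν + 1))⌋`. -/
def stopTime (η r ν : ℝ) (n : ℕ) : ℕ :=
  ⌊η⁻¹ * (n : ℝ) ^ (1 / (min (2 * r) 1 + ν + 1))⌋₊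

/-- The constant `C⋆ = c max {1, d} (D + M + Σ)`. -/
def constStar (c d D M σ : ℝ) : ℝ :=
  c * max 1 d * (D + M + σ)

/-- The smallest admissible level `δ₀ = 6 exp (- (d / C) η ^ min {r, 1/2})`. -/
def deltaZero (C d η r : ℝ) : ℝ :=
  6 * Real.exp (-(d / C) * η ^ min r (1 / 2))

end InverseLearning

end

noncomputable section

namespace InverseLearning

/-! ### Hilbert–Schmidt sums and eigenbases -/

section HilbertSchmidt

variable {H F : Type*} [NormedAddCommGroup H] [InnerProductSpace ℝ H]
  [NormedAddCommGroup F] [InnerProductSpace ℝ F]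

/-! Write `B = S A'(f†)`, `T = B* B`, `L = S* S`, `e_k = g_{k+1} - f†`, `a = min r (1/2)` and `τ = η
(k + 1)`. To leading order gradient descent is the linear iteration `e_{k+1} = (I - η T) e_k`. Under
the source condition its solution decays like `τ ^ (-(a + u))` after applying `T ^ u`. Everything
else is a perturbation that must not spoil this rate; `perturbed_landweber_bound` shows this by
induction for `u = 0` and `u = 1/2` together.

Nonlinearity. Range invariance gives `(S A'(f))* = B* R_f*`, so errors measured in `L²` enter
through `B*` and are smoothed by the powers of `I - η T`. Integrating along the segment from `f†` to
`f` bounds the linearization error by `C_R ‖e‖ ‖B e‖`. This product of two decaying factors is of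
order `τ ^ (-(2 a + 1/2))`, and its discrete convolution with the smoothing weights is again of
order `τ ^ (-(a + u))`.

Randomness. The averaged noise `ζ` and the covariance error `(L̂ - L)(A f - A f†)` live in `H₂` and
need not lie in the range of `S*`. The identity `ζ = S* S (L + λ)⁻¹ ζ + λ (L + λ)⁻¹ ζ` splits off a
part to which range invariance applies. The rest misses the smoothing of `B*` but carries an extra
`√λ`, which compensates as long as `λ τ ≤ 1` (`adjoint_residual_eq`). Both parts are controlled by
the quadratic form of `(L + λ)⁻¹`.

Take `λ = n ^ (-1 / (2 a + ν + 1))`, so that `λ τ ≤ 1` is exactly the range `t ≤ T_n`. Bernstein's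
inequality (`measure_le_norm_sum_le`) and the effective dimension make the whitened noise of order
`λ ^ (a + 1/2) log (6/δ)`, which fits the rate. For the covariance the second moment suffices: its
error is multiplied by `‖e‖`, which leaves a spare factor `λ ^ (a/2)`, and for large `n` this beats
the constant `δ₀ ^ (-1/2)` coming from Markov's inequality.

The induction closes (`amplitude_closes`) because the amplitude `P` is twice the linear
contributions, while the quadratic one is a small multiple of `P` once `P η ^ (-a)` is small. The
condition `δ ≥ δ₀` provides this smallness, and it also keeps the iterates in the ball. -/

theorem hasSum_inner_sq {ι : Type*} (b : HilbertBasis ι ℝ H) (x : H) :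
    HasSum (fun i => ⟪b i, x⟫_ℝ ^ 2) (‖x‖ ^ 2) := by
  have h := b.hasSum_inner_mul_inner x x
  rw [real_inner_self_eq_norm_sq] at h
  simpa only [real_inner_comm (b _) x, ← sq] using h

theorem tsum_ofReal_inner_sq {ι : Type*} (b : HilbertBasis ι ℝ H) (x : H) :
    ∑' i, ENNReal.ofReal (⟪b i, x⟫_ℝ ^ 2) = ENNReal.ofReal (‖x‖ ^ 2) := by
  rw [← (hasSum_inner_sq b x).tsum_eq,
    ENNReal.ofReal_tsum_of_nonneg (fun _ => sq_nonneg _) (hasSum_inner_sq b x).summable]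

variable [CompleteSpace F]

/-- The finite-rank truncations in the basis converge in operator norm: by Cauchy-Schwarz the error
is at most the square root of the tail of the Hilbert-Schmidt sum. -/
theorem isCompactOperator_of_tsum_norm_sq {ι : Type*} (b : HilbertBasis ι ℝ H) (C : H →L[ℝ] F)
    (hC : ∑' i, ENNReal.ofReal (‖C (b i)‖ ^ 2) ≠ ∞) : IsCompactOperator C := by
  classical
  have hs : Summable fun i => ‖C (b i)‖ ^ 2 := by
    have := ENNReal.summable_toReal hC
    refine this.congr fun i => ?_
    rw [ENNReal.toReal_ofReal (sq_nonneg _)]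
  let F' : Finset ι → H →L[ℝ] F := fun s => ∑ i ∈ s, (innerSL ℝ (b i)).smulRight (C (b i))
  have hexp : ∀ x, HasSum (fun i => ⟪b i, x⟫_ℝ • C (b i)) (C x) := by
    intro x
    have := (b.hasSum_repr x).mapL C
    simpa only [b.repr_apply_apply, map_smul] using this
  have hbound : ∀ s : Finset ι, ‖F' s - C‖ ≤ √(∑' i : {i // i ∉ s}, ‖C (b i)‖ ^ 2) := by
    intro s
    refine ContinuousLinearMap.opNorm_le_bound _ (Real.sqrt_nonneg _) fun x => ?_
    have h1 : HasSum (fun i : {i // i ∉ s} => ⟪b i, x⟫_ℝ • C (b i)) (C x - F' s x) := by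
      have := (Finset.hasSum_compl_iff (f := fun i => ⟪b i, x⟫_ℝ • C (b i)) s
        (a := C x - F' s x)).2 (by
          convert hexp x using 1
          simp [F'])
      exact this
    rw [← norm_neg]
    have h2 : -((F' s - C) x) = C x - F' s x := by simp
    rw [h2]
    refine le_of_tendsto h1.norm (Filter.Eventually.of_forall fun t => ?_)
    refine (norm_sum_le _ _).trans ?_
    simp_rw [norm_smul]
    refine (Real.sum_mul_le_sqrt_mul_sqrt _ _ _).trans ?_
    rw [mul_comm]
    gcongr
    · exact (hs.subtype _).sum_le_tsum t (fun _ _ => sq_nonneg _)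
    · rw [← Real.sqrt_sq (norm_nonneg x)]
      apply Real.sqrt_le_sqrt
      have h3 := sum_le_hasSum (t.map (Function.Embedding.subtype _)) (fun _ _ => sq_nonneg _)
        (hasSum_inner_sq b x)
      rw [Finset.sum_map] at h3
      simp only [Real.norm_eq_abs, sq_abs]
      exact h3
  have hlim : Filter.Tendsto F' Filter.atTop (nhds C) := by
    rw [tendsto_iff_norm_sub_tendsto_zero]
    refine squeeze_zero (fun _ => norm_nonneg _) hbound ?_
    have := (tendsto_tsum_compl_atTop_zero fun i => ‖C (b i)‖ ^ 2).sqrt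
    simpa using this
  refine isCompactOperator_of_tendsto hlim (Filter.Eventually.of_forall fun s => ?_)
  have hmem : F' s ∈ compactOperator (RingHom.id ℝ) H F := by
    refine Submodule.sum_mem _ fun i _ => ?_
    have h1 : IsCompactOperator (innerSL ℝ (b i)) := isCompactOperator_of_locallyCompactSpace_dom _
    exact h1.clm_comp ((ContinuousLinearMap.id ℝ ℝ).smulRight (C (b i)))
  exact hmem

variable [CompleteSpace H]

/-- By Parseval both sides are the double sum of `⟪c k, C (b i)⟫ ^ 2`, taken in either order. -/
theorem tsum_norm_sq_eq_adjoint {ι κ : Type*} (b : HilbertBasis ι ℝ H) (c : HilbertBasis κ ℝ F)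
    (C : H →L[ℝ] F) :
    ∑' i, ENNReal.ofReal (‖C (b i)‖ ^ 2) = ∑' k, ENNReal.ofReal (‖C.adjoint (c k)‖ ^ 2) := by
  simp_rw [← tsum_ofReal_inner_sq c, ← tsum_ofReal_inner_sq b]
  rw [ENNReal.tsum_comm]
  refine tsum_congr fun k => tsum_congr fun i => ?_
  rw [ContinuousLinearMap.adjoint_inner_right, real_inner_comm]

theorem tsum_norm_sq_eq_of_basis {ι κ : Type*} (b : HilbertBasis ι ℝ H) (c : HilbertBasis κ ℝ H)
    (C : H →L[ℝ] F) :
    ∑' i, ENNReal.ofReal (‖C (b i)‖ ^ 2) = ∑' k, ENNReal.ofReal (‖C (c k)‖ ^ 2) := by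
  obtain ⟨w, e, -⟩ := exists_hilbertBasis ℝ F
  rw [tsum_norm_sq_eq_adjoint b e, tsum_norm_sq_eq_adjoint c e]

end HilbertSchmidt

universe u

/-! ### Spectral decomposition of compact self-adjoint operators -/

section Eigenbasis

variable {H : Type*} [NormedAddCommGroup H] [InnerProductSpace ℝ H]

theorem inner_eigenbasis_apply {ι : Type*} {T : H →L[ℝ] H} (hT : (T : H →ₗ[ℝ] H).IsSymmetric)
    {b : HilbertBasis ι ℝ H} {m : ι → ℝ} (hb : ∀ i, T (b i) = m i • b i) (i : ι) (x : H) :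
    ⟪b i, T x⟫_ℝ = m i * ⟪b i, x⟫_ℝ := by
  have := hT (b i) x
  simp only [ContinuousLinearMap.coe_coe] at this
  rw [← this, hb, real_inner_smul_left]

theorem mem_ker_sub_smul_id {T : H →L[ℝ] H} {μ : ℝ} {x : H} :
    x ∈ LinearMap.ker ((T - μ • ContinuousLinearMap.id ℝ H : H →L[ℝ] H) : H →ₗ[ℝ] H) ↔
      T x = μ • x := by
  simp [LinearMap.mem_ker, sub_eq_zero]

theorem orthogonalFamily_ker_sub_smul_id {T : H →L[ℝ] H} (hT : (T : H →ₗ[ℝ] H).IsSymmetric) :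
    OrthogonalFamily ℝ
      (fun μ : ℝ => LinearMap.ker
        ((T - μ • ContinuousLinearMap.id ℝ H : H →L[ℝ] H) : H →ₗ[ℝ] H))
      (fun μ => (LinearMap.ker
        ((T - μ • ContinuousLinearMap.id ℝ H : H →L[ℝ] H) : H →ₗ[ℝ] H)).subtypeₗᵢ) := by
  intro μ ν hμν v w
  have hv := mem_ker_sub_smul_id.1 v.2
  have hw := mem_ker_sub_smul_id.1 w.2
  have h := hT v w
  simp only [ContinuousLinearMap.coe_coe, hv, hw, real_inner_smul_left,
    real_inner_smul_right] at h
  have h' : (μ - ν) * ⟪(v : H), (w : H)⟫_ℝ = 0 := by linarith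
  exact (mul_eq_zero.1 h').resolve_left (sub_ne_zero.2 hμν)

variable [CompleteSpace H]

/-- Hilbert bases of the eigenspaces, the kernel included, are collected into one orthonormal
family. The spectral theorem for compact operators makes its span dense. -/
theorem exists_eigenbasis {H : Type u} [NormedAddCommGroup H] [InnerProductSpace ℝ H]
    [CompleteSpace H] {T : H →L[ℝ] H} (hc : IsCompactOperator T)
    (hT : (T : H →ₗ[ℝ] H).IsSymmetric) :
    ∃ (ι : Type u) (b : HilbertBasis ι ℝ H) (m : ι → ℝ), ∀ i, T (b i) = m i • b i := by
  let E : ℝ → Submodule ℝ H := fun μ =>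
    LinearMap.ker ((T - μ • ContinuousLinearMap.id ℝ H : H →L[ℝ] H) : H →ₗ[ℝ] H)
  choose w c hc' using fun μ => exists_hilbertBasis ℝ (E μ)
  have hon := (orthogonalFamily_ker_sub_smul_id hT).orthonormal_sigma_orthonormal
    (v_family := fun μ => (c μ : w μ → E μ)) fun μ => (c μ).orthonormal
  have hbot : (Submodule.span ℝ (Set.range fun a : Σ μ, w μ =>
      (E a.1).subtypeₗᵢ (c a.1 a.2)))ᗮ = ⊥ := by
    rw [eq_bot_iff]
    intro x hx
    have hx' : ∀ (μ : ℝ) (i : w μ), ⟪(c μ i : H), x⟫_ℝ = 0 := fun μ i =>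
      hx _ (Submodule.subset_span ⟨⟨μ, i⟩, rfl⟩)
    have h0 := ContinuousLinearMap.orthogonalComplement_iSup_eigenspaces_eq_bot hc hT
    rw [← h0, ← Submodule.iInf_orthogonal, Submodule.mem_iInf]
    intro μ y hy
    have hyE : y ∈ E μ := by
      rw [mem_ker_sub_smul_id]
      exact Module.End.mem_eigenspace_iff.1 hy
    have h1 := (c μ).hasSum_repr (⟨y, hyE⟩ : E μ)
    have h2 := (h1.mapL (E μ).subtypeL).mapL (innerSL ℝ x)
    have h3 : (fun i => (innerSL ℝ x) ((E μ).subtypeL ((c μ).repr (⟨y, hyE⟩ : E μ) i • c μ i)))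
        = fun _ => 0 := by
      funext i
      simp only [map_smul, innerSL_apply_apply, Submodule.subtypeL_apply, smul_eq_mul]
      rw [real_inner_comm, hx' μ i, mul_zero]
    rw [h3] at h2
    have := h2.unique hasSum_zero
    rw [real_inner_comm]
    exact this
  refine ⟨Σ μ, w μ, HilbertBasis.mkOfOrthogonalEqBot hon hbot, fun a => a.1, fun a => ?_⟩
  rw [HilbertBasis.coe_mkOfOrthogonalEqBot]
  exact mem_ker_sub_smul_id.1 (c a.1 a.2).2

/-- The coordinates of `T ^ s x` in an eigenbasis of a positive `T`. -/
theorem inner_opPow {ι : Type*} {T : H →L[ℝ] H} (hT : (T : H →ₗ[ℝ] H).IsSymmetric)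
    (hpos : ∀ x, 0 ≤ ⟪x, T x⟫_ℝ)
    {b : HilbertBasis ι ℝ H} {m : ι → ℝ} (hb : ∀ i, T (b i) = m i • b i)
    {s : ℝ} (hs : 0 ≤ s) (i : ι) (x : H) :
    ⟪b i, opPow T s x⟫_ℝ = m i ^ s * ⟪b i, x⟫_ℝ := by
  let E : ℝ → Submodule ℝ H := fun μ =>
    LinearMap.ker ((T - μ • ContinuousLinearMap.id ℝ H : H →L[ℝ] H) : H →ₗ[ℝ] H)
  have hE : OrthogonalFamily ℝ (fun μ => E μ) fun μ => (E μ).subtypeₗᵢ :=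
    orthogonalFamily_ker_sub_smul_id hT
  have hproj : ∀ μ, ‖(E μ).orthogonalProjectionOnto x‖ ^ 2
      = ⟪x, (E μ).starProjection x⟫_ℝ := by
    intro μ
    have h1 : (E μ).starProjection ((E μ).starProjection x) = (E μ).starProjection x :=
      Submodule.starProjection_eq_self_iff.2 (Submodule.starProjection_apply_mem _ _)
    have h2 := Submodule.inner_starProjection_left_eq_right (E μ) x ((E μ).starProjection x)
    rw [h1] at h2
    rw [← h2, real_inner_self_eq_norm_sq, Submodule.starProjection_apply, Submodule.coe_norm]
  -- Bessel's inequality for the eigenprojections, needed since `opPow` is a sum over all real `μ`.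
  have hbessel : Summable fun μ => ‖(E μ).orthogonalProjectionOnto x‖ ^ 2 := by
    refine summable_of_sum_le (fun _ => sq_nonneg _) (c := ‖x‖ ^ 2) fun u => ?_
    set y := ∑ μ ∈ u, (E μ).starProjection x with hy
    have h1 : ‖y‖ ^ 2 = ∑ μ ∈ u, ‖(E μ).orthogonalProjectionOnto x‖ ^ 2 :=
      hE.norm_sum (fun μ => (E μ).orthogonalProjectionOnto x) u
    have h2 : ⟪x, y⟫_ℝ = ‖y‖ ^ 2 := by
      rw [h1, hy, inner_sum]
      exact Finset.sum_congr rfl fun μ _ => (hproj μ).symm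
    rw [← h1]
    have h3 := real_inner_le_norm x y
    rw [h2] at h3
    rcases (norm_nonneg y).eq_or_lt with h4 | h4
    · rw [← h4, zero_pow two_ne_zero]; positivity
    · have : ‖y‖ ≤ ‖x‖ := by nlinarith
      gcongr
  -- Only `μ` in `[0, ‖T‖]` contributes, so the weights `μ ^ s` are bounded by `‖T‖ ^ s` and the
  -- series converges.
  have hmem : ∀ μ : ℝ, (E μ).orthogonalProjectionOnto x ≠ 0 → 0 ≤ μ ∧ μ ≤ ‖T‖ := by
    intro μ hne
    set v : E μ := (E μ).orthogonalProjectionOnto x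
    have hv : T (v : H) = μ • (v : H) := mem_ker_sub_smul_id.1 v.2
    have hv0 : 0 < ‖(v : H)‖ := by simpa using hne
    constructor
    · have := hpos v
      rw [hv, real_inner_smul_right, real_inner_self_eq_norm_sq] at this
      by_contra h
      push Not at h
      have : μ * ‖(v : H)‖ ^ 2 < 0 := mul_neg_of_neg_of_pos h (by positivity)
      linarith
    · have := T.le_opNorm v
      rw [hv, norm_smul, Real.norm_eq_abs] at this
      exact (le_abs_self μ).trans (le_of_mul_le_mul_right this hv0)
  have hsum : Summable fun μ : ℝ => μ ^ s • (E μ).starProjection x := by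
    have := (hE.summable_iff_norm_sq_summable
      (fun μ : ℝ => μ ^ s • (E μ).orthogonalProjectionOnto x)).2 ?_
    · exact this
    · refine Summable.of_nonneg_of_le (fun _ => sq_nonneg _) (fun μ => ?_)
        (hbessel.mul_left ((‖T‖ ^ s) ^ 2))
      by_cases hne : (E μ).orthogonalProjectionOnto x = 0
      · simp [hne]
      · obtain ⟨h1, h2⟩ := hmem μ hne
        rw [norm_smul, mul_pow, Real.norm_eq_abs, abs_of_nonneg (Real.rpow_nonneg h1 s)]
        gcongr
  have h1 := (hsum.hasSum.mapL (innerSL ℝ (b i)))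
  -- The vector `b i` lies in a single eigenspace, so pairing with it keeps only the term `μ = m i`.
  have h2 : (fun μ : ℝ => (innerSL ℝ (b i)) (μ ^ s • (E μ).starProjection x)) =
      fun μ => if μ = m i then m i ^ s * ⟪b i, x⟫_ℝ else 0 := by
    funext μ
    rw [innerSL_apply_apply, real_inner_smul_right,
      ← Submodule.inner_starProjection_left_eq_right]
    split_ifs with h
    · have : (E μ).starProjection (b i) = b i := by
        rw [Submodule.starProjection_eq_self_iff, mem_ker_sub_smul_id, hb, h]
      rw [this, h]
    · have : (E μ).starProjection (b i) = 0 := by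
        rw [Submodule.starProjection_apply_eq_zero_iff]
        intro y hy
        have hbi : b i ∈ E (m i) := mem_ker_sub_smul_id.2 (hb i)
        exact hE h ⟨y, hy⟩ ⟨b i, hbi⟩
      rw [this, inner_zero_left, mul_zero]
  rw [h2] at h1
  exact h1.unique (hasSum_ite_eq _ _)

end Eigenbasis

/-! ### Spectral estimates for `(I - η B* B) ^ j` -/

section Spectral

/-- The case `a = 1` follows from Bernoulli: `(1 - x) ^ j (1 + j x) ≤ (1 - x ^ 2) ^ j ≤ 1`, and `(j
+ 1) x ≤ 1 + j x`. General `a` interpolates between this and `(1 - x) ^ j ≤ 1`. -/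
theorem rpow_mul_one_sub_pow_le {x a : ℝ} (hx0 : 0 ≤ x) (hx1 : x ≤ 1) (ha0 : 0 ≤ a) (ha1 : a ≤ 1)
    (j : ℕ) : x ^ a * (1 - x) ^ j ≤ ((j : ℝ) + 1) ^ (-a) := by
  have h1 : 0 ≤ 1 - x := by linarith
  have hj : (0 : ℝ) < (j : ℝ) + 1 := by positivity
  have h2 : (1 - x) ^ j ≤ 1 := pow_le_one₀ h1 (by linarith)
  have h3 : x * (1 - x) ^ j ≤ ((j : ℝ) + 1)⁻¹ := by
    rw [← one_div, le_div_iff₀ hj]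
    have h4 : 1 + (j : ℝ) * x ≤ (1 + x) ^ j := one_add_mul_le_pow (by linarith) j
    have h5 : (1 - x) ^ j * (1 + x) ^ j ≤ 1 := by
      rw [← mul_pow]
      exact pow_le_one₀ (by nlinarith) (by nlinarith)
    have h6 : 0 ≤ (1 - x) ^ j := pow_nonneg h1 j
    nlinarith [mul_le_mul_of_nonneg_left h4 h6, mul_nonneg h1 h6]
  have h6 : 0 ≤ (1 - x) ^ j := pow_nonneg h1 j
  have h7 : x ^ a * (1 - x) ^ j = (x * (1 - x) ^ j) ^ a * ((1 - x) ^ j) ^ (1 - a) := by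
    rw [Real.mul_rpow hx0 h6, mul_assoc, ← Real.rpow_add_of_nonneg h6 ha0 (by linarith)]
    simp
  rw [h7, Real.rpow_neg hj.le, ← Real.inv_rpow hj.le, ← mul_one ((((j : ℝ) + 1)⁻¹) ^ a)]
  refine mul_le_mul (Real.rpow_le_rpow (mul_nonneg hx0 h6) h3 ha0)
    (Real.rpow_le_one h6 h2 (by linarith)) (by positivity) (by positivity)

theorem rpow_mul_one_sub_mul_pow_le {η m a : ℝ} (hη : 0 < η) (hm : 0 ≤ m) (hm1 : η * m ≤ 1)
    (ha0 : 0 ≤ a) (ha1 : a ≤ 1) (j : ℕ) :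
    m ^ a * (1 - η * m) ^ j ≤ (η * ((j : ℝ) + 1)) ^ (-a) := by
  have h := rpow_mul_one_sub_pow_le (mul_nonneg hη.le hm) hm1 ha0 ha1 j
  rw [Real.mul_rpow hη.le hm] at h
  rw [Real.mul_rpow hη.le (by positivity), Real.rpow_neg hη.le, ← div_eq_inv_mul,
    le_div_iff₀ (Real.rpow_pos_of_pos hη a)]
  linarith

variable {H F : Type*} [NormedAddCommGroup H] [InnerProductSpace ℝ H] [CompleteSpace H]
  [NormedAddCommGroup F] [InnerProductSpace ℝ F] [CompleteSpace F]

theorem isSymmetric_adjoint_comp_self (B : H →L[ℝ] F) :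
    ((B.adjoint ∘L B : H →L[ℝ] H) : H →ₗ[ℝ] H).IsSymmetric :=
  (ContinuousLinearMap.isPositive_adjoint_comp_self B).isSymmetric

theorem inner_adjoint_comp_self (B : H →L[ℝ] F) (x y : H) :
    ⟪x, (B.adjoint ∘L B) y⟫_ℝ = ⟪B x, B y⟫_ℝ := by
  rw [ContinuousLinearMap.comp_apply, ContinuousLinearMap.adjoint_inner_right]

variable {B : H →L[ℝ] F} {ι : Type*} {b : HilbertBasis ι ℝ H} {m : ι → ℝ} {η : ℝ}

theorem eigenvalue_eq_norm_sq (hb : ∀ i, (B.adjoint ∘L B) (b i) = m i • b i) (i : ι) :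
    m i = ‖B (b i)‖ ^ 2 := by
  rw [← real_inner_self_eq_norm_sq, ← inner_adjoint_comp_self, hb, real_inner_smul_right,
    real_inner_self_eq_norm_sq, b.orthonormal.1 i]
  simp

theorem eigenvalue_nonneg (hb : ∀ i, (B.adjoint ∘L B) (b i) = m i • b i) (i : ι) : 0 ≤ m i := by
  rw [eigenvalue_eq_norm_sq hb]; positivity

theorem eigenvalue_le (hb : ∀ i, (B.adjoint ∘L B) (b i) = m i • b i) (i : ι) :
    m i ≤ ‖B‖ ^ 2 := by
  rw [eigenvalue_eq_norm_sq hb]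
  have := B.le_opNorm (b i)
  rw [b.orthonormal.1 i, mul_one] at this
  gcongr

theorem hasSum_norm_sq_apply (hb : ∀ i, (B.adjoint ∘L B) (b i) = m i • b i) (x : H) :
    HasSum (fun i => m i * ⟪b i, x⟫_ℝ ^ 2) (‖B x‖ ^ 2) := by
  have h := b.hasSum_inner_mul_inner x ((B.adjoint ∘L B) x)
  rw [inner_adjoint_comp_self, real_inner_self_eq_norm_sq] at h
  have h' : ∀ i, m i * ⟪b i, x⟫_ℝ ^ 2 = ⟪x, b i⟫_ℝ * ⟪b i, (B.adjoint ∘L B) x⟫_ℝ := fun i => by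
    rw [inner_eigenbasis_apply (isSymmetric_adjoint_comp_self B) hb, real_inner_comm (b i) x]
    ring
  simpa only [h'] using h

omit [CompleteSpace H] in
theorem norm_le_of_coord {K : ℝ} (hK : 0 ≤ K) {x y : H}
    (h : ∀ i, ⟪b i, y⟫_ℝ ^ 2 ≤ K ^ 2 * ⟪b i, x⟫_ℝ ^ 2) : ‖y‖ ≤ K * ‖x‖ := by
  refine le_of_sq_le_sq ?_ (by positivity)
  rw [mul_pow]
  exact hasSum_le h (hasSum_inner_sq b y) ((hasSum_inner_sq b x).mul_left _)

theorem norm_apply_le_of_coord (hb : ∀ i, (B.adjoint ∘L B) (b i) = m i • b i)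
    {K : ℝ} (hK : 0 ≤ K) {x y : H}
    (h : ∀ i, m i * ⟪b i, y⟫_ℝ ^ 2 ≤ K ^ 2 * ⟪b i, x⟫_ℝ ^ 2) : ‖B y‖ ≤ K * ‖x‖ := by
  refine le_of_sq_le_sq ?_ (by positivity)
  rw [mul_pow]
  exact hasSum_le h (hasSum_norm_sq_apply hb y) ((hasSum_inner_sq b x).mul_left _)

/-- Here `y = q(T) B* v`. Comparing coordinates gives `‖B y‖ ^ 2 ≤ K ⟪y, B* v⟫ = K ⟪B y, v⟫`, and
one factor `‖B y‖` cancels. No functional calculus for `B B*` is needed. -/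
theorem norm_apply_adjoint_le_of_coord (hb : ∀ i, (B.adjoint ∘L B) (b i) = m i • b i)
    {K : ℝ} {q : ι → ℝ} (hq : ∀ i, 0 ≤ q i) (hqK : ∀ i, m i * q i ≤ K)
    {y : H} {v : F} (h : ∀ i, ⟪b i, y⟫_ℝ = q i * ⟪b i, B.adjoint v⟫_ℝ) (hK : 0 ≤ K) :
    ‖B y‖ ≤ K * ‖v‖ := by
  have h1 := (b.hasSum_inner_mul_inner y (B.adjoint v)).mul_left K
  have h2 : ‖B y‖ ^ 2 ≤ K * ⟪y, B.adjoint v⟫_ℝ := by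
    refine hasSum_le (fun i => ?_) (hasSum_norm_sq_apply hb y) h1
    rw [real_inner_comm (b i) y, h]
    have := mul_le_mul_of_nonneg_right (hqK i)
      (mul_nonneg (hq i) (sq_nonneg ⟪b i, B.adjoint v⟫_ℝ))
    nlinarith
  rw [ContinuousLinearMap.adjoint_inner_right] at h2
  have h3 := real_inner_le_norm (B y) v
  have h4 : ‖B y‖ * ‖B y‖ ≤ (K * ‖v‖) * ‖B y‖ := by nlinarith
  rcases (norm_nonneg (B y)).eq_or_lt with h5 | h5
  · rw [← h5]; positivity
  · exact le_of_mul_le_mul_right h4 h5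

theorem inner_one_sub_smul_pow (hb : ∀ i, (B.adjoint ∘L B) (b i) = m i • b i) (j : ℕ) (i : ι)
    (x : H) :
    ⟪b i, ((1 - η • (B.adjoint ∘L B)) ^ j) x⟫_ℝ = (1 - η * m i) ^ j * ⟪b i, x⟫_ℝ := by
  induction j with
  | zero => simp
  | succ j ih =>
    rw [pow_succ', mul_apply_eq_comp, sub_apply, inner_sub_right,
      smul_apply, real_inner_smul_right, one_apply_eq_self,
      inner_eigenbasis_apply (isSymmetric_adjoint_comp_self B) hb, ih]
    ring

theorem sq_coord_le {η m : ℝ} (hη : 0 < η) (hm : 0 ≤ m) (hm1 : η * m ≤ 1) {a : ℝ}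
    (ha0 : 0 ≤ a) (ha1 : a ≤ 1) (j : ℕ) (c : ℝ) :
    (m ^ a * ((1 - η * m) ^ j * c)) ^ 2 ≤ ((η * ((j : ℝ) + 1)) ^ (-a)) ^ 2 * c ^ 2 := by
  rw [← mul_assoc, mul_pow]
  have h := rpow_mul_one_sub_mul_pow_le hη hm hm1 ha0 ha1 j
  have h0 : 0 ≤ (1 - η * m) ^ j := pow_nonneg (by linarith) j
  gcongr

theorem sq_rpow_half {m : ℝ} (hm : 0 ≤ m) : (m ^ (1 / 2 : ℝ)) ^ 2 = m := by
  rw [← Real.sqrt_eq_rpow, Real.sq_sqrt hm]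

variable (hη : 0 < η) (hηm : ∀ i, η * m i ≤ 1)
include hη hηm

theorem norm_one_sub_smul_pow_le (hb : ∀ i, (B.adjoint ∘L B) (b i) = m i • b i) (j : ℕ) (x : H) :
    ‖((1 - η • (B.adjoint ∘L B)) ^ j) x‖ ≤ ‖x‖ := by
  rw [← one_mul ‖x‖]
  refine norm_le_of_coord (b := b) zero_le_one fun i => ?_
  rw [inner_one_sub_smul_pow hb]
  simpa using sq_coord_le hη (eigenvalue_nonneg hb i) (hηm i) le_rfl zero_le_one j _

theorem norm_apply_one_sub_smul_pow_le (hb : ∀ i, (B.adjoint ∘L B) (b i) = m i • b i) (j : ℕ)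
    (x : H) :
    ‖B (((1 - η • (B.adjoint ∘L B)) ^ j) x)‖ ≤ (η * ((j : ℝ) + 1)) ^ (-(1 / 2) : ℝ) * ‖x‖ := by
  refine norm_apply_le_of_coord hb (by positivity) fun i => ?_
  rw [inner_one_sub_smul_pow hb]
  have hm := eigenvalue_nonneg hb i
  have := sq_coord_le hη hm (hηm i) (a := 1 / 2) (by norm_num) (by norm_num) j ⟪b i, x⟫_ℝ
  rw [mul_pow, sq_rpow_half hm] at this
  exact this

/-- Dual to `norm_apply_one_sub_smul_pow_le`, the power of `I - η T` being self-adjoint. -/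
theorem norm_one_sub_smul_pow_adjoint_le (hb : ∀ i, (B.adjoint ∘L B) (b i) = m i • b i) (j : ℕ)
    (v : F) :
    ‖((1 - η • (B.adjoint ∘L B)) ^ j) (B.adjoint v)‖
      ≤ (η * ((j : ℝ) + 1)) ^ (-(1 / 2) : ℝ) * ‖v‖ := by
  set y := ((1 - η • (B.adjoint ∘L B)) ^ j) (B.adjoint v) with hy
  set K := (η * ((j : ℝ) + 1)) ^ (-(1 / 2) : ℝ)
  have h1 : ‖y‖ ^ 2 = ⟪B (((1 - η • (B.adjoint ∘L B)) ^ j) y), v⟫_ℝ := by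
    rw [← ContinuousLinearMap.adjoint_inner_right, ← real_inner_self_eq_norm_sq]
    refine (b.hasSum_inner_mul_inner y y).unique ?_
    convert b.hasSum_inner_mul_inner (((1 - η • (B.adjoint ∘L B)) ^ j) y) (B.adjoint v) using 2
      with i
    have hyi : ⟪b i, y⟫_ℝ = (1 - η * m i) ^ j * ⟪b i, B.adjoint v⟫_ℝ :=
      inner_one_sub_smul_pow hb j i _
    rw [real_inner_comm (b i) (((1 - η • (B.adjoint ∘L B)) ^ j) y),
      inner_one_sub_smul_pow hb j i y, real_inner_comm (b i) y, hyi]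
    ring
  have h2 := real_inner_le_norm (B (((1 - η • (B.adjoint ∘L B)) ^ j) y)) v
  have h3 := norm_apply_one_sub_smul_pow_le hη hηm hb j y
  have h4 : ‖y‖ * ‖y‖ ≤ (K * ‖v‖) * ‖y‖ := by
    have := mul_le_mul_of_nonneg_right h3 (norm_nonneg v)
    nlinarith
  rcases (norm_nonneg y).eq_or_lt with h5 | h5
  · rw [← h5]; positivity
  · exact le_of_mul_le_mul_right h4 h5

theorem norm_apply_one_sub_smul_pow_adjoint_le (hb : ∀ i, (B.adjoint ∘L B) (b i) = m i • b i)
    (j : ℕ) (v : F) :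
    ‖B (((1 - η • (B.adjoint ∘L B)) ^ j) (B.adjoint v))‖
      ≤ (η * ((j : ℝ) + 1)) ^ (-1 : ℝ) * ‖v‖ := by
  refine norm_apply_adjoint_le_of_coord hb (q := fun i => (1 - η * m i) ^ j)
    (fun i => pow_nonneg (by linarith [hηm i]) j) (fun i => ?_)
    (fun i => inner_one_sub_smul_pow hb j i _) (by positivity)
  have := rpow_mul_one_sub_mul_pow_le hη (eigenvalue_nonneg hb i) (hηm i) zero_le_one le_rfl j
  rwa [Real.rpow_one] at this

/-- The geometric sum telescopes, `m ∑ η (1 - η m) ^ s = 1 - (1 - η m) ^ t ≤ 1`. Bounding the terms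
one by one, each of order `1 / (s + 1)`, would cost a logarithm. -/
theorem norm_apply_sum_one_sub_smul_pow_adjoint_le
    (hb : ∀ i, (B.adjoint ∘L B) (b i) = m i • b i) (t : ℕ) (v : F) :
    ‖B (∑ s ∈ Finset.range t, η • ((1 - η • (B.adjoint ∘L B)) ^ (t - 1 - s)) (B.adjoint v))‖
      ≤ ‖v‖ := by
  rw [Finset.sum_range_reflect
    (fun s => η • ((1 - η • (B.adjoint ∘L B)) ^ s) (B.adjoint v)) t]
  have h0 : ∀ i, 0 ≤ 1 - η * m i := fun i => by linarith [hηm i]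
  rw [← one_mul ‖v‖]
  refine norm_apply_adjoint_le_of_coord hb
    (q := fun i => ∑ s ∈ Finset.range t, η * (1 - η * m i) ^ s)
    (fun i => Finset.sum_nonneg fun s _ => mul_nonneg hη.le (pow_nonneg (h0 i) s))
    (fun i => ?_) (fun i => ?_) zero_le_one
  · have h1 : m i * ∑ s ∈ Finset.range t, η * (1 - η * m i) ^ s = 1 - (1 - η * m i) ^ t := by
      have := mul_neg_geom_sum (1 - η * m i) t
      rw [← this, ← Finset.mul_sum]
      ring
    rw [h1]
    linarith [pow_nonneg (h0 i) t]
  · rw [inner_sum, Finset.sum_mul]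
    refine Finset.sum_congr rfl fun s _ => ?_
    rw [real_inner_smul_right, inner_one_sub_smul_pow hb, mul_assoc]

/-- Of `T ^ r` only `T ^ a` is traded for decay; the surplus `T ^ (r - a)` is bounded by `K ^ (r -
a)`. -/
theorem norm_one_sub_smul_pow_opPow_le (hb : ∀ i, (B.adjoint ∘L B) (b i) = m i • b i)
    {K r a : ℝ} (hmK : ∀ i, m i ≤ K) (ha0 : 0 ≤ a) (ha1 : a ≤ 1) (har : a ≤ r) (j : ℕ) (g : H) :
    ‖((1 - η • (B.adjoint ∘L B)) ^ j) (opPow (B.adjoint ∘L B) r g)‖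
      ≤ K ^ (r - a) * (η * ((j : ℝ) + 1)) ^ (-a) * ‖g‖ := by
  -- The sign of `K` is read off an eigenvalue; without basis vectors the space is trivial.
  rcases isEmpty_or_nonempty ι with hι | ⟨⟨i₀⟩⟩
  · have h : ∀ x : H, ‖x‖ ^ 2 = 0 := fun x => (hasSum_inner_sq b x).unique hasSum_empty
    have h' : ∀ x : H, ‖x‖ = 0 := fun x => pow_eq_zero_iff two_ne_zero |>.1 (h x)
    rw [h', h' g, mul_zero]
  have hK : 0 ≤ K := (eigenvalue_nonneg hb i₀).trans (hmK i₀)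
  refine norm_le_of_coord (b := b) (by positivity) fun i => ?_
  have hm := eigenvalue_nonneg hb i
  rw [inner_one_sub_smul_pow hb, inner_opPow (isSymmetric_adjoint_comp_self B)
    (fun x => by rw [inner_adjoint_comp_self]; exact real_inner_self_nonneg) hb
    (ha0.trans har), show r = a + (r - a) by ring, Real.rpow_add_of_nonneg hm ha0 (by linarith)]
  have h1 := sq_coord_le hη hm (hηm i) ha0 ha1 j ⟪b i, g⟫_ℝ
  have h2 : (m i ^ (r - a)) ^ 2 ≤ (K ^ (r - a)) ^ 2 := by
    have := Real.rpow_le_rpow hm (hmK i) (show 0 ≤ r - a by linarith)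
    gcongr
  calc _ = (m i ^ (r - a)) ^ 2 * (m i ^ a * ((1 - η * m i) ^ j * ⟪b i, g⟫_ℝ)) ^ 2 := by ring
    _ ≤ (K ^ (r - a)) ^ 2 * (((η * ((j : ℝ) + 1)) ^ (-a)) ^ 2 * ⟪b i, g⟫_ℝ ^ 2) :=
      mul_le_mul h2 h1 (sq_nonneg _) (sq_nonneg _)
    _ = _ := by rw [show a + (r - a) - a = r - a by ring]; ring

/-- `B` acts as a further half power of `T`. The total exponent `a + 1/2` has to stay below `1`,
which is why the rate uses `a ≤ 1/2`. -/
theorem norm_apply_one_sub_smul_pow_opPow_le (hb : ∀ i, (B.adjoint ∘L B) (b i) = m i • b i)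
    {K r a : ℝ} (hmK : ∀ i, m i ≤ K) (ha0 : 0 ≤ a) (ha1 : a ≤ 1 / 2) (har : a ≤ r) (j : ℕ)
    (g : H) :
    ‖B (((1 - η • (B.adjoint ∘L B)) ^ j) (opPow (B.adjoint ∘L B) r g))‖
      ≤ K ^ (r - a) * (η * ((j : ℝ) + 1)) ^ (-(a + 1 / 2)) * ‖g‖ := by
  rcases isEmpty_or_nonempty ι with hι | ⟨⟨i₀⟩⟩
  · have h : ∀ x : H, ‖x‖ ^ 2 = 0 := fun x => (hasSum_inner_sq b x).unique hasSum_empty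
    have h' : ∀ x : H, x = 0 := fun x => norm_eq_zero.1 (pow_eq_zero_iff two_ne_zero |>.1 (h x))
    rw [h' (((1 - η • (B.adjoint ∘L B)) ^ j) _), h' g, map_zero, norm_zero, norm_zero, mul_zero]
  have hK : 0 ≤ K := (eigenvalue_nonneg hb i₀).trans (hmK i₀)
  refine norm_apply_le_of_coord hb (by positivity) fun i => ?_
  have hm := eigenvalue_nonneg hb i
  rw [inner_one_sub_smul_pow hb, inner_opPow (isSymmetric_adjoint_comp_self B)
    (fun x => by rw [inner_adjoint_comp_self]; exact real_inner_self_nonneg) hb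
    (ha0.trans har), show r = a + (r - a) by ring, Real.rpow_add_of_nonneg hm ha0 (by linarith)]
  have h1 := sq_coord_le hη hm (hηm i) (a := a + 1 / 2) (by linarith) (by linarith) j ⟪b i, g⟫_ℝ
  rw [Real.rpow_add_of_nonneg hm ha0 (by norm_num)] at h1
  have h2 : (m i ^ (r - a)) ^ 2 ≤ (K ^ (r - a)) ^ 2 := by
    have := Real.rpow_le_rpow hm (hmK i) (show 0 ≤ r - a by linarith)
    gcongr
  calc _ = (m i ^ (r - a)) ^ 2 *
        (m i ^ a * m i ^ (1 / 2 : ℝ) * ((1 - η * m i) ^ j * ⟪b i, g⟫_ℝ)) ^ 2 := by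
        nth_rewrite 1 [← sq_rpow_half hm]; ring
    _ ≤ (K ^ (r - a)) ^ 2 * (((η * ((j : ℝ) + 1)) ^ (-(a + 1 / 2))) ^ 2 * ⟪b i, g⟫_ℝ ^ 2) :=
      mul_le_mul h2 h1 (sq_nonneg _) (sq_nonneg _)
    _ = _ := by rw [show a + (r - a) - a = r - a by ring]; ring

omit hη hηm

theorem norm_opPow_zero (hb : ∀ i, (B.adjoint ∘L B) (b i) = m i • b i) (x : H) :
    ‖opPow (B.adjoint ∘L B) 0 x‖ = ‖x‖ := by
  rw [← sq_eq_sq₀ (norm_nonneg _) (norm_nonneg _)]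
  refine (hasSum_inner_sq b _).unique ?_
  convert hasSum_inner_sq b x using 2 with i
  rw [inner_opPow (isSymmetric_adjoint_comp_self B)
    (fun x => by rw [inner_adjoint_comp_self]; exact real_inner_self_nonneg) hb le_rfl]
  simp

/-- Both squared norms equal `∑ m i ⟪b i, x⟫ ^ 2`. The error for `u = 1/2` can therefore be followed
as `‖B e‖`. -/
theorem norm_opPow_half (hb : ∀ i, (B.adjoint ∘L B) (b i) = m i • b i) (x : H) :
    ‖opPow (B.adjoint ∘L B) (1 / 2) x‖ = ‖B x‖ := by
  rw [← sq_eq_sq₀ (norm_nonneg _) (norm_nonneg _)]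
  refine (hasSum_inner_sq b _).unique ?_
  convert hasSum_norm_sq_apply hb x using 2 with i
  rw [inner_opPow (isSymmetric_adjoint_comp_self B)
    (fun x => by rw [inner_adjoint_comp_self]; exact real_inner_self_nonneg) hb (by norm_num),
    mul_pow, sq_rpow_half (eigenvalue_nonneg hb i)]

end Spectral

/-! ### Discrete convolutions of power weights -/

section Convolution

/-- The value `∑ j ≥ 1, j ^ (-(1 + θ))`. -/
def zetaSum (θ : ℝ) : ℝ := ∑' j : ℕ, ((j : ℝ) + 1) ^ (-(1 + θ))

theorem summable_zetaSum {θ : ℝ} (hθ : 0 < θ) :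
    Summable fun j : ℕ => ((j : ℝ) + 1) ^ (-(1 + θ)) := by
  have := (summable_nat_add_iff (f := fun j : ℕ => (j : ℝ) ^ (-(1 + θ))) 1).2
    (Real.summable_nat_rpow.2 (by linarith))
  simpa using this

theorem zetaSum_nonneg (θ : ℝ) : 0 ≤ zetaSum θ := tsum_nonneg fun _ => by positivity

theorem sum_range_rpow_le_zetaSum {θ : ℝ} (hθ : 0 < θ) (k : ℕ) :
    ∑ j ∈ Finset.range k, ((j : ℝ) + 1) ^ (-(1 + θ)) ≤ zetaSum θ :=
  (summable_zetaSum hθ).sum_le_tsum _ fun _ _ => by positivity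

theorem sum_range_sub (f : ℝ → ℝ) (k : ℕ) :
    ∑ s ∈ Finset.range k, f ((k : ℝ) - s) = ∑ j ∈ Finset.range k, f ((j : ℝ) + 1) := by
  rw [← Finset.sum_range_reflect]
  refine Finset.sum_congr rfl fun s hs => ?_
  have hs' := Finset.mem_range.1 hs
  congr 1
  rw [Nat.sub_sub, Nat.cast_sub (by omega)]
  push_cast
  ring

/-- The larger variable absorbs the weight `(x + y) ^ w`. What is left of it has a nonpositive
exponent and may be replaced by the smaller variable. -/
theorem add_rpow_mul_le {x y p q w θ : ℝ} (hx : 1 ≤ x) (hy : 1 ≤ y) (hw0 : 0 ≤ w) (hwp : w ≤ p)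
    (hwq : w ≤ q) (hθ : 1 + θ ≤ p + q - w) :
    (x + y) ^ w * (x ^ (-p) * y ^ (-q)) ≤ 2 ^ w * (x ^ (-(1 + θ)) + y ^ (-(1 + θ))) := by
  wlog h : y ≤ x generalizing x y p q
  · have := this (x := y) (y := x) (p := q) (q := p) hy hx hwq hwp (by linarith)
      (le_of_lt (not_le.1 h))
    rw [add_comm x y, mul_comm (x ^ (-p)), add_comm (x ^ (-(1 + θ)))]
    exact this
  have hx0 : 0 < x := by linarith
  have hy0 : 0 < y := by linarith
  have h1 : (x + y) ^ w ≤ 2 ^ w * x ^ w := by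
    rw [← Real.mul_rpow (by norm_num) hx0.le]
    exact Real.rpow_le_rpow (by positivity) (by linarith) hw0
  have h2 : x ^ w * x ^ (-p) ≤ y ^ (w - p) := by
    rw [← Real.rpow_add hx0, ← sub_eq_add_neg]
    exact Real.rpow_le_rpow_of_nonpos hy0 h (by linarith)
  have h3 : y ^ (w - p) * y ^ (-q) ≤ y ^ (-(1 + θ)) := by
    rw [← Real.rpow_add hy0]
    exact Real.rpow_le_rpow_of_exponent_le hy (by linarith)
  calc (x + y) ^ w * (x ^ (-p) * y ^ (-q)) ≤ 2 ^ w * x ^ w * (x ^ (-p) * y ^ (-q)) := by gcongr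
    _ = 2 ^ w * ((x ^ w * x ^ (-p)) * y ^ (-q)) := by ring
    _ ≤ 2 ^ w * (y ^ (w - p) * y ^ (-q)) := by gcongr
    _ ≤ 2 ^ w * (x ^ (-(1 + θ)) + y ^ (-(1 + θ))) := by
      have : 0 ≤ x ^ (-(1 + θ)) := by positivity
      gcongr
      linarith

/-- Since `k + 1 = (k - s) + (s + 1)`, the target weight can be distributed over the two factors of
each term, leaving two summable series. -/
theorem sum_sub_rpow_mul_rpow_le {p q w θ : ℝ} (hθ0 : 0 < θ) (hw0 : 0 ≤ w) (hwp : w ≤ p)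
    (hwq : w ≤ q) (hθ : 1 + θ ≤ p + q - w) (k : ℕ) :
    ∑ s ∈ Finset.range k, ((k : ℝ) - s) ^ (-p) * ((s : ℝ) + 1) ^ (-q)
      ≤ 2 ^ (w + 1) * zetaSum θ * ((k : ℝ) + 1) ^ (-w) := by
  have hk : (0 : ℝ) < (k : ℝ) + 1 := by positivity
  rw [Real.rpow_neg hk.le, ← div_eq_mul_inv, le_div_iff₀ (Real.rpow_pos_of_pos hk w),
    Finset.sum_mul]
  calc _ ≤ ∑ s ∈ Finset.range k,
        2 ^ w * (((k : ℝ) - s) ^ (-(1 + θ)) + ((s : ℝ) + 1) ^ (-(1 + θ))) := by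
        refine Finset.sum_le_sum fun s hs => ?_
        have hs' : (s : ℝ) + 1 ≤ k := by exact_mod_cast Finset.mem_range.1 hs
        have hs0 : (0 : ℝ) ≤ s := Nat.cast_nonneg s
        have := add_rpow_mul_le (x := (k : ℝ) - s) (y := (s : ℝ) + 1) (by linarith) (by linarith)
          hw0 hwp hwq hθ
        rw [show (k : ℝ) - s + (s + 1) = k + 1 by ring] at this
        linarith
    _ = 2 ^ w * (∑ j ∈ Finset.range k, ((j : ℝ) + 1) ^ (-(1 + θ))
          + ∑ j ∈ Finset.range k, ((j : ℝ) + 1) ^ (-(1 + θ))) := by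
        rw [← Finset.mul_sum, Finset.sum_add_distrib, sum_range_sub fun x => x ^ (-(1 + θ))]
    _ ≤ 2 ^ w * (zetaSum θ + zetaSum θ) := by
        have := sum_range_rpow_le_zetaSum hθ0 k
        gcongr
    _ = _ := by rw [Real.rpow_add (by norm_num), Real.rpow_one]; ring

theorem sum_range_rpow_neg_half_le (k : ℕ) :
    ∑ j ∈ Finset.range k, ((j : ℝ) + 1) ^ (-(1 / 2) : ℝ) ≤ 2 * (k : ℝ) ^ (1 / 2 : ℝ) := by
  simp_rw [Real.rpow_neg (Nat.cast_add_one_pos _).le, ← Real.sqrt_eq_rpow]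
  induction k with
  | zero => simp
  | succ k ih =>
    rw [Finset.sum_range_succ]
    have h1 : 0 < √((k : ℝ) + 1) := Real.sqrt_pos.2 (by positivity)
    have h2 : √((k : ℝ) + 1) ^ 2 = k + 1 := Real.sq_sqrt (by positivity)
    have h3 : √(k : ℝ) ^ 2 = k := Real.sq_sqrt (by positivity)
    have h4 : √(k : ℝ) ≤ √((k : ℝ) + 1) := Real.sqrt_le_sqrt (by linarith)
    have h5 : (√((k : ℝ) + 1))⁻¹ ≤ 2 * √((k : ℝ) + 1) - 2 * √(k : ℝ) := by
      rw [inv_le_iff_one_le_mul₀ h1]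
      nlinarith [sq_nonneg (√((k : ℝ) + 1) - √(k : ℝ))]
    push_cast
    linarith

variable {η a u : ℝ} (hη : 0 < η) (ha : 0 < a) (ha' : a ≤ 1 / 2) (hu : 0 ≤ u) (hu' : u ≤ 1 / 2)
  (k : ℕ)

theorem sub_pos_of_mem_range {k s : ℕ} (hs : s ∈ Finset.range k) : (0 : ℝ) < (k : ℝ) - s := by
  have : (s : ℝ) < k := by exact_mod_cast Finset.mem_range.1 hs
  linarith

include hη in
theorem sum_scaled_eq (p q : ℝ) :
    ∑ s ∈ Finset.range k, η * (η * ((k : ℝ) - s)) ^ (-p) * (η * ((s : ℝ) + 1)) ^ (-q)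
      = η ^ (1 - p - q) *
        ∑ s ∈ Finset.range k, ((k : ℝ) - s) ^ (-p) * ((s : ℝ) + 1) ^ (-q) := by
  rw [Finset.mul_sum]
  refine Finset.sum_congr rfl fun s hs => ?_
  rw [Real.mul_rpow hη.le (sub_pos_of_mem_range hs).le, Real.mul_rpow hη.le (by positivity),
    show 1 - p - q = 1 + -p + -q by ring, Real.rpow_add hη, Real.rpow_add hη, Real.rpow_one]
  ring

include hη ha ha' hu'

include hu in
-- The weights of the quadratic error. The exponents leave `p + q - w = 1 + a`, so the choice `θ = a
-- / 2` has room to spare.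
theorem conv_sq_le :
    ∑ s ∈ Finset.range k,
        η * (η * ((k : ℝ) - s)) ^ (-(1 / 2 + u)) * (η * ((s : ℝ) + 1)) ^ (-(2 * a + 1 / 2))
      ≤ 4 * zetaSum (a / 2) * η ^ (-a) * (η * ((k : ℝ) + 1)) ^ (-(a + u)) := by
  rw [sum_scaled_eq hη]
  have h := sum_sub_rpow_mul_rpow_le (p := 1 / 2 + u) (q := 2 * a + 1 / 2) (w := a + u)
    (θ := a / 2) (by linarith) (by linarith) (by linarith) (by linarith) (by linarith) k
  have h2 : (2 : ℝ) ^ (a + u + 1) ≤ 4 := by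
    calc (2 : ℝ) ^ (a + u + 1) ≤ 2 ^ (2 : ℝ) :=
          Real.rpow_le_rpow_of_exponent_le (by norm_num) (by linarith)
      _ = 4 := by norm_num
  have hz := zetaSum_nonneg (a / 2)
  calc _ ≤ η ^ (1 - (1 / 2 + u) - (2 * a + 1 / 2)) *
        (4 * zetaSum (a / 2) * ((k : ℝ) + 1) ^ (-(a + u))) := by
        gcongr
        refine h.trans ?_
        gcongr
    _ = _ := by
        rw [Real.mul_rpow hη.le (by positivity),
          show 1 - (1 / 2 + u) - (2 * a + 1 / 2) = -a + -(a + u) by ring, Real.rpow_add hη]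
        ring

/-- Deliberately not sharp in `τ`: the decay of the error is given up for a factor `η ^ (-a)`, which
will meet `P` in the bounded product `P η ^ (-a)`. Used for noise times error. -/
theorem conv_le :
    ∑ s ∈ Finset.range k,
        η * (η * ((k : ℝ) - s)) ^ (-(1 / 2 + u)) * (η * ((s : ℝ) + 1)) ^ (-a)
      ≤ 2 * zetaSum (a / 2) * η ^ (-a) * (η * ((k : ℝ) + 1)) ^ (1 / 2 - u) := by
  rw [sum_scaled_eq hη]
  have h := sum_sub_rpow_mul_rpow_le (p := 1) (q := a) (w := 0)
    (θ := a / 2) (by linarith) (by linarith) (by linarith) (by linarith) (by linarith) k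
  have h1 : ∑ s ∈ Finset.range k, ((k : ℝ) - s) ^ (-(1 / 2 + u)) * ((s : ℝ) + 1) ^ (-a)
      ≤ ((k : ℝ) + 1) ^ (1 / 2 - u) * (2 * zetaSum (a / 2)) := by
    refine le_trans ?_ (mul_le_mul_of_nonneg_left (h.trans_eq (by simp)) (by positivity))
    rw [Finset.mul_sum]
    refine Finset.sum_le_sum fun s hs => ?_
    have hp := sub_pos_of_mem_range hs
    rw [show -(1 / 2 + u) = (1 / 2 - u) + -1 by ring, Real.rpow_add hp, ← mul_assoc]
    have : ((k : ℝ) - s) ^ (1 / 2 - u) ≤ ((k : ℝ) + 1) ^ (1 / 2 - u) :=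
      Real.rpow_le_rpow hp.le (by linarith [Nat.cast_nonneg (α := ℝ) s]) (by linarith)
    gcongr
  calc _ ≤ η ^ (1 - (1 / 2 + u) - a) * (((k : ℝ) + 1) ^ (1 / 2 - u) * (2 * zetaSum (a / 2))) := by
        gcongr
    _ = _ := by
        rw [Real.mul_rpow hη.le (by positivity),
          show 1 - (1 / 2 + u) - a = -a + (1 / 2 - u) by ring, Real.rpow_add hη]
        ring

/-- Keeps half of the decay `a`, the other half avoiding a logarithm at `u = 1/2`. The retained `τ ^
(-a/2)` is what makes the covariance term negligible. -/
theorem conv_le' :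
    ∑ s ∈ Finset.range k,
        η * (η * ((k : ℝ) - s)) ^ (-(1 / 2 + u)) * (η * ((s : ℝ) + 1)) ^ (-a)
      ≤ 4 * zetaSum (a / 2) * η ^ (-(a / 2)) * (η * ((k : ℝ) + 1)) ^ (1 / 2 - u - a / 2) := by
  rw [sum_scaled_eq hη]
  have hk : (0 : ℝ) < (k : ℝ) + 1 := by positivity
  have h := sum_sub_rpow_mul_rpow_le (p := 1 + a / 2) (q := a) (w := a)
    (θ := a / 2) (by linarith) (by linarith) (by linarith) (by linarith) (by linarith) k
  have h2 : (2 : ℝ) ^ (a + 1) ≤ 4 := by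
    calc (2 : ℝ) ^ (a + 1) ≤ 2 ^ (2 : ℝ) :=
          Real.rpow_le_rpow_of_exponent_le (by norm_num) (by linarith)
      _ = 4 := by norm_num
  have hz := zetaSum_nonneg (a / 2)
  have h1 : ∑ s ∈ Finset.range k, ((k : ℝ) - s) ^ (-(1 / 2 + u)) * ((s : ℝ) + 1) ^ (-a)
      ≤ ((k : ℝ) + 1) ^ (1 / 2 - u + a / 2) *
        (4 * zetaSum (a / 2) * ((k : ℝ) + 1) ^ (-a)) := by
    refine le_trans ?_ (mul_le_mul_of_nonneg_left
      (h.trans (by gcongr : _ ≤ 4 * zetaSum (a / 2) * ((k : ℝ) + 1) ^ (-a))) (by positivity))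
    rw [Finset.mul_sum]
    refine Finset.sum_le_sum fun s hs => ?_
    have hp := sub_pos_of_mem_range hs
    rw [show -(1 / 2 + u) = (1 / 2 - u + a / 2) + -(1 + a / 2) by ring, Real.rpow_add hp,
      ← mul_assoc]
    have : ((k : ℝ) - s) ^ (1 / 2 - u + a / 2) ≤ ((k : ℝ) + 1) ^ (1 / 2 - u + a / 2) :=
      Real.rpow_le_rpow hp.le (by linarith [Nat.cast_nonneg (α := ℝ) s]) (by linarith)
    gcongr
  calc _ ≤ η ^ (1 - (1 / 2 + u) - a) * (((k : ℝ) + 1) ^ (1 / 2 - u + a / 2) *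
        (4 * zetaSum (a / 2) * ((k : ℝ) + 1) ^ (-a))) := by
        gcongr
    _ = _ := by
        rw [Real.mul_rpow hη.le hk.le,
          show 1 - (1 / 2 + u) - a = -(a / 2) + (1 / 2 - u - a / 2) by ring, Real.rpow_add hη,
          show 1 / 2 - u - a / 2 = (1 / 2 - u + a / 2) + -a by ring,
          Real.rpow_add hk (1 / 2 - u + a / 2) (-a)]
        ring

/-- For errors not passing through `B*`: compared with `conv_le'` each weight loses at most `τ ^
(1/2)`. -/
theorem conv_shift_le :
    ∑ s ∈ Finset.range k, η * (η * ((k : ℝ) - s)) ^ (-u) * (η * ((s : ℝ) + 1)) ^ (-a)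
      ≤ 4 * zetaSum (a / 2) * η ^ (-(a / 2)) * (η * ((k : ℝ) + 1)) ^ (1 - u - a / 2) := by
  have hτ : 0 < η * ((k : ℝ) + 1) := by positivity
  rw [show 1 - u - a / 2 = 1 / 2 + (1 / 2 - u - a / 2) by ring, Real.rpow_add hτ]
  have h := mul_le_mul_of_nonneg_left (conv_le' hη ha ha' hu' k)
    (Real.rpow_nonneg hτ.le (1 / 2))
  refine le_trans ?_ (h.trans_eq (by ring))
  rw [Finset.mul_sum]
  refine Finset.sum_le_sum fun s hs => ?_
  have hp := sub_pos_of_mem_range hs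
  have hp' : 0 < η * ((k : ℝ) - s) := by positivity
  rw [show -u = 1 / 2 + -(1 / 2 + u) by ring, Real.rpow_add hp']
  have : (η * ((k : ℝ) - s)) ^ (1 / 2 : ℝ) ≤ (η * ((k : ℝ) + 1)) ^ (1 / 2 : ℝ) := by
    refine Real.rpow_le_rpow hp'.le ?_ (by norm_num)
    gcongr
    linarith [Nat.cast_nonneg (α := ℝ) s]
  calc _ = (η * ((k : ℝ) - s)) ^ (1 / 2 : ℝ) * (η * (η * ((k : ℝ) - s)) ^ (-(1 / 2 + u))
        * (η * ((s : ℝ) + 1)) ^ (-a)) := by ring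
    _ ≤ _ := by gcongr

omit ha ha' in
theorem sum_scaled_rpow_le :
    ∑ s ∈ Finset.range k, η * (η * ((k : ℝ) - s)) ^ (-u)
      ≤ 2 * (η * ((k : ℝ) + 1)) ^ (1 - u) := by
  have hk : (0 : ℝ) < (k : ℝ) + 1 := by positivity
  have h1 : ∀ s ∈ Finset.range k, η * (η * ((k : ℝ) - s)) ^ (-u)
      ≤ η ^ (1 - u) * ((k : ℝ) + 1) ^ (1 / 2 - u) * ((k : ℝ) - s) ^ (-(1 / 2) : ℝ) := by
    intro s hs
    have hp := sub_pos_of_mem_range hs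
    rw [Real.mul_rpow hη.le hp.le, sub_eq_add_neg 1 u, Real.rpow_add hη, Real.rpow_one,
      show -u = (1 / 2 - u) + -(1 / 2) by ring, Real.rpow_add hp]
    have : ((k : ℝ) - s) ^ (1 / 2 - u) ≤ ((k : ℝ) + 1) ^ (1 / 2 - u) :=
      Real.rpow_le_rpow hp.le (by linarith [Nat.cast_nonneg (α := ℝ) s]) (by linarith)
    calc _ = η * η ^ (1 / 2 - u + -(1 / 2)) *
          (((k : ℝ) - s) ^ (1 / 2 - u) * ((k : ℝ) - s) ^ (-(1 / 2) : ℝ)) := by ring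
      _ ≤ η * η ^ (1 / 2 - u + -(1 / 2)) *
          (((k : ℝ) + 1) ^ (1 / 2 - u) * ((k : ℝ) - s) ^ (-(1 / 2) : ℝ)) := by
          have : 0 ≤ ((k : ℝ) - s) ^ (-(1 / 2) : ℝ) := Real.rpow_nonneg hp.le _
          gcongr
      _ = _ := by ring
  refine (Finset.sum_le_sum h1).trans ?_
  rw [← Finset.mul_sum, sum_range_sub fun x => x ^ (-(1 / 2) : ℝ)]
  have h2 := sum_range_rpow_neg_half_le k
  have h3 : (k : ℝ) ^ (1 / 2 : ℝ) ≤ ((k : ℝ) + 1) ^ (1 / 2 : ℝ) :=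
    Real.rpow_le_rpow (by positivity) (by linarith) (by norm_num)
  calc _ ≤ η ^ (1 - u) * ((k : ℝ) + 1) ^ (1 / 2 - u) * (2 * ((k : ℝ) + 1) ^ (1 / 2 : ℝ)) := by
        gcongr
        linarith
    _ = _ := by
        rw [Real.mul_rpow hη.le hk.le, show 1 - u = (1 / 2 - u) + 1 / 2 by ring, Real.rpow_add hk]
        ring

end Convolution

/-! ### Perturbed Landweber iteration -/

section Landweber

/-- The accumulated errors of the perturbed iteration reproduce the bound `P τ ^ (-(a + u))`. -/
theorem accumulated_error_le {η a u lam N P ω Cw CR C₁ C₂ ℓ I ν₁ ω₁ : ℝ} (k : ℕ)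
    (hη : 0 < η) (ha : 0 < a) (ha' : a ≤ 1 / 2) (hu : 0 ≤ u) (hu' : u ≤ 1 / 2)
    (hlam : 0 < lam) (hN0 : 0 ≤ N) (hP0 : 0 ≤ P) (hω0 : 0 ≤ ω) (hCw : 0 ≤ Cw) (hCR : 0 ≤ CR)
    (hC₁ : 0 ≤ C₁) (hC₂ : 0 ≤ C₂) (hℓ : 0 ≤ ℓ)
    (hlamτ : lam * (η * ((k : ℝ) + 1)) ≤ 1)
    (hN : N * (η * ((k : ℝ) + 1)) ^ (a + 1 / 2) ≤ ν₁)
    (hω : ω * (η * ((k : ℝ) + 1)) ^ (1 / 2 + a / 2) ≤ ω₁)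
    (hP : I + 2 * ν₁ + 4 * zetaSum (a / 2) * Cw * P ^ 2 * η ^ (-a)
      + 2 * zetaSum (a / 2) * CR * P * η ^ (-a) * ν₁
      + 4 * zetaSum (a / 2) * C₁ * η ^ (-(a / 2)) * ω₁ * P
      + 2 * ℓ * ν₁ + 4 * zetaSum (a / 2) * C₂ * η ^ (-(a / 2)) * ω₁ * P ≤ P) :
    I * (η * ((k : ℝ) + 1)) ^ (-(a + u)) + 2 * N * (η * ((k : ℝ) + 1)) ^ (1 / 2 - u)
      + ∑ s ∈ Finset.range k, η * (η * ((k : ℝ) - s)) ^ (-(1 / 2 + u)) *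
          (Cw * P ^ 2 * (η * ((s : ℝ) + 1)) ^ (-(2 * a + 1 / 2))
            + (CR * N + C₁ * ω) * P * (η * ((s : ℝ) + 1)) ^ (-a))
      + √lam * ∑ s ∈ Finset.range k, η * (η * ((k : ℝ) - s)) ^ (-u) *
          (ℓ * N + C₂ * ω * P * (η * ((s : ℝ) + 1)) ^ (-a))
      ≤ P * (η * ((k : ℝ) + 1)) ^ (-(a + u)) := by
  set τ := η * ((k : ℝ) + 1) with hτdef
  have hτ : 0 < τ := by positivity
  set Z := zetaSum (a / 2)
  have hZ : 0 ≤ Z := zetaSum_nonneg _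
  have e1 := conv_sq_le hη ha ha' hu hu' k
  have e2 := conv_le hη ha ha' hu' k
  have e3 := conv_le' hη ha ha' hu' k
  have e4 := sum_scaled_rpow_le hη hu' k
  have e5 := conv_shift_le hη ha ha' hu' k
  rw [← hτdef] at e1 e2 e3 e4 e5
  set S1 := ∑ s ∈ Finset.range k,
        η * (η * ((k : ℝ) - s)) ^ (-(1 / 2 + u)) * (η * ((s : ℝ) + 1)) ^ (-(2 * a + 1 / 2))
  set S2 := ∑ s ∈ Finset.range k,
        η * (η * ((k : ℝ) - s)) ^ (-(1 / 2 + u)) * (η * ((s : ℝ) + 1)) ^ (-a)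
  set S4 := ∑ s ∈ Finset.range k, η * (η * ((k : ℝ) - s)) ^ (-u)
  set S5 := ∑ s ∈ Finset.range k, η * (η * ((k : ℝ) - s)) ^ (-u) * (η * ((s : ℝ) + 1)) ^ (-a)
  have h1 : ∑ s ∈ Finset.range k, η * (η * ((k : ℝ) - s)) ^ (-(1 / 2 + u)) *
          (Cw * P ^ 2 * (η * ((s : ℝ) + 1)) ^ (-(2 * a + 1 / 2))
            + (CR * N + C₁ * ω) * P * (η * ((s : ℝ) + 1)) ^ (-a))
      = Cw * P ^ 2 * S1 + (CR * N + C₁ * ω) * P * S2 := by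
    rw [Finset.mul_sum, Finset.mul_sum, ← Finset.sum_add_distrib]
    exact Finset.sum_congr rfl fun s _ => by ring
  have h2 : ∑ s ∈ Finset.range k, η * (η * ((k : ℝ) - s)) ^ (-u) *
          (ℓ * N + C₂ * ω * P * (η * ((s : ℝ) + 1)) ^ (-a))
      = ℓ * N * S4 + C₂ * ω * P * S5 := by
    rw [Finset.mul_sum, Finset.mul_sum, ← Finset.sum_add_distrib]
    exact Finset.sum_congr rfl fun s _ => by ring
  rw [h1, h2]
  set Q := τ ^ (-(a + u)) with hQ
  have hQ0 : 0 ≤ Q := by positivity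
  have n1 : N * τ ^ (1 / 2 - u) ≤ ν₁ * Q := by
    rw [show 1 / 2 - u = (a + 1 / 2) + -(a + u) by ring, Real.rpow_add hτ, ← mul_assoc]
    gcongr
  have w1 : ω * τ ^ (1 / 2 - u - a / 2) ≤ ω₁ * Q := by
    rw [show 1 / 2 - u - a / 2 = (1 / 2 + a / 2) + -(a + u) by ring, Real.rpow_add hτ,
      ← mul_assoc]
    gcongr
  -- The factor `√lam` pays for the half power of `τ` lost by the terms that do not pass through
  -- `B*`.
  have l1 : √lam * τ ^ (1 / 2 : ℝ) ≤ 1 := by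
    rw [← Real.sqrt_eq_rpow, ← Real.sqrt_mul hlam.le]
    exact Real.sqrt_le_one.2 hlamτ
  have n2 : √lam * (N * τ ^ (1 - u)) ≤ ν₁ * Q := by
    rw [show 1 - u = 1 / 2 + (1 / 2 - u) by ring, Real.rpow_add hτ]
    calc _ = (√lam * τ ^ (1 / 2 : ℝ)) * (N * τ ^ (1 / 2 - u)) := by ring
      _ ≤ 1 * (N * τ ^ (1 / 2 - u)) := by gcongr
      _ ≤ _ := by rw [one_mul]; exact n1
  have w2 : √lam * (ω * τ ^ (1 - u - a / 2)) ≤ ω₁ * Q := by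
    rw [show 1 - u - a / 2 = 1 / 2 + (1 / 2 - u - a / 2) by ring, Real.rpow_add hτ]
    calc _ = (√lam * τ ^ (1 / 2 : ℝ)) * (ω * τ ^ (1 / 2 - u - a / 2)) := by ring
      _ ≤ 1 * (ω * τ ^ (1 / 2 - u - a / 2)) := by gcongr
      _ ≤ _ := by rw [one_mul]; exact w1
  have t1 : Cw * P ^ 2 * S1 ≤ 4 * Z * Cw * P ^ 2 * η ^ (-a) * Q := by
    calc _ ≤ Cw * P ^ 2 * (4 * Z * η ^ (-a) * Q) := by gcongr
      _ = _ := by ring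
  have t2 : CR * N * P * S2 ≤ 2 * Z * CR * P * η ^ (-a) * ν₁ * Q := by
    calc _ ≤ CR * N * P * (2 * Z * η ^ (-a) * τ ^ (1 / 2 - u)) := by gcongr
      _ = 2 * Z * CR * P * η ^ (-a) * (N * τ ^ (1 / 2 - u)) := by ring
      _ ≤ 2 * Z * CR * P * η ^ (-a) * (ν₁ * Q) := by gcongr
      _ = _ := by ring
  have t3 : C₁ * ω * P * S2 ≤ 4 * Z * C₁ * η ^ (-(a / 2)) * ω₁ * P * Q := by
    calc _ ≤ C₁ * ω * P * (4 * Z * η ^ (-(a / 2)) * τ ^ (1 / 2 - u - a / 2)) := by gcongr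
      _ = 4 * Z * C₁ * P * η ^ (-(a / 2)) * (ω * τ ^ (1 / 2 - u - a / 2)) := by ring
      _ ≤ 4 * Z * C₁ * P * η ^ (-(a / 2)) * (ω₁ * Q) := by gcongr
      _ = _ := by ring
  have t4 : √lam * (ℓ * N * S4) ≤ 2 * ℓ * ν₁ * Q := by
    calc _ ≤ √lam * (ℓ * N * (2 * τ ^ (1 - u))) := by gcongr
      _ = 2 * ℓ * (√lam * (N * τ ^ (1 - u))) := by ring
      _ ≤ 2 * ℓ * (ν₁ * Q) := by gcongr
      _ = _ := by ring
  have t5 : √lam * (C₂ * ω * P * S5) ≤ 4 * Z * C₂ * η ^ (-(a / 2)) * ω₁ * P * Q := by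
    calc _ ≤ √lam * (C₂ * ω * P * (4 * Z * η ^ (-(a / 2)) * τ ^ (1 - u - a / 2))) := by gcongr
      _ = 4 * Z * C₂ * P * η ^ (-(a / 2)) * (√lam * (ω * τ ^ (1 - u - a / 2))) := by ring
      _ ≤ 4 * Z * C₂ * P * η ^ (-(a / 2)) * (ω₁ * Q) := by gcongr
      _ = _ := by ring
  have hPQ := mul_le_mul_of_nonneg_right hP hQ0
  calc _ = I * Q + 2 * (N * τ ^ (1 / 2 - u)) + (Cw * P ^ 2 * S1 + CR * N * P * S2
          + C₁ * ω * P * S2) + (√lam * (ℓ * N * S4) + √lam * (C₂ * ω * P * S5)) := by ring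
    _ ≤ I * Q + 2 * (ν₁ * Q) + (4 * Z * Cw * P ^ 2 * η ^ (-a) * Q
          + 2 * Z * CR * P * η ^ (-a) * ν₁ * Q + 4 * Z * C₁ * η ^ (-(a / 2)) * ω₁ * P * Q)
          + (2 * ℓ * ν₁ * Q + 4 * Z * C₂ * η ^ (-(a / 2)) * ω₁ * P * Q) := by gcongr
    _ ≤ _ := by linarith

variable {H F : Type*} [NormedAddCommGroup H] [InnerProductSpace ℝ H] [CompleteSpace H]
  [NormedAddCommGroup F] [InnerProductSpace ℝ F] [CompleteSpace F]

omit [CompleteSpace H] in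
theorem affine_recursion (A : H →L[ℝ] H) (e c : ℕ → H) (k : ℕ)
    (h : ∀ s < k, e (s + 1) = A (e s) - c s) :
    e k = (A ^ k) (e 0) - ∑ s ∈ Finset.range k, (A ^ (k - 1 - s)) (c s) := by
  induction k with
  | zero => simp
  | succ k ih =>
    rw [h k (Nat.lt_succ_self k), ih fun s hs => h s (hs.trans (Nat.lt_succ_self k)), map_sub,
      map_sum, Finset.sum_range_succ, pow_succ', mul_apply_eq_comp, sub_sub]
    congr 2
    · refine Finset.sum_congr rfl fun s hs => ?_
      have hs' := Finset.mem_range.1 hs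
      rw [← mul_apply_eq_comp, ← pow_succ']
      congr 2
      omega
    · simp

/-- Error bounds for the iteration `e (s + 1) = (I - η B* B) e s - η (B* (v + y s) + √lam p s)`
with perturbations that are controlled by the errors themselves. -/
theorem perturbed_landweber_bound {B : H →L[ℝ] F} {ι : Type*} {b : HilbertBasis ι ℝ H}
    {m : ι → ℝ} (hb : ∀ i, (B.adjoint ∘L B) (b i) = m i • b i)
    {η a r K D lam N P ω Cw CR C₁ C₂ ℓ ν₁ ω₁ ϱ : ℝ} (kmax : ℕ)
    (hη : 0 < η) (hηm : ∀ i, η * m i ≤ 1) (hK : 0 < K) (hmK : ∀ i, m i ≤ K)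
    (ha : 0 < a) (ha' : a ≤ 1 / 2) (har : a ≤ r)
    (hlam : 0 < lam) (hN0 : 0 ≤ N) (hP0 : 0 ≤ P) (hω0 : 0 ≤ ω) (hCw : 0 ≤ Cw) (hCR : 0 ≤ CR)
    (hC₁ : 0 ≤ C₁) (hC₂ : 0 ≤ C₂) (hℓ : 0 ≤ ℓ)
    (hlamτ : lam * (η * ((kmax : ℝ) + 1)) ≤ 1)
    (hN : N * (η * ((kmax : ℝ) + 1)) ^ (a + 1 / 2) ≤ ν₁)
    (hω : ω * (η * ((kmax : ℝ) + 1)) ^ (1 / 2 + a / 2) ≤ ω₁)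
    (hP : K ^ (r - a) * D + 2 * ν₁ + 4 * zetaSum (a / 2) * Cw * P ^ 2 * η ^ (-a)
      + 2 * zetaSum (a / 2) * CR * P * η ^ (-a) * ν₁
      + 4 * zetaSum (a / 2) * C₁ * η ^ (-(a / 2)) * ω₁ * P
      + 2 * ℓ * ν₁ + 4 * zetaSum (a / 2) * C₂ * η ^ (-(a / 2)) * ω₁ * P ≤ P)
    (hPϱ : P * η ^ (-a) ≤ ϱ)
    {g : H} (hg : ‖g‖ ≤ D) {e : ℕ → H} (he0 : e 0 = -opPow (B.adjoint ∘L B) r g)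
    {v : F} (hv : ‖v‖ ≤ N)
    (hstep : ∀ s < kmax, ‖e s‖ ≤ ϱ → ∃ (y : F) (p : H),
      e (s + 1) = (1 - η • (B.adjoint ∘L B)) (e s) - η • (B.adjoint (v + y) + √lam • p) ∧
      ‖y‖ ≤ Cw * ‖e s‖ * ‖B (e s)‖ + (CR * N + C₁ * ω) * ‖e s‖ ∧
      ‖p‖ ≤ ℓ * N + C₂ * ω * ‖e s‖) :
    ∀ k ≤ kmax, ‖e k‖ ≤ P * (η * ((k : ℝ) + 1)) ^ (-a) ∧
      ‖B (e k)‖ ≤ P * (η * ((k : ℝ) + 1)) ^ (-(a + 1 / 2)) := by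
  intro k
  induction k using Nat.strong_induction_on with
  | _ k ih =>
  intro hk
  have hτ : 0 < η * ((k : ℝ) + 1) := by positivity
  have hτle : η * ((k : ℝ) + 1) ≤ η * ((kmax : ℝ) + 1) := by
    have : (k : ℝ) ≤ kmax := by exact_mod_cast hk
    gcongr
  -- The decomposition of a step is available only near `f†`; the induction hypothesis supplies this
  -- for all earlier errors.
  have hball : ∀ s < k, ‖e s‖ ≤ ϱ := by
    intro s hs
    refine ((ih s hs (hs.le.trans hk)).1.trans ?_).trans hPϱ
    refine mul_le_mul_of_nonneg_left ?_ hP0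
    refine Real.rpow_le_rpow_of_nonpos hη ?_ (by linarith)
    have : (0 : ℝ) ≤ s := Nat.cast_nonneg s
    nlinarith
  have hex : ∀ s, ∃ yp : F × H, s < k →
      e (s + 1) = (1 - η • (B.adjoint ∘L B)) (e s)
        - η • (B.adjoint (v + yp.1) + √lam • yp.2) ∧
      ‖yp.1‖ ≤ Cw * ‖e s‖ * ‖B (e s)‖ + (CR * N + C₁ * ω) * ‖e s‖ ∧
      ‖yp.2‖ ≤ ℓ * N + C₂ * ω * ‖e s‖ := by
    intro s
    by_cases hs : s < k
    · obtain ⟨y, p, h⟩ := hstep s (hs.trans_le hk) (hball s hs)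
      exact ⟨(y, p), fun _ => h⟩
    · exact ⟨(0, 0), fun h => absurd h hs⟩
  choose yp hyp using hex
  set A : H →L[ℝ] H := 1 - η • (B.adjoint ∘L B) with hA
  have hrec := affine_recursion A e
    (fun s => η • (B.adjoint (v + (yp s).1) + √lam • (yp s).2)) k fun s hs => (hyp s hs).1
  have hy : ∀ s ∈ Finset.range k, ‖(yp s).1‖ ≤
      Cw * P ^ 2 * (η * ((s : ℝ) + 1)) ^ (-(2 * a + 1 / 2))
        + (CR * N + C₁ * ω) * P * (η * ((s : ℝ) + 1)) ^ (-a) := by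
    intro s hs
    have hs' := Finset.mem_range.1 hs
    obtain ⟨i1, i2⟩ := ih s hs' (hs'.le.trans hk)
    have hτs : 0 < η * ((s : ℝ) + 1) := by positivity
    refine (hyp s hs').2.1.trans ?_
    calc _ ≤ Cw * (P * (η * ((s : ℝ) + 1)) ^ (-a)) * (P * (η * ((s : ℝ) + 1)) ^ (-(a + 1 / 2)))
          + (CR * N + C₁ * ω) * (P * (η * ((s : ℝ) + 1)) ^ (-a)) := by gcongr
      _ = _ := by
        rw [show -(2 * a + 1 / 2) = -a + -(a + 1 / 2) by ring, Real.rpow_add hτs]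
        ring
  have hp : ∀ s ∈ Finset.range k, ‖(yp s).2‖ ≤
      ℓ * N + C₂ * ω * P * (η * ((s : ℝ) + 1)) ^ (-a) := by
    intro s hs
    have hs' := Finset.mem_range.1 hs
    refine (hyp s hs').2.2.trans ?_
    have := mul_le_mul_of_nonneg_left (ih s hs' (hs'.le.trans hk)).1 (mul_nonneg hC₂ hω0)
    linarith
  have hcast : ∀ s ∈ Finset.range k, ((k - 1 - s : ℕ) : ℝ) + 1 = (k : ℝ) - s := by
    intro s hs
    have hs' := Finset.mem_range.1 hs
    rw [Nat.sub_sub, Nat.cast_sub (by omega)]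
    push_cast
    ring
  -- The noise `v` does not change from step to step and is kept apart from the `y s`, so that its
  -- sum can telescope.
  have hsplit : e k = (A ^ k) (e 0)
      - ∑ s ∈ Finset.range k, η • (A ^ (k - 1 - s)) (B.adjoint v)
      - ∑ s ∈ Finset.range k, η • (A ^ (k - 1 - s)) (B.adjoint (yp s).1)
      - √lam • ∑ s ∈ Finset.range k, η • (A ^ (k - 1 - s)) (yp s).2 := by
    rw [hrec, sub_sub, sub_sub, Finset.smul_sum, ← Finset.sum_add_distrib,
      ← Finset.sum_add_distrib]
    congr 1
    refine Finset.sum_congr rfl fun s _ => ?_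
    simp only [map_smul, map_add, smul_add]
    rw [smul_comm, add_assoc]
  have hν₁ : N * (η * ((k : ℝ) + 1)) ^ (a + 1 / 2) ≤ ν₁ := le_trans (by gcongr) hN
  have hω₁ : ω * (η * ((k : ℝ) + 1)) ^ (1 / 2 + a / 2) ≤ ω₁ := le_trans (by gcongr) hω
  have hlam₁ : lam * (η * ((k : ℝ) + 1)) ≤ 1 := le_trans (by gcongr) hlamτ
  -- Both values of `u` are needed at once: the quadratic term involves `‖e s‖` and `‖B (e s)‖`.
  have key := fun (u : ℝ) (hu : 0 ≤ u) (hu' : u ≤ 1 / 2) =>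
    accumulated_error_le k hη ha ha' hu hu' hlam hN0 hP0 hω0 hCw hCR hC₁ hC₂ hℓ hlam₁ hν₁ hω₁ hP
  have hK0 : 0 ≤ K ^ (r - a) := by positivity
  constructor
  · have k0 := key 0 le_rfl (by norm_num)
    simp only [add_zero, neg_zero, sub_zero, Real.rpow_zero, mul_one] at k0
    refine le_trans ?_ k0
    rw [hsplit]
    refine (norm_sub_le _ _).trans (add_le_add ((norm_sub_le _ _).trans
      (add_le_add ((norm_sub_le _ _).trans (add_le_add ?_ ?_)) ?_)) ?_)
    · rw [he0, map_neg, norm_neg]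
      refine (norm_one_sub_smul_pow_opPow_le hη hηm hb hmK ha.le (by linarith) har k g).trans ?_
      calc _ ≤ K ^ (r - a) * (η * ((k : ℝ) + 1)) ^ (-a) * D := by gcongr
        _ = _ := by ring
    · have h2 := sum_scaled_rpow_le hη (u := 1 / 2) le_rfl k
      rw [show (1 : ℝ) - 1 / 2 = 1 / 2 by norm_num] at h2
      calc _ ≤ ∑ s ∈ Finset.range k, η * (η * ((k : ℝ) - s)) ^ (-(1 / 2) : ℝ) * N := by
            refine (norm_sum_le _ _).trans (Finset.sum_le_sum fun s hs => ?_)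
            rw [norm_smul, Real.norm_of_nonneg hη.le, ← hcast s hs, mul_assoc]
            refine mul_le_mul_of_nonneg_left ?_ hη.le
            refine (norm_one_sub_smul_pow_adjoint_le hη hηm hb _ v).trans ?_
            gcongr
        _ ≤ (2 * (η * ((k : ℝ) + 1)) ^ (1 / 2 : ℝ)) * N := by
            rw [← Finset.sum_mul]
            gcongr
        _ = _ := by ring
    · refine (norm_sum_le _ _).trans (Finset.sum_le_sum fun s hs => ?_)
      rw [norm_smul, Real.norm_of_nonneg hη.le, ← hcast s hs, mul_assoc]
      refine mul_le_mul_of_nonneg_left ?_ hη.le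
      refine (norm_one_sub_smul_pow_adjoint_le hη hηm hb _ _).trans ?_
      have := hy s hs
      gcongr
    · rw [norm_smul, Real.norm_of_nonneg (Real.sqrt_nonneg _)]
      refine mul_le_mul_of_nonneg_left ?_ (Real.sqrt_nonneg _)
      refine (norm_sum_le _ _).trans (Finset.sum_le_sum fun s hs => ?_)
      rw [norm_smul, Real.norm_of_nonneg hη.le]
      exact mul_le_mul_of_nonneg_left
        ((norm_one_sub_smul_pow_le hη hηm hb _ _).trans (hp s hs)) hη.le
  · have k0 := key (1 / 2) (by norm_num) le_rfl
    rw [sub_self, Real.rpow_zero, show (1 / 2 + 1 / 2 : ℝ) = 1 by norm_num] at k0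
    refine le_trans ?_ k0
    rw [hsplit, map_sub, map_sub, map_sub]
    refine (norm_sub_le _ _).trans (add_le_add ((norm_sub_le _ _).trans
      (add_le_add ((norm_sub_le _ _).trans (add_le_add ?_ ?_)) ?_)) ?_)
    · rw [he0, map_neg, map_neg, norm_neg]
      refine (norm_apply_one_sub_smul_pow_opPow_le hη hηm hb hmK ha.le ha' har k g).trans ?_
      calc _ ≤ K ^ (r - a) * (η * ((k : ℝ) + 1)) ^ (-(a + 1 / 2)) * D := by gcongr
        _ = _ := by ring
    -- For `u = 1/2` the constant noise is summed exactly, without a logarithm.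
    · have := norm_apply_sum_one_sub_smul_pow_adjoint_le hη hηm hb k v
      linarith
    · rw [map_sum]
      refine (norm_sum_le _ _).trans (Finset.sum_le_sum fun s hs => ?_)
      rw [map_smul, norm_smul, Real.norm_of_nonneg hη.le, ← hcast s hs, mul_assoc]
      refine mul_le_mul_of_nonneg_left ?_ hη.le
      refine (norm_apply_one_sub_smul_pow_adjoint_le hη hηm hb _ _).trans ?_
      have := hy s hs
      gcongr
    · rw [map_smul, norm_smul, Real.norm_of_nonneg (Real.sqrt_nonneg _)]
      refine mul_le_mul_of_nonneg_left ?_ (Real.sqrt_nonneg _)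
      rw [map_sum]
      refine (norm_sum_le _ _).trans (Finset.sum_le_sum fun s hs => ?_)
      rw [map_smul, norm_smul, Real.norm_of_nonneg hη.le, ← hcast s hs, mul_assoc]
      refine mul_le_mul_of_nonneg_left ?_ hη.le
      refine (norm_apply_one_sub_smul_pow_le hη hηm hb _ _).trans ?_
      have := hp s hs
      gcongr

end Landweber

/-! ### A Bernstein inequality for sums of independent Hilbert-space-valued variables -/

section Bernstein

/-- As a function of `N ^ 2`, `cosh N` is a power series with nonnegative coefficients, hence convex
on nonnegative arguments. -/
theorem cosh_sqrt_convex {p q θ N : ℝ} (hθ0 : 0 ≤ θ) (hθ1 : θ ≤ 1)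
    (hN : N ^ 2 = θ * p ^ 2 + (1 - θ) * q ^ 2) :
    Real.cosh N ≤ θ * Real.cosh p + (1 - θ) * Real.cosh q := by
  refine hasSum_le (fun n => ?_) (Real.hasSum_cosh N)
    (((Real.hasSum_cosh p).mul_left θ).add ((Real.hasSum_cosh q).mul_left (1 - θ)))
  have h := (convexOn_pow n).2 (x := p ^ 2) (Set.mem_Ici.2 (sq_nonneg p)) (y := q ^ 2)
    (Set.mem_Ici.2 (sq_nonneg q)) hθ0 (sub_nonneg.2 hθ1) (by ring)
  simp only [smul_eq_mul] at h
  rw [← hN, ← pow_mul, ← pow_mul, ← pow_mul] at h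
  calc N ^ (2 * n) / ((2 * n).factorial : ℝ)
      ≤ (θ * p ^ (2 * n) + (1 - θ) * q ^ (2 * n)) / ((2 * n).factorial : ℝ) := by gcongr
    _ = _ := by ring

variable {F : Type*} [NormedAddCommGroup F] [InnerProductSpace ℝ F]

/-- The part of the increment linear in `x` is isolated because it vanishes in the mean for centred
`x`. The remainder depends on `‖x‖` only. -/
theorem cosh_norm_add_le (a x : F) :
    Real.cosh ‖a + x‖ ≤ Real.cosh ‖a‖ * (Real.exp ‖x‖ - ‖x‖)
      + Real.sinh ‖a‖ / ‖a‖ * ⟪a, x⟫_ℝ := by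
  have hexp : Real.exp ‖x‖ - ‖x‖ = Real.cosh ‖x‖ + (Real.sinh ‖x‖ - ‖x‖) := by
    rw [← Real.cosh_add_sinh]; ring
  have hX : 0 ≤ Real.sinh ‖x‖ - ‖x‖ := sub_nonneg.2 (Real.self_le_sinh_iff.2 (norm_nonneg x))
  rcases eq_or_ne a 0 with rfl | ha
  · simp only [zero_add, norm_zero, Real.cosh_zero, one_mul, inner_zero_left, mul_zero, add_zero]
    linarith
  rcases eq_or_ne x 0 with rfl | hx
  · simp
  have hA0 : 0 < ‖a‖ := norm_pos_iff.2 ha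
  have hX0 : 0 < ‖x‖ := norm_pos_iff.2 hx
  set c := ⟪a, x⟫_ℝ with hc
  have hcl : c ≤ ‖a‖ * ‖x‖ := real_inner_le_norm a x
  have hcl' : -(‖a‖ * ‖x‖) ≤ c := neg_le_of_abs_le (abs_real_inner_le_norm a x)
  have hAX : 0 < ‖a‖ * ‖x‖ := by positivity
  -- With `θ = (1 + cos) / 2`, where `cos` is the cosine of the angle, `‖a + x‖ ^ 2` is the convex
  -- combination of the squares of `‖a‖ ± ‖x‖`.
  have h1 := cosh_sqrt_convex (p := ‖a‖ + ‖x‖) (q := ‖a‖ - ‖x‖)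
    (θ := (1 + c / (‖a‖ * ‖x‖)) / 2) (N := ‖a + x‖)
    (by have : -1 ≤ c / (‖a‖ * ‖x‖) := by rw [le_div_iff₀ hAX]; linarith
        linarith)
    (by have : c / (‖a‖ * ‖x‖) ≤ 1 := by rw [div_le_iff₀ hAX]; linarith
        linarith)
    (by rw [norm_add_sq_real, ← hc]; field_simp; ring)
  rw [Real.cosh_add, Real.cosh_sub] at h1
  have h2 : Real.cosh ‖a + x‖ ≤ Real.cosh ‖a‖ * Real.cosh ‖x‖
      + Real.sinh ‖a‖ / ‖a‖ * c + c * (Real.sinh ‖a‖ / ‖a‖ * ((Real.sinh ‖x‖ - ‖x‖) / ‖x‖)) := by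
    refine h1.trans_eq ?_
    field_simp
    ring
  have hsA : 0 ≤ Real.sinh ‖a‖ := Real.sinh_nonneg_iff.2 (norm_nonneg a)
  have h3 : c * (Real.sinh ‖a‖ / ‖a‖ * ((Real.sinh ‖x‖ - ‖x‖) / ‖x‖))
      ≤ Real.cosh ‖a‖ * (Real.sinh ‖x‖ - ‖x‖) := by
    calc _ ≤ (‖a‖ * ‖x‖) * (Real.sinh ‖a‖ / ‖a‖ * ((Real.sinh ‖x‖ - ‖x‖) / ‖x‖)) := by
          gcongr
      _ = Real.sinh ‖a‖ * (Real.sinh ‖x‖ - ‖x‖) := by field_simp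
      _ ≤ _ := by
          gcongr
          exact (Real.sinh_lt_cosh _).le
  rw [hexp]
  linarith

variable [CompleteSpace F] {Z : Type*} [MeasurableSpace Z] {ρ : Measure Z}

/-- One step of the exponential supermartingale argument: centring removes the inner product term of
`cosh_norm_add_le`. -/
theorem lintegral_cosh_norm_add_le {ξ : Z → F} (hξ : Integrable ξ ρ) (h0 : ∫ z, ξ z ∂ρ = 0)
    (a : F) :
    ∫⁻ z, ENNReal.ofReal (Real.cosh ‖a + ξ z‖) ∂ρ
      ≤ ENNReal.ofReal (Real.cosh ‖a‖) *
        ∫⁻ z, ENNReal.ofReal (Real.exp ‖ξ z‖ - ‖ξ z‖) ∂ρ := by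
  have hpos : ∀ z, 0 ≤ Real.exp ‖ξ z‖ - ‖ξ z‖ := fun z => by
    linarith [Real.add_one_le_exp ‖ξ z‖]
  by_cases htop : ∫⁻ z, ENNReal.ofReal (Real.exp ‖ξ z‖ - ‖ξ z‖) ∂ρ = ∞
  · rw [htop, ENNReal.mul_top (by simpa using Real.cosh_pos _)]
    exact le_top
  have hm : AEStronglyMeasurable (fun z => Real.exp ‖ξ z‖ - ‖ξ z‖) ρ :=
    (Real.continuous_exp.sub continuous_id).comp_aestronglyMeasurable hξ.1.norm
  have hf : Integrable (fun z => Real.exp ‖ξ z‖ - ‖ξ z‖) ρ :=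
    (lintegral_ofReal_ne_top_iff_integrable hm (Filter.Eventually.of_forall hpos)).1 htop
  have hi : Integrable (fun z => ⟪a, ξ z⟫_ℝ) ρ := hξ.const_inner a
  have hint := (hf.const_mul (Real.cosh ‖a‖)).add (hi.const_mul (Real.sinh ‖a‖ / ‖a‖))
  calc _ ≤ ∫⁻ z, ENNReal.ofReal (Real.cosh ‖a‖ * (Real.exp ‖ξ z‖ - ‖ξ z‖)
        + Real.sinh ‖a‖ / ‖a‖ * ⟪a, ξ z⟫_ℝ) ∂ρ :=
        lintegral_mono fun z => ENNReal.ofReal_le_ofReal (cosh_norm_add_le a (ξ z))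
    _ = ENNReal.ofReal (∫ z, (Real.cosh ‖a‖ * (Real.exp ‖ξ z‖ - ‖ξ z‖)
        + Real.sinh ‖a‖ / ‖a‖ * ⟪a, ξ z⟫_ℝ) ∂ρ) :=
        (ofReal_integral_eq_lintegral_ofReal hint (Filter.Eventually.of_forall fun z =>
          (Real.cosh_pos _).le.trans (cosh_norm_add_le a (ξ z)))).symm
    _ = ENNReal.ofReal (Real.cosh ‖a‖ * ∫ z, (Real.exp ‖ξ z‖ - ‖ξ z‖) ∂ρ) := by
        rw [integral_add (hf.const_mul _) (hi.const_mul _), integral_const_mul,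
          integral_const_mul, integral_inner hξ, h0, inner_zero_right, mul_zero, add_zero]
    _ = _ := by
        rw [ENNReal.ofReal_mul (Real.cosh_pos _).le,
          ofReal_integral_eq_lintegral_ofReal hf (Filter.Eventually.of_forall hpos)]

/-- Integrating out one independent summand at a time; the free starting point `a` makes the
induction work. -/
theorem lintegral_cosh_norm_sum_le [IsProbabilityMeasure ρ] {ξ : Z → F}
    (hm : StronglyMeasurable ξ) (hξ : Integrable ξ ρ) (h0 : ∫ z, ξ z ∂ρ = 0) (n : ℕ) (a : F) :
    ∫⁻ z : Fin n → Z, ENNReal.ofReal (Real.cosh ‖a + ∑ j, ξ (z j)‖) ∂(Measure.pi fun _ => ρ)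
      ≤ ENNReal.ofReal (Real.cosh ‖a‖) *
        (∫⁻ z, ENNReal.ofReal (Real.exp ‖ξ z‖ - ‖ξ z‖) ∂ρ) ^ n := by
  induction n generalizing a with
  | zero => simp
  | succ n ih =>
    have hsum : StronglyMeasurable fun p : Z × (Fin n → Z) => (a + ξ p.1) + ∑ j, ξ (p.2 j) := by
      refine ((stronglyMeasurable_const.add (hm.comp_measurable measurable_fst))).add ?_
      exact Finset.stronglyMeasurable_fun_sum _ fun j _ =>
        hm.comp_measurable ((measurable_pi_apply j).comp measurable_snd)
    have hcosh : Measurable fun p : Z × (Fin n → Z) =>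
        ENNReal.ofReal (Real.cosh ‖(a + ξ p.1) + ∑ j, ξ (p.2 j)‖) :=
      ENNReal.measurable_ofReal.comp (Real.continuous_cosh.measurable.comp hsum.norm.measurable)
    have hmp := measurePreserving_piFinSuccAbove (fun _ : Fin (n + 1) => ρ) 0
    have heq : ∀ z : Fin (n + 1) → Z, ENNReal.ofReal (Real.cosh ‖a + ∑ j, ξ (z j)‖) =
        (fun p : Z × (Fin n → Z) => ENNReal.ofReal
          (Real.cosh ‖(a + ξ p.1) + ∑ j, ξ (p.2 j)‖))
          (MeasurableEquiv.piFinSuccAbove (fun _ => Z) 0 z) := by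
      intro z
      rw [Fin.sum_univ_succ, ← add_assoc]
      rfl
    simp_rw [heq]
    rw [hmp.lintegral_comp hcosh, lintegral_prod _ hcosh.aemeasurable]
    calc _ ≤ ∫⁻ x, ENNReal.ofReal (Real.cosh ‖a + ξ x‖) *
          (∫⁻ z, ENNReal.ofReal (Real.exp ‖ξ z‖ - ‖ξ z‖) ∂ρ) ^ n ∂ρ :=
          lintegral_mono fun x => ih (a + ξ x)
      _ = (∫⁻ x, ENNReal.ofReal (Real.cosh ‖a + ξ x‖) ∂ρ) *
          (∫⁻ z, ENNReal.ofReal (Real.exp ‖ξ z‖ - ‖ξ z‖) ∂ρ) ^ n := by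
          refine lintegral_mul_const _ ?_
          exact ENNReal.measurable_ofReal.comp (Real.continuous_cosh.measurable.comp
            (stronglyMeasurable_const.add hm).norm.measurable)
      _ ≤ _ := by
          rw [pow_succ', ← mul_assoc]
          gcongr
          exact lintegral_cosh_norm_add_le hξ h0 a

omit [CompleteSpace F] in
-- In `exp x - x` the linear term of the series is gone. For the terms of order `l ≥ 2` the
-- factorials cancel against the moment bound and leave a geometric series of ratio `s * Lb ≤ 1/2`.
theorem lintegral_exp_norm_sub_le [IsProbabilityMeasure ρ] {ξ : Z → F}
    (hm : StronglyMeasurable ξ) {s V Lb : ℝ} (hs : 0 ≤ s) (hLb : 0 ≤ Lb) (hsL : s * Lb ≤ 1 / 2)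
    (hmom : ∀ l : ℕ, 2 ≤ l → ∫⁻ z, ‖ξ z‖ₑ ^ l ∂ρ
      ≤ ENNReal.ofReal (1 / 2 * (l.factorial : ℝ) * V ^ 2 * Lb ^ (l - 2))) :
    ∫⁻ z, ENNReal.ofReal (Real.exp ‖s • ξ z‖ - ‖s • ξ z‖) ∂ρ
      ≤ 1 + ENNReal.ofReal (s ^ 2 * V ^ 2) := by
  have hexp : ∀ x : ℝ, 0 ≤ x → ENNReal.ofReal (Real.exp x - x)
      = 1 + ∑' l : ℕ, ENNReal.ofReal (x ^ (l + 2) / ((l + 2).factorial : ℝ)) := by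
    intro x hx
    have h1 : HasSum (fun l : ℕ => x ^ l / (l.factorial : ℝ)) (Real.exp x) := by
      rw [Real.exp_eq_exp_ℝ]
      exact NormedSpace.expSeries_div_hasSum_exp x
    have h2 : HasSum (fun l : ℕ => x ^ (l + 2) / ((l + 2).factorial : ℝ))
        (Real.exp x - x - 1) := by
      have := (hasSum_nat_add_iff' 2).2 h1
      rw [show Real.exp x - x - 1
        = Real.exp x - ∑ i ∈ Finset.range 2, x ^ i / (i.factorial : ℝ) by
          rw [Finset.sum_range_succ, Finset.sum_range_one]
          norm_num
          ring]
      exact this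
    have h3 : 0 ≤ Real.exp x - x - 1 := by linarith [Real.add_one_le_exp x]
    rw [← ENNReal.ofReal_tsum_of_nonneg (fun l => by positivity) h2.summable, h2.tsum_eq,
      ← ENNReal.ofReal_one, ← ENNReal.ofReal_add zero_le_one h3]
    congr 1
    ring
  have hterm : ∀ (l : ℕ) (z : Z), ENNReal.ofReal (‖s • ξ z‖ ^ (l + 2) / ((l + 2).factorial : ℝ))
      = ENNReal.ofReal (s ^ (l + 2) / ((l + 2).factorial : ℝ)) * ‖ξ z‖ₑ ^ (l + 2) := by
    intro l z
    rw [norm_smul, Real.norm_of_nonneg hs, mul_pow, mul_div_right_comm,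
      ENNReal.ofReal_mul (by positivity), ENNReal.ofReal_pow (norm_nonneg _), ofReal_norm]
  have hmeas : ∀ l : ℕ, Measurable fun z => ‖ξ z‖ₑ ^ l := fun l => hm.enorm.pow_const l
  simp_rw [hexp _ (norm_nonneg _), hterm]
  rw [lintegral_add_left measurable_const, lintegral_const, measure_univ, mul_one,
    lintegral_tsum fun l => ((hmeas (l + 2)).const_mul _).aemeasurable]
  gcongr
  have hr : 0 ≤ s * Lb := by positivity
  have hgeo := (hasSum_geometric_of_lt_one hr (by linarith)).mul_left (1 / 2 * (s ^ 2 * V ^ 2))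
  calc _ ≤ ∑' l : ℕ, ENNReal.ofReal (1 / 2 * (s ^ 2 * V ^ 2) * (s * Lb) ^ l) := by
        refine ENNReal.tsum_le_tsum fun l => ?_
        rw [lintegral_const_mul _ (hmeas (l + 2))]
        refine (mul_le_mul_right (hmom (l + 2) (by omega)) _).trans ?_
        rw [← ENNReal.ofReal_mul (by positivity)]
        refine ENNReal.ofReal_le_ofReal (le_of_eq ?_)
        have : ((l + 2).factorial : ℝ) ≠ 0 := by positivity
        rw [Nat.add_sub_cancel]
        field_simp
        ring
    _ = ENNReal.ofReal (1 / 2 * (s ^ 2 * V ^ 2) * (1 - s * Lb)⁻¹) := by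
        rw [← hgeo.tsum_eq, ENNReal.ofReal_tsum_of_nonneg (fun l => by positivity) hgeo.summable]
    _ ≤ _ := by
        refine ENNReal.ofReal_le_ofReal ?_
        have : (1 - s * Lb)⁻¹ ≤ 2 := inv_le_of_inv_le₀ (by norm_num) (by linarith)
        nlinarith [mul_nonneg (sq_nonneg s) (sq_nonneg V)]

/-- **Bernstein's inequality** in a Hilbert space. -/
theorem measure_le_norm_sum_le [IsProbabilityMeasure ρ] {ξ : Z → F}
    (hm : StronglyMeasurable ξ) (hξ : Integrable ξ ρ) (h0 : ∫ z, ξ z ∂ρ = 0) {V Lb R δ : ℝ}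
    (hLb : 0 ≤ Lb) (hmom : ∀ l : ℕ, 2 ≤ l → ∫⁻ z, ‖ξ z‖ₑ ^ l ∂ρ
      ≤ ENNReal.ofReal (1 / 2 * (l.factorial : ℝ) * V ^ 2 * Lb ^ (l - 2))) (n : ℕ)
    (hR : 0 < R) (hRL : 2 * Lb ≤ R) (hRV : n * V ^ 2 ≤ R ^ 2) (hδ : 0 < δ) (hδ1 : δ ≤ 1) :
    Measure.pi (fun _ : Fin n => ρ) {z | R * (2 * Real.log (6 / δ)) ≤ ‖∑ j, ξ (z j)‖}
      ≤ ENNReal.ofReal (δ / 2) := by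
  -- At the scale `1 / R` the Bernstein factor satisfies `s * Lb ≤ 1/2` and the accumulated variance
  -- satisfies `n s ^ 2 V ^ 2 ≤ 1`, so the expected `cosh` is at most `exp 1`.
  set s := R⁻¹ with hs
  have hs0 : 0 < s := inv_pos.2 hR
  have hξs : StronglyMeasurable fun z => s • ξ z := hm.const_smul s
  have hQ := lintegral_exp_norm_sub_le (V := V) hm hs0.le hLb
    (by rw [hs, inv_mul_le_iff₀ hR]; linarith) hmom
  have hL := lintegral_cosh_norm_sum_le hξs (hξ.smul s)
    (by rw [integral_smul, h0, smul_zero]) n 0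
  have hnV : (n : ℝ) * (s ^ 2 * V ^ 2) ≤ 1 := by
    rw [hs, inv_pow]
    have : (n : ℝ) * ((R ^ 2)⁻¹ * V ^ 2) = (R ^ 2)⁻¹ * (n * V ^ 2) := by ring
    rw [this, inv_mul_le_iff₀ (by positivity)]
    linarith
  have hpow : (1 + ENNReal.ofReal (s ^ 2 * V ^ 2)) ^ n ≤ ENNReal.ofReal (Real.exp 1) := by
    rw [← ENNReal.ofReal_one, ← ENNReal.ofReal_add zero_le_one (by positivity),
      ← ENNReal.ofReal_pow (by positivity)]
    refine ENNReal.ofReal_le_ofReal ?_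
    calc _ ≤ (Real.exp (s ^ 2 * V ^ 2)) ^ n := by
          gcongr
          linarith [Real.add_one_le_exp (s ^ 2 * V ^ 2)]
      _ = Real.exp (n * (s ^ 2 * V ^ 2)) := by rw [← Real.exp_nat_mul]
      _ ≤ _ := Real.exp_le_exp.2 hnV
  set t := 2 * Real.log (6 / δ) with ht
  have h6 : 0 < 6 / δ := by positivity
  have ht0 : 0 ≤ t := by
    have : 0 ≤ Real.log (6 / δ) := Real.log_nonneg (by rw [le_div_iff₀ hδ]; linarith)
    positivity
  -- The factor `2` in `t` yields `δ ^ 2`; Markov then gives `exp 1 * δ ^ 2 / 18 ≤ δ / 2`.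
  have hcosh : 18 / δ ^ 2 ≤ Real.cosh t := by
    rw [Real.cosh_eq]
    have h1 : Real.exp t = 36 / δ ^ 2 := by
      rw [ht, two_mul, Real.exp_add, Real.exp_log h6]
      field_simp
      norm_num
    have h2 := Real.exp_pos (-t)
    rw [h1]
    have : 18 / δ ^ 2 = 36 / δ ^ 2 / 2 := by ring
    linarith
  have hmeas : Measurable fun z : Fin n → Z =>
      ENNReal.ofReal (Real.cosh ‖(0 : F) + ∑ j, s • ξ (z j)‖) :=
    ENNReal.measurable_ofReal.comp (Real.continuous_cosh.measurable.comp
      (stronglyMeasurable_const.add (Finset.stronglyMeasurable_fun_sum _ fun j _ =>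
        hξs.comp_measurable (measurable_pi_apply j))).norm.measurable)
  have hmarkov := mul_meas_ge_le_lintegral (μ := Measure.pi fun _ : Fin n => ρ) hmeas
    (ENNReal.ofReal (Real.cosh t))
  have hsub : {z : Fin n → Z | R * t ≤ ‖∑ j, ξ (z j)‖} ⊆
      {z | ENNReal.ofReal (Real.cosh t)
        ≤ ENNReal.ofReal (Real.cosh ‖(0 : F) + ∑ j, s • ξ (z j)‖)} := by
    intro z hz
    simp only [Set.mem_ofPred_eq] at hz ⊢
    refine ENNReal.ofReal_le_ofReal (Real.cosh_le_cosh.2 ?_)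
    rw [abs_of_nonneg ht0, abs_of_nonneg (norm_nonneg _), zero_add, ← Finset.smul_sum, norm_smul,
      Real.norm_of_nonneg hs0.le, hs, le_inv_mul_iff₀ hR]
    exact hz
  have hchain : ENNReal.ofReal (18 / δ ^ 2) *
      Measure.pi (fun _ : Fin n => ρ) {z | R * t ≤ ‖∑ j, ξ (z j)‖}
      ≤ ENNReal.ofReal (Real.exp 1) := by
    calc _ ≤ ENNReal.ofReal (Real.cosh t) * Measure.pi (fun _ : Fin n => ρ)
          {z | ENNReal.ofReal (Real.cosh t)
            ≤ ENNReal.ofReal (Real.cosh ‖(0 : F) + ∑ j, s • ξ (z j)‖)} :=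
          mul_le_mul' (ENNReal.ofReal_le_ofReal hcosh) (measure_mono hsub)
      _ ≤ _ := hmarkov
      _ ≤ _ := hL
      _ ≤ (1 + ENNReal.ofReal (s ^ 2 * V ^ 2)) ^ n := by
          rw [norm_zero, Real.cosh_zero, ENNReal.ofReal_one, one_mul]
          gcongr
      _ ≤ _ := hpow
  have hpos : (0 : ℝ) < 18 / δ ^ 2 := by positivity
  rw [mul_comm, ← ENNReal.le_div_iff_mul_le (Or.inl (by simpa using hpos)) (Or.inl (by simp)),
    ← ENNReal.ofReal_div_of_pos hpos] at hchain
  refine hchain.trans (ENNReal.ofReal_le_ofReal ?_)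
  have he := Real.exp_one_lt_d9
  rw [div_div_eq_mul_div, div_le_iff₀ (by norm_num)]
  nlinarith [mul_nonneg hδ.le (sub_nonneg.2 hδ1)]

end Bernstein

/-! ### The covariance operator and the effective dimension -/

section Resolvent

variable {H F : Type*} [NormedAddCommGroup H] [InnerProductSpace ℝ H] [CompleteSpace H]
  [NormedAddCommGroup F] [InnerProductSpace ℝ F] [CompleteSpace F]

theorem isUnit_adjoint_comp_self_add (S : H →L[ℝ] F) {lam : ℝ} (hlam : 0 < lam) :
    IsUnit (S.adjoint ∘L S + lam • ContinuousLinearMap.id ℝ H) := by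
  refine ContinuousLinearMap.isUnit_of_forall_le_norm_inner_map _ (c := ⟨lam, hlam.le⟩) hlam
    fun x => ?_
  refine le_trans ?_ (le_abs_self _)
  rw [real_inner_comm, add_apply, inner_add_right, inner_adjoint_comp_self, smul_apply,
    real_inner_smul_right, ContinuousLinearMap.id_apply, real_inner_self_eq_norm_sq,
    real_inner_self_eq_norm_sq]
  change ‖x‖ ^ 2 * lam ≤ _
  nlinarith [sq_nonneg ‖S x‖]

/-- The resolvent `(S* S + lam I)⁻¹`. -/
def resolvent (S : H →L[ℝ] F) (lam : ℝ) : H →L[ℝ] H :=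
  Ring.inverse (S.adjoint ∘L S + lam • ContinuousLinearMap.id ℝ H)

variable {S : H →L[ℝ] F} {lam : ℝ} (hlam : 0 < lam)
include hlam

theorem adjoint_resolvent_add (x : H) :
    S.adjoint (S (resolvent S lam x)) + lam • resolvent S lam x = x := by
  have h := Ring.mul_inverse_cancel _ (isUnit_adjoint_comp_self_add S hlam)
  exact DFunLike.congr_fun h x

theorem resolvent_adjoint_comp_self (x : H) :
    resolvent S lam (S.adjoint (S x)) = S.adjoint (S (resolvent S lam x)) := by
  have h := Ring.inverse_mul_cancel _ (isUnit_adjoint_comp_self_add S hlam)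
  have h1 : resolvent S lam (S.adjoint (S x)) + lam • resolvent S lam x = x := by
    rw [← map_smul, ← map_add]
    exact DFunLike.congr_fun h x
  exact add_right_cancel (h1.trans (adjoint_resolvent_add hlam x).symm)

theorem inner_resolvent_self (x : H) :
    ⟪x, resolvent S lam x⟫_ℝ = ‖S (resolvent S lam x)‖ ^ 2 + lam * ‖resolvent S lam x‖ ^ 2 := by
  nth_rewrite 1 [← adjoint_resolvent_add (S := S) hlam x]
  rw [inner_add_left, ContinuousLinearMap.adjoint_inner_left, real_inner_smul_left,
    real_inner_self_eq_norm_sq, real_inner_self_eq_norm_sq]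

/-- Writes a diagonal entry of `(L + lam)⁻¹ L` as squared norms of two operators, whose sums over a
basis are Hilbert-Schmidt sums and hence independent of the basis. -/
theorem inner_resolvent_adjoint_comp_self (x : H) :
    ⟪x, resolvent S lam (S.adjoint (S x))⟫_ℝ
      = ‖S.adjoint (S (resolvent S lam x))‖ ^ 2 + ‖√lam • S (resolvent S lam x)‖ ^ 2 := by
  rw [resolvent_adjoint_comp_self hlam]
  nth_rewrite 1 [← adjoint_resolvent_add (S := S) hlam x]
  rw [inner_add_left, real_inner_self_eq_norm_sq, real_inner_smul_left,
    ContinuousLinearMap.adjoint_inner_right, real_inner_self_eq_norm_sq, norm_smul, mul_pow,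
    Real.norm_of_nonneg (Real.sqrt_nonneg _), Real.sq_sqrt hlam.le]

theorem inner_resolvent_eigenbasis {ι : Type*} {e : HilbertBasis ι ℝ H} {l : ι → ℝ}
    (he : ∀ i, (S.adjoint ∘L S) (e i) = l i • e i) (i : ι) (x : H) :
    ⟪e i, resolvent S lam x⟫_ℝ = ⟪e i, x⟫_ℝ / (l i + lam) := by
  have hl := eigenvalue_nonneg he i
  rw [eq_div_iff (by linarith)]
  nth_rewrite 2 [← adjoint_resolvent_add (S := S) hlam x]
  have := inner_eigenbasis_apply (isSymmetric_adjoint_comp_self S) he i (resolvent S lam x)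
  rw [ContinuousLinearMap.comp_apply] at this
  rw [inner_add_right, this, real_inner_smul_right]
  ring

theorem tsum_inner_resolvent_adjoint_comp_self {κ : Type*} (c : HilbertBasis κ ℝ H) :
    ∑' k, ENNReal.ofReal ⟪c k, resolvent S lam (S.adjoint (S (c k)))⟫_ℝ
      = ∑' k, ENNReal.ofReal (‖(S.adjoint ∘L S ∘L resolvent S lam) (c k)‖ ^ 2)
        + ∑' k, ENNReal.ofReal (‖(√lam • (S ∘L resolvent S lam)) (c k)‖ ^ 2) := by
  rw [← ENNReal.tsum_add]
  refine tsum_congr fun k => ?_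
  rw [inner_resolvent_adjoint_comp_self hlam, ENNReal.ofReal_add (sq_nonneg _) (sq_nonneg _)]
  rfl

/-- `opTrace` uses one fixed basis. Splitting into two Hilbert-Schmidt sums allows the change to the
eigenbasis. -/
theorem effDim_eq_tsum {ι : Type*} {e : HilbertBasis ι ℝ H} {l : ι → ℝ}
    (he : ∀ i, (S.adjoint ∘L S) (e i) = l i • e i) :
    effDim (S.adjoint ∘L S) lam = ∑' i, ENNReal.ofReal (l i / (l i + lam)) := by
  have h1 : effDim (S.adjoint ∘L S) lam = ∑' k, ENNReal.ofReal
      ⟪(exists_hilbertBasis ℝ H).choose_spec.choose k, resolvent S lam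
        (S.adjoint (S ((exists_hilbertBasis ℝ H).choose_spec.choose k)))⟫_ℝ := rfl
  rw [h1, tsum_inner_resolvent_adjoint_comp_self hlam,
    tsum_norm_sq_eq_of_basis _ e (S.adjoint ∘L S ∘L resolvent S lam),
    tsum_norm_sq_eq_of_basis _ e (√lam • (S ∘L resolvent S lam)),
    ← tsum_inner_resolvent_adjoint_comp_self hlam]
  refine tsum_congr fun i => ?_
  have hi : ‖e i‖ = 1 := e.orthonormal.1 i
  have hei : S.adjoint (S (e i)) = l i • e i := he i
  rw [inner_resolvent_eigenbasis hlam he, hei, real_inner_smul_right, real_inner_self_eq_norm_sq,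
    hi]
  simp

omit hlam in
/-- The embedding `ζ ↦ (S (S* S + lam I)⁻¹ ζ, √lam (S* S + lam I)⁻¹ ζ)`; the square of its norm
is the quadratic form of the resolvent. -/
def resolventEmb (S : H →L[ℝ] F) (lam : ℝ) : H →L[ℝ] WithLp 2 (F × H) :=
  (WithLp.prodContinuousLinearEquiv 2 ℝ F H).symm.toContinuousLinearMap ∘L
    ((S ∘L resolvent S lam).prod (√lam • resolvent S lam))

omit hlam in
theorem norm_sq_resolventEmb (x : H) :
    ‖resolventEmb S lam x‖ ^ 2 = ‖S (resolvent S lam x)‖ ^ 2 + ‖√lam • resolvent S lam x‖ ^ 2 := by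
  rw [WithLp.prod_norm_sq_eq_of_L2]
  rfl

theorem hasSum_norm_sq_resolventEmb {ι : Type*} {e : HilbertBasis ι ℝ H} {l : ι → ℝ}
    (he : ∀ i, (S.adjoint ∘L S) (e i) = l i • e i) (x : H) :
    HasSum (fun i => ⟪e i, x⟫_ℝ ^ 2 / (l i + lam)) (‖resolventEmb S lam x‖ ^ 2) := by
  have h := e.hasSum_inner_mul_inner x (resolvent S lam x)
  rw [inner_resolvent_self hlam] at h
  rw [norm_sq_resolventEmb, norm_smul, mul_pow, Real.norm_of_nonneg (Real.sqrt_nonneg _),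
    Real.sq_sqrt hlam.le]
  have h' : ∀ i, ⟪x, e i⟫_ℝ * ⟪e i, resolvent S lam x⟫_ℝ = ⟪e i, x⟫_ℝ ^ 2 / (l i + lam) := by
    intro i
    rw [inner_resolvent_eigenbasis hlam he, real_inner_comm (e i) x]
    ring
  simpa only [h'] using h

omit hlam in
theorem norm_apply_resolvent_le (x : H) : ‖S (resolvent S lam x)‖ ≤ ‖resolventEmb S lam x‖ := by
  refine le_of_sq_le_sq ?_ (norm_nonneg _)
  rw [norm_sq_resolventEmb]
  nlinarith [sq_nonneg ‖√lam • resolvent S lam x‖]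

omit hlam in
theorem norm_sqrt_smul_resolvent_le (x : H) :
    ‖√lam • resolvent S lam x‖ ≤ ‖resolventEmb S lam x‖ := by
  refine le_of_sq_le_sq ?_ (norm_nonneg _)
  rw [norm_sq_resolventEmb]
  nlinarith [sq_nonneg ‖S (resolvent S lam x)‖]

end Resolvent

/-! ### Compactness of the inclusion and the local effective dimension -/

section Covariance

variable {X Y : Type*} [MeasurableSpace X]
  [NormedAddCommGroup Y] [InnerProductSpace ℝ Y] [CompleteSpace Y]
  {H₂ : Type*} [NormedAddCommGroup H₂] [InnerProductSpace ℝ H₂] [CompleteSpace H₂]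
  [RKHS ℝ H₂ X Y] {κ₀ : ℝ}

/-- Evaluation at `x` is the adjoint of `K_x`, so the sum is the Hilbert-Schmidt sum of `K_x` seen
from the other side. -/
theorem KernelCondition.tsum_norm_sq_apply_le (hK : KernelCondition H₂ κ₀) {ι : Type*}
    (e : HilbertBasis ι ℝ H₂) (x : X) :
    ∑' i, ENNReal.ofReal (‖e i x‖ ^ 2) ≤ ENNReal.ofReal (κ₀ ^ 2) := by
  refine le_trans (le_of_eq ?_) ((le_iSup _ x).trans hK.trace_le)
  have h := tsum_norm_sq_eq_adjoint (exists_hilbertBasis ℝ Y).choose_spec.choose e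
    (RKHS.kerFun H₂ x)
  simp only [RKHS.adjoint_kerFun] at h
  rw [← h]
  unfold opTrace
  refine tsum_congr fun i => ?_
  rw [ContinuousLinearMap.comp_apply, ContinuousLinearMap.adjoint_inner_right,
    real_inner_self_eq_norm_sq]

variable [SecondCountableTopology Y] [MeasurableSpace Y] [BorelSpace Y]
  (hK : KernelCondition H₂ κ₀) (μ : Measure X) [IsProbabilityMeasure μ]

theorem inclusion_apply (g : H₂) : inclusion hK μ g = (hK.memLp μ g).toLp g := rfl

theorem inner_inclusion (g h : H₂) :
    ⟪inclusion hK μ g, inclusion hK μ h⟫_ℝ = ∫ x, ⟪g x, h x⟫_ℝ ∂μ := by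
  rw [L2.inner_def]
  refine integral_congr_ae ?_
  filter_upwards [(hK.memLp μ g).coeFn_toLp, (hK.memLp μ h).coeFn_toLp] with x hg hh
  rw [inclusion_apply, inclusion_apply, hg, hh]

theorem ofReal_norm_sq_inclusion (g : H₂) :
    ENNReal.ofReal (‖inclusion hK μ g‖ ^ 2) = ∫⁻ x, ENNReal.ofReal (‖g x‖ ^ 2) ∂μ := by
  rw [← real_inner_self_eq_norm_sq, inner_inclusion,
    ofReal_integral_eq_lintegral_ofReal]
  · simp_rw [real_inner_self_eq_norm_sq]
  · simp_rw [real_inner_self_eq_norm_sq]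
    exact (hK.memLp μ g).integrable_norm_pow (by norm_num)
  · exact Filter.Eventually.of_forall fun x => real_inner_self_nonneg

theorem norm_inclusion_le (hκ : 0 ≤ κ₀) : ‖inclusion hK μ‖ ≤ κ₀ :=
  (LinearMap.mkContinuous_norm_le _ (abs_nonneg κ₀) _).trans_eq (abs_of_nonneg hκ)

omit hK in
theorem KernelCondition.measurable_norm_sq (hK : KernelCondition H₂ κ₀) (h : H₂) :
    Measurable fun x => ENNReal.ofReal (‖h x‖ ^ 2) :=
  ENNReal.measurable_ofReal.comp ((hK.measurable_coe h).norm.pow_const 2)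

/-- The inclusion is Hilbert-Schmidt: integrate the pointwise trace bound over `x`. -/
theorem isCompactOperator_inclusion [SecondCountableTopology H₂] :
    IsCompactOperator (inclusion hK μ) := by
  obtain ⟨w, b, -⟩ := exists_hilbertBasis ℝ H₂
  have : Countable w := countable_hilbertBasis b
  refine isCompactOperator_of_tsum_norm_sq b _ (ne_of_lt ?_)
  simp_rw [ofReal_norm_sq_inclusion]
  rw [← lintegral_tsum fun i => (hK.measurable_norm_sq (b i)).aemeasurable]
  calc _ ≤ ∫⁻ _, ENNReal.ofReal (κ₀ ^ 2) ∂μ :=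
        lintegral_mono fun x => hK.tsum_norm_sq_apply_le b x
    _ < ∞ := by simp

variable {ι : Type*} (e : HilbertBasis ι ℝ H₂) (l : ι → ℝ) (lam : ℝ)

/-- The local effective dimension `x ↦ ∑ i, ‖e i x‖ ^ 2 / (l i + lam)` of an eigenbasis `e` of the
covariance operator. -/
def leverage (x : X) : ℝ≥0∞ := ∑' i, ENNReal.ofReal (‖e i x‖ ^ 2 / (l i + lam))

variable {e l lam} {μ}
variable (hlam : 0 < lam) (he : ∀ i, covOp hK μ (e i) = l i • e i)
include hlam he

theorem leverage_le (x : X) : leverage e l lam x ≤ ENNReal.ofReal (κ₀ ^ 2 / lam) := by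
  have hl := eigenvalue_nonneg (B := inclusion hK μ) he
  calc _ ≤ ∑' i, ENNReal.ofReal (‖e i x‖ ^ 2) * ENNReal.ofReal lam⁻¹ := by
        refine ENNReal.tsum_le_tsum fun i => ?_
        rw [← ENNReal.ofReal_mul (sq_nonneg _), ← div_eq_mul_inv]
        refine ENNReal.ofReal_le_ofReal ?_
        have := hl i
        gcongr
        linarith
    _ ≤ _ := by
        rw [ENNReal.tsum_mul_right, div_eq_mul_inv, ENNReal.ofReal_mul (sq_nonneg _)]
        gcongr
        exact hK.tsum_norm_sq_apply_le e x

/-- The integral of `‖e i x‖ ^ 2` is `‖S (e i)‖ ^ 2 = l i`, so the terms integrate to `l i / (l i +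
lam)`. -/
theorem lintegral_leverage [SecondCountableTopology H₂] :
    ∫⁻ x, leverage e l lam x ∂μ = effDim (covOp hK μ) lam := by
  have hl := eigenvalue_nonneg (B := inclusion hK μ) he
  have : Countable ι := countable_hilbertBasis e
  have h1 : ∀ i x, ENNReal.ofReal (‖e i x‖ ^ 2 / (l i + lam))
      = ENNReal.ofReal (‖e i x‖ ^ 2) * ENNReal.ofReal (l i + lam)⁻¹ := fun i x => by
    rw [div_eq_mul_inv, ENNReal.ofReal_mul (sq_nonneg _)]
  have h2 : effDim (covOp hK μ) lam = _ := effDim_eq_tsum (S := inclusion hK μ) hlam he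
  rw [h2]
  unfold leverage
  simp_rw [h1]
  rw [lintegral_tsum fun i => ((hK.measurable_norm_sq (e i)).mul_const _).aemeasurable]
  refine tsum_congr fun i => ?_
  rw [lintegral_mul_const _ (hK.measurable_norm_sq (e i)), ← ofReal_norm_sq_inclusion hK μ,
    ← eigenvalue_eq_norm_sq (B := inclusion hK μ) he, ← ENNReal.ofReal_mul (hl i),
    div_eq_mul_inv]

theorem ofReal_norm_sq_resolventEmb_kerFun_le (x : X) (v : Y) :
    ENNReal.ofReal (‖resolventEmb (inclusion hK μ) lam (RKHS.kerFun H₂ x v)‖ ^ 2)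
      ≤ leverage e l lam x * ENNReal.ofReal (‖v‖ ^ 2) := by
  have hl := eigenvalue_nonneg (B := inclusion hK μ) he
  have h := hasSum_norm_sq_resolventEmb (S := inclusion hK μ) hlam he (RKHS.kerFun H₂ x v)
  have hpos : ∀ i, 0 < l i + lam := fun i => by linarith [hl i]
  rw [← h.tsum_eq, ENNReal.ofReal_tsum_of_nonneg
    (fun i => div_nonneg (sq_nonneg _) (hpos i).le) h.summable]
  unfold leverage
  rw [← ENNReal.tsum_mul_right]
  refine ENNReal.tsum_le_tsum fun i => ?_
  rw [← ENNReal.ofReal_mul (div_nonneg (sq_nonneg _) (hpos i).le), div_mul_eq_mul_div]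
  refine ENNReal.ofReal_le_ofReal ?_
  rw [RKHS.inner_kerFun, ← mul_pow]
  have := hpos i
  gcongr ?_ / _
  exact sq_le_sq' (by linarith [neg_abs_le ⟪e i x, v⟫_ℝ, abs_real_inner_le_norm (e i x) v])
    (real_inner_le_norm _ _)

end Covariance

/-! ### Concentration of the empirical noise and of the empirical covariance -/

section Concentration

/-- The left side is the variance of an average of independent copies, that is `Var f / n`. -/
theorem lintegral_sq_empirical_mean_le {Z : Type*} [MeasurableSpace Z] {ρ : Measure Z}
    [IsProbabilityMeasure ρ] {f : Z → ℝ} (hf : MemLp f 2 ρ) {n : ℕ} (hn : 0 < n) :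
    ∫⁻ z : Fin n → Z, ENNReal.ofReal (((n : ℝ)⁻¹ * ∑ j, f (z j) - ∫ z, f z ∂ρ) ^ 2)
        ∂(Measure.pi fun _ => ρ)
      ≤ ENNReal.ofReal (n : ℝ)⁻¹ * ∫⁻ z, ENNReal.ofReal (f z ^ 2) ∂ρ := by
  have hn' : (n : ℝ) ≠ 0 := by positivity
  have hmemj : ∀ j : Fin n, MemLp (fun z : Fin n → Z => f (z j)) 2 (Measure.pi fun _ => ρ) :=
    fun j => hf.comp_measurePreserving (measurePreserving_eval _ j)
  set G : (Fin n → Z) → ℝ := fun z => (n : ℝ)⁻¹ * ∑ j, f (z j) with hG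
  have hsum : MemLp (fun z : Fin n → Z => ∑ j, f (z j)) 2 (Measure.pi fun _ => ρ) :=
    memLp_finsetSum _ fun j _ => hmemj j
  have hGm : MemLp G 2 (Measure.pi fun _ => ρ) := hsum.const_mul _
  have hmean : ∫ z, G z ∂(Measure.pi fun _ => ρ) = ∫ z, f z ∂ρ := by
    rw [hG, integral_const_mul, integral_finsetSum _ fun j _ => (hmemj j).integrable (by norm_num)]
    have : ∀ j : Fin n, ∫ z : Fin n → Z, f (z j) ∂(Measure.pi fun _ => ρ) = ∫ z, f z ∂ρ := by
      intro j
      have hmp := measurePreserving_eval (fun _ : Fin n => ρ) j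
      have h := integral_map (f := f) hmp.measurable.aemeasurable (by rw [hmp.map_eq]; exact hf.1)
      rw [hmp.map_eq] at h
      exact h.symm
    simp only [this, Finset.sum_const, Finset.card_univ, Fintype.card_fin, nsmul_eq_mul]
    field_simp
  have hvar : Var[G; Measure.pi fun _ => ρ] = (n : ℝ)⁻¹ * Var[f; ρ] := by
    rw [hG, variance_const_mul]
    have h := variance_sum_pi (μ := fun _ : Fin n => ρ) (X := fun _ => f) fun _ => hf
    have h' : (∑ i : Fin n, fun ω : Fin n → Z => f (ω i)) = fun ω => ∑ i, f (ω i) := by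
      ext ω; simp
    rw [h'] at h
    rw [h]
    simp only [Finset.sum_const, Finset.card_univ, Fintype.card_fin, nsmul_eq_mul]
    field_simp
  calc _ = ENNReal.ofReal (Var[G; Measure.pi fun _ => ρ]) := by
        rw [hGm.ofReal_variance_eq, evariance_eq_lintegral_ofReal, hmean]
    _ ≤ ENNReal.ofReal ((n : ℝ)⁻¹ * ∫ z, f z ^ 2 ∂ρ) := by
        rw [hvar]
        refine ENNReal.ofReal_le_ofReal (mul_le_mul_of_nonneg_left ?_ (by positivity))
        exact variance_le_expectation_sq hf.1
    _ = _ := by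
        rw [ENNReal.ofReal_mul (by positivity), ofReal_integral_eq_lintegral_ofReal
          hf.integrable_sq (Filter.Eventually.of_forall fun z => sq_nonneg _)]

variable {X Y : Type*} [MeasurableSpace X]
  [NormedAddCommGroup Y] [InnerProductSpace ℝ Y] [CompleteSpace Y]
  [SecondCountableTopology Y] [MeasurableSpace Y] [BorelSpace Y]
  {H₂ : Type*} [NormedAddCommGroup H₂] [InnerProductSpace ℝ H₂] [CompleteSpace H₂]
  [RKHS ℝ H₂ X Y] {κ₀ : ℝ}

variable (H₂) in
/-- The empirical covariance operator `n⁻¹ ∑ j, K_{x_j} K_{x_j}*`. -/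
def empCov {n : ℕ} (z : Fin n → X × Y) : H₂ →L[ℝ] H₂ :=
  (n : ℝ)⁻¹ • ∑ j, RKHS.kerFun H₂ (z j).1 ∘L (RKHS.kerFun H₂ (z j).1).adjoint

omit [MeasurableSpace X] [SecondCountableTopology Y] [MeasurableSpace Y] [BorelSpace Y] in
theorem empCov_apply {n : ℕ} (z : Fin n → X × Y) (h : H₂) :
    empCov H₂ z h = (n : ℝ)⁻¹ • ∑ j, RKHS.kerFun H₂ (z j).1 (h (z j).1) := by
  simp [empCov]

omit [MeasurableSpace X] [SecondCountableTopology Y] [MeasurableSpace Y] [BorelSpace Y] in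
theorem inner_empCov {n : ℕ} (z : Fin n → X × Y) (g h : H₂) :
    ⟪g, empCov H₂ z h⟫_ℝ = (n : ℝ)⁻¹ * ∑ j, ⟪g (z j).1, h (z j).1⟫_ℝ := by
  rw [empCov_apply, real_inner_smul_right, inner_sum]
  simp_rw [RKHS.inner_kerFun]

variable (hK : KernelCondition H₂ κ₀)

theorem inner_covOp (μ : Measure X) [IsProbabilityMeasure μ] (g h : H₂) :
    ⟪g, covOp hK μ h⟫_ℝ = ∫ x, ⟪g x, h x⟫_ℝ ∂μ := by
  rw [← inner_inclusion hK μ]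
  exact inner_adjoint_comp_self _ _ _

omit hK in
theorem KernelCondition.memLp_inner (hK : KernelCondition H₂ κ₀) (ρ : Measure (X × Y))
    [IsProbabilityMeasure ρ] (g h : H₂) :
    MemLp (fun z : X × Y => ⟪g z.1, h z.1⟫_ℝ) 2 ρ := by
  refine MemLp.of_bound (C := (|κ₀| * ‖g‖) * (|κ₀| * ‖h‖)) ?_
    (Filter.Eventually.of_forall fun z => ?_)
  · exact (((hK.measurable_coe g).comp measurable_fst).inner
      ((hK.measurable_coe h).comp measurable_fst)).aestronglyMeasurable
  · refine (norm_inner_le_norm _ _).trans ?_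
    have h1 := hK.norm_apply_le g z.1
    have h2 := hK.norm_apply_le h z.1
    gcongr

variable (ρ : Measure (X × Y)) [IsProbabilityMeasure ρ]
  {ι : Type*} {e : HilbertBasis ι ℝ H₂} {l : ι → ℝ} {lam : ℝ}
  (hlam : 0 < lam) (he : ∀ i, covOp hK ρ.fst (e i) = l i • e i)

/-- The squared Hilbert–Schmidt norm of `(L + lam I) ^ (-1/2) (L̂ - L)` in an eigenbasis of the
covariance operator `L`. -/
def covDeviation (e : HilbertBasis ι ℝ H₂) (l : ι → ℝ) (lam : ℝ) {n : ℕ} (z : Fin n → X × Y) :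
    ℝ≥0∞ :=
  ∑' m, ENNReal.ofReal (l m + lam)⁻¹ *
    ∑' i, ENNReal.ofReal (⟪e i, (empCov H₂ z - covOp hK ρ.fst) (e m)⟫_ℝ ^ 2)

include hlam he

/-- By symmetry of `L̂ - L` the coordinates of `(L̂ - L) h` are `⟪(L̂ - L) e m, h⟫`; Cauchy-Schwarz
makes the bound uniform in `h`. This matters because `h` will be `A f - A f†` at a random iterate.
-/
theorem norm_resolventEmb_sub_le {n : ℕ} (z : Fin n → X × Y) {ω : ℝ} (hω : 0 ≤ ω)
    (hz : covDeviation hK ρ e l lam z ≤ ENNReal.ofReal (ω ^ 2)) (h : H₂) :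
    ‖resolventEmb (inclusion hK ρ.fst) lam ((empCov H₂ z - covOp hK ρ.fst) h)‖ ≤ ω * ‖h‖ := by
  have hl := eigenvalue_nonneg (B := inclusion hK ρ.fst) he
  set D := empCov H₂ z - covOp hK ρ.fst with hD
  have hsymm : ∀ g h : H₂, ⟪g, D h⟫_ℝ = ⟪D g, h⟫_ℝ := by
    intro g h
    rw [real_inner_comm h (D g), hD, sub_apply, sub_apply, inner_sub_right, inner_sub_right,
      inner_empCov, inner_empCov, inner_covOp, inner_covOp]
    simp_rw [real_inner_comm (h _) (g _)]
  have hsum := hasSum_norm_sq_resolventEmb (S := inclusion hK ρ.fst) hlam he (D h)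
  have hpos : ∀ i, 0 < l i + lam := fun i => by linarith [hl i]
  have key : ENNReal.ofReal (‖resolventEmb (inclusion hK ρ.fst) lam (D h)‖ ^ 2)
      ≤ ENNReal.ofReal ((ω * ‖h‖) ^ 2) := by
    rw [← hsum.tsum_eq, ENNReal.ofReal_tsum_of_nonneg
      (fun i => div_nonneg (sq_nonneg _) (hpos i).le) hsum.summable, mul_pow,
      ENNReal.ofReal_mul (sq_nonneg _)]
    refine le_trans ?_ (mul_le_mul_left hz _)
    unfold covDeviation
    rw [← ENNReal.tsum_mul_right]
    refine ENNReal.tsum_le_tsum fun m => ?_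
    rw [tsum_ofReal_inner_sq e, mul_assoc, ← ENNReal.ofReal_mul (sq_nonneg _), div_eq_inv_mul,
      ENNReal.ofReal_mul (inv_nonneg.2 (hpos m).le)]
    gcongr
    rw [hsymm, ← mul_pow, ← hD]
    exact sq_le_sq' (by linarith [neg_abs_le ⟪D (e m), h⟫_ℝ, abs_real_inner_le_norm (D (e m)) h])
      (real_inner_le_norm _ _)
  exact le_of_sq_le_sq ((ENNReal.ofReal_le_ofReal_iff (sq_nonneg _)).1 key) (by positivity)

omit hlam he in
theorem measurable_covDeviation [SecondCountableTopology H₂] (n : ℕ) :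
    Measurable fun z : Fin n → X × Y => covDeviation hK ρ e l lam z := by
  have : Countable ι := countable_hilbertBasis e
  unfold covDeviation
  refine Measurable.tsum fun m => Measurable.const_mul (Measurable.tsum fun i => ?_) _
  refine ENNReal.measurable_ofReal.comp (Measurable.pow_const ?_ 2)
  simp only [sub_apply, inner_sub_right, inner_empCov]
  refine Measurable.sub_const (Measurable.const_mul (Finset.measurable_fun_sum _ fun j _ => ?_) _) _
  exact ((hK.measurable_coe _).comp (measurable_fst.comp (measurable_pi_apply j))).inner
    ((hK.measurable_coe _).comp (measurable_fst.comp (measurable_pi_apply j)))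

theorem lintegral_covDeviation_le [SecondCountableTopology H₂] {n : ℕ} (hn : 0 < n) :
    ∫⁻ z : Fin n → X × Y, covDeviation hK ρ e l lam z ∂(Measure.pi fun _ => ρ)
      ≤ ENNReal.ofReal (κ₀ ^ 2 / n) * effDim (covOp hK ρ.fst) lam := by
  have : Countable ι := countable_hilbertBasis e
  have hl := eigenvalue_nonneg (B := inclusion hK ρ.fst) he
  have hpos : ∀ i, 0 < l i + lam := fun i => by linarith [hl i]
  have hm : ∀ m i, Measurable fun z : Fin n → X × Y =>
      ENNReal.ofReal (⟪e i, (empCov H₂ z - covOp hK ρ.fst) (e m)⟫_ℝ ^ 2) := by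
    intro m i
    refine ENNReal.measurable_ofReal.comp (Measurable.pow_const ?_ 2)
    simp only [sub_apply, inner_sub_right, inner_empCov]
    refine Measurable.sub_const
      (Measurable.const_mul (Finset.measurable_fun_sum _ fun j _ => ?_) _) _
    exact ((hK.measurable_coe _).comp (measurable_fst.comp (measurable_pi_apply j))).inner
      ((hK.measurable_coe _).comp (measurable_fst.comp (measurable_pi_apply j)))
  have hmX : ∀ m i, Measurable fun x : X => ENNReal.ofReal (⟪e i x, e m x⟫_ℝ ^ 2) := fun m i =>
    ENNReal.measurable_ofReal.comp
      (((hK.measurable_coe (e i)).inner (hK.measurable_coe (e m))).pow_const 2)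
  have hone : ∀ m i, ∫⁻ z : Fin n → X × Y,
      ENNReal.ofReal (⟪e i, (empCov H₂ z - covOp hK ρ.fst) (e m)⟫_ℝ ^ 2) ∂(Measure.pi fun _ => ρ)
      ≤ ENNReal.ofReal (n : ℝ)⁻¹ * ∫⁻ x, ENNReal.ofReal (⟪e i x, e m x⟫_ℝ ^ 2) ∂ρ.fst := by
    intro m i
    have hint : ∫ x, ⟪e i x, e m x⟫_ℝ ∂ρ.fst = ∫ z, ⟪e i z.1, e m z.1⟫_ℝ ∂ρ := by
      rw [Measure.fst, integral_map measurable_fst.aemeasurable]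
      exact ((hK.measurable_coe (e i)).inner (hK.measurable_coe (e m))).aestronglyMeasurable
    have hlint : ∫⁻ x, ENNReal.ofReal (⟪e i x, e m x⟫_ℝ ^ 2) ∂ρ.fst
        = ∫⁻ z, ENNReal.ofReal (⟪e i z.1, e m z.1⟫_ℝ ^ 2) ∂ρ := by
      rw [Measure.fst, lintegral_map (hmX m i) measurable_fst]
    simp only [sub_apply, inner_sub_right, inner_empCov, inner_covOp]
    rw [hint, hlint]
    exact lintegral_sq_empirical_mean_le (hK.memLp_inner ρ (e i) (e m)) hn
  calc _ = ∑' m, ENNReal.ofReal (l m + lam)⁻¹ * ∑' i, ∫⁻ z : Fin n → X × Y,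
        ENNReal.ofReal (⟪e i, (empCov H₂ z - covOp hK ρ.fst) (e m)⟫_ℝ ^ 2)
          ∂(Measure.pi fun _ => ρ) := by
        unfold covDeviation
        rw [lintegral_tsum fun m =>
          ((Measurable.tsum fun i => hm m i).const_mul _).aemeasurable]
        refine tsum_congr fun m => ?_
        rw [lintegral_const_mul _ (Measurable.tsum fun i => hm m i),
          lintegral_tsum fun i => (hm m i).aemeasurable]
    _ ≤ ∑' m, ENNReal.ofReal (l m + lam)⁻¹ * ∑' i, (ENNReal.ofReal (n : ℝ)⁻¹ *
          ∫⁻ x, ENNReal.ofReal (⟪e i x, e m x⟫_ℝ ^ 2) ∂ρ.fst) := by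
        gcongr with m i
        exact hone m i
    _ = ENNReal.ofReal (n : ℝ)⁻¹ * ∫⁻ x, ∑' m, ENNReal.ofReal (l m + lam)⁻¹ *
          ∑' i, ENNReal.ofReal (⟪e i x, e m x⟫_ℝ ^ 2) ∂ρ.fst := by
        rw [lintegral_tsum fun m =>
          ((Measurable.tsum fun i => hmX m i).const_mul _).aemeasurable,
          ← ENNReal.tsum_mul_left]
        refine tsum_congr fun m => ?_
        rw [lintegral_const_mul _ (Measurable.tsum fun i => hmX m i),
          lintegral_tsum fun i => (hmX m i).aemeasurable, ENNReal.tsum_mul_left]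
        ring
    -- After Cauchy-Schwarz in `Y`, the sum over `i` is the trace bound `κ₀ ^ 2` and the sum over
    -- `m` is the leverage.
    _ ≤ ENNReal.ofReal (n : ℝ)⁻¹ * ∫⁻ x, ENNReal.ofReal (κ₀ ^ 2) * leverage e l lam x ∂ρ.fst := by
        gcongr with x
        unfold leverage
        rw [← ENNReal.tsum_mul_left]
        refine ENNReal.tsum_le_tsum fun m => ?_
        calc _ ≤ ENNReal.ofReal (l m + lam)⁻¹ *
              ∑' i, (ENNReal.ofReal (‖e i x‖ ^ 2) * ENNReal.ofReal (‖e m x‖ ^ 2)) := by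
              gcongr with i
              rw [← ENNReal.ofReal_mul (sq_nonneg _), ← mul_pow]
              exact ENNReal.ofReal_le_ofReal (sq_le_sq' (by
                linarith [neg_abs_le ⟪e i x, e m x⟫_ℝ, abs_real_inner_le_norm (e i x) (e m x)])
                (real_inner_le_norm _ _))
          _ ≤ ENNReal.ofReal (l m + lam)⁻¹ *
              (ENNReal.ofReal (κ₀ ^ 2) * ENNReal.ofReal (‖e m x‖ ^ 2)) := by
              rw [ENNReal.tsum_mul_right]
              gcongr
              exact hK.tsum_norm_sq_apply_le e x
          _ = _ := by
              rw [div_eq_mul_inv, ENNReal.ofReal_mul (sq_nonneg _)]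
              ring
    _ = _ := by
        have hlev : Measurable fun x => leverage e l lam x := by
          refine Measurable.tsum fun i => ENNReal.measurable_ofReal.comp ?_
          exact ((hK.measurable_coe (e i)).norm.pow_const 2).div_const _
        rw [lintegral_const_mul _ hlev, lintegral_leverage hK hlam he, ← mul_assoc,
          ← ENNReal.ofReal_mul (by positivity), div_eq_inv_mul]

end Concentration

/-! ### Moments of the whitened noise and the good event -/

section Noise

theorem stronglyMeasurable_of_inner_basis {Z H : Type*} [MeasurableSpace Z]
    [NormedAddCommGroup H] [InnerProductSpace ℝ H] {ι : Type*} [Countable ι]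
    (b : HilbertBasis ι ℝ H) {Φ : Z → H} (h : ∀ i, Measurable fun z => ⟪b i, Φ z⟫_ℝ) :
    StronglyMeasurable Φ := by
  refine stronglyMeasurable_of_tendsto (f := fun (s : Finset ι) z => ∑ i ∈ s, ⟪b i, Φ z⟫_ℝ • b i)
    Filter.atTop (fun s => Finset.stronglyMeasurable_fun_sum s fun i _ =>
      (h i).stronglyMeasurable.smul_const (b i)) ?_
  rw [tendsto_pi_nhds]
  intro z
  have := b.hasSum_repr (Φ z)
  simp_rw [b.repr_apply_apply] at this
  exact this

variable {X Y : Type*} [MeasurableSpace X]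
  [NormedAddCommGroup Y] [InnerProductSpace ℝ Y] [CompleteSpace Y]
  [SecondCountableTopology Y] [MeasurableSpace Y] [BorelSpace Y]
  {H₂ : Type*} [NormedAddCommGroup H₂] [InnerProductSpace ℝ H₂] [CompleteSpace H₂]
  [SecondCountableTopology H₂] [RKHS ℝ H₂ X Y] {κ₀ : ℝ}

theorem KernelCondition.stronglyMeasurable_kerFun_residual (hK : KernelCondition H₂ κ₀) (f : H₂) :
    StronglyMeasurable fun z : X × Y => RKHS.kerFun H₂ z.1 (z.2 - f z.1) := by
  obtain ⟨w, b, -⟩ := exists_hilbertBasis ℝ H₂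
  have : Countable w := countable_hilbertBasis b
  refine stronglyMeasurable_of_inner_basis b fun i => ?_
  simp_rw [RKHS.inner_kerFun]
  exact ((hK.measurable_coe (b i)).comp measurable_fst).inner
    (measurable_snd.sub ((hK.measurable_coe f).comp measurable_fst))

variable (hK : KernelCondition H₂ κ₀) (ρ : Measure (X × Y)) [IsProbabilityMeasure ρ]
  {lam : ℝ}

/-- The whitened noise `(L + lam I) ^ (-1/2) K_x (y - f x)` attached to a sample `(x, y)`. -/
def noiseVar (lam : ℝ) (f : H₂) (z : X × Y) : WithLp 2 (Lp Y 2 ρ.fst × H₂) :=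
  resolventEmb (inclusion hK ρ.fst) lam (RKHS.kerFun H₂ z.1 (z.2 - f z.1))

theorem stronglyMeasurable_noiseVar (f : H₂) : StronglyMeasurable (noiseVar hK ρ lam f) :=
  (resolventEmb (inclusion hK ρ.fst) lam).continuous.comp_stronglyMeasurable
    (hK.stronglyMeasurable_kerFun_residual f)

variable {ι : Type*} {e : HilbertBasis ι ℝ H₂} {l : ι → ℝ}
  (hlam : 0 < lam) (he : ∀ i, covOp hK ρ.fst (e i) = l i • e i)
include hlam he

omit [SecondCountableTopology H₂] in
-- Only two of the `k` powers are bounded by the leverage, whose integral is the effective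
-- dimension. The others use the uniform bound `κ₀ / √lam`.
theorem enorm_noiseVar_pow_le (hκ : 0 ≤ κ₀) (f : H₂) (z : X × Y) {k : ℕ} (hk : 2 ≤ k) :
    ‖noiseVar hK ρ lam f z‖ₑ ^ k
      ≤ leverage e l lam z.1 * ENNReal.ofReal (κ₀ / √lam) ^ (k - 2) * ‖z.2 - f z.1‖ₑ ^ k := by
  have h := ofReal_norm_sq_resolventEmb_kerFun_le hK hlam he z.1 (z.2 - f z.1)
  rw [ENNReal.ofReal_pow (norm_nonneg _), ENNReal.ofReal_pow (norm_nonneg _), ofReal_norm,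
    ofReal_norm] at h
  change ‖noiseVar hK ρ lam f z‖ₑ ^ 2 ≤ _ at h
  have hlev := leverage_le hK hlam he z.1
  have h1 : ‖noiseVar hK ρ lam f z‖ₑ ≤ ENNReal.ofReal (κ₀ / √lam) * ‖z.2 - f z.1‖ₑ := by
    have : ‖noiseVar hK ρ lam f z‖ₑ ^ 2 ≤ (ENNReal.ofReal (κ₀ / √lam) * ‖z.2 - f z.1‖ₑ) ^ 2 := by
      rw [mul_pow, ← ENNReal.ofReal_pow (by positivity), div_pow, Real.sq_sqrt hlam.le]
      exact h.trans (mul_le_mul_left hlev _)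
    exact (ENNReal.pow_le_pow_left_iff two_ne_zero).1 this
  obtain ⟨j, rfl⟩ := Nat.exists_eq_add_of_le hk
  rw [Nat.add_sub_cancel_left, pow_add]
  calc _ ≤ (leverage e l lam z.1 * ‖z.2 - f z.1‖ₑ ^ 2) *
        (ENNReal.ofReal (κ₀ / √lam) * ‖z.2 - f z.1‖ₑ) ^ j := by gcongr
    _ = _ := by rw [mul_pow, pow_add]; ring

variable {H₁ : Type*} {A : H₁ → H₂} {fdag : H₁}

/-- Conditioning on `x` applies the noise moments first; the leverage is then integrated. This gives
Bernstein parameters `V = σ √N` and `Lb = M κ₀ / √lam`. -/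
theorem lintegral_enorm_noiseVar_pow_le (hκ : 0 ≤ κ₀) {M σ N : ℝ} (hM : 0 ≤ M)
    (hnoise : NoiseCondition ρ A fdag M σ)
    (hN : effDim (covOp hK ρ.fst) lam ≤ ENNReal.ofReal N) (hN0 : 0 ≤ N) {k : ℕ} (hk : 2 ≤ k) :
    ∫⁻ z, ‖noiseVar hK ρ lam (A fdag) z‖ₑ ^ k ∂ρ
      ≤ ENNReal.ofReal (1 / 2 * (k.factorial : ℝ) * (σ * √N) ^ 2 * (M * κ₀ / √lam) ^ (k - 2)) := by
  have : Countable ι := countable_hilbertBasis e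
  have hlev : Measurable fun x => leverage e l lam x := by
    refine Measurable.tsum fun i => ENNReal.measurable_ofReal.comp ?_
    exact ((hK.measurable_coe (e i)).norm.pow_const 2).div_const _
  have hres : Measurable fun z : X × Y => ‖z.2 - A fdag z.1‖ₑ ^ k :=
    (measurable_snd.sub ((hK.measurable_coe (A fdag)).comp measurable_fst)).enorm.pow_const k
  set c := ENNReal.ofReal (κ₀ / √lam) ^ (k - 2) with hc
  set C := ENNReal.ofReal (1 / 2 * (k.factorial : ℝ) * σ ^ 2 * M ^ (k - 2)) with hC
  calc _ ≤ ∫⁻ z, leverage e l lam z.1 * c * ‖z.2 - A fdag z.1‖ₑ ^ k ∂ρ :=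
        lintegral_mono fun z => enorm_noiseVar_pow_le hK ρ hlam he hκ (A fdag) z hk
    _ = ∫⁻ x, ∫⁻ y, leverage e l lam x * c * ‖y - A fdag x‖ₑ ^ k ∂(ρ.condKernel x) ∂ρ.fst := by
        rw [← Measure.lintegral_condKernel (ρ := ρ)]
        exact ((hlev.comp measurable_fst).mul_const c).mul hres
    _ ≤ ∫⁻ x, leverage e l lam x * (c * C) ∂ρ.fst := by
        refine lintegral_mono_ae ?_
        filter_upwards [hnoise] with x hx
        have hy : Measurable fun y => ‖y - A fdag x‖ₑ ^ k :=
          (measurable_id.sub_const (A fdag x)).enorm.pow_const k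
        rw [lintegral_const_mul _ hy, mul_assoc]
        have := hx k hk
        gcongr
    _ = effDim (covOp hK ρ.fst) lam * (c * C) := by
        rw [lintegral_mul_const _ hlev, lintegral_leverage hK hlam he]
    _ ≤ ENNReal.ofReal N * (c * C) := by gcongr
    _ = _ := by
        rw [hc, hC, ← ENNReal.ofReal_pow (by positivity), ← ENNReal.ofReal_mul (by positivity),
          ← ENNReal.ofReal_mul hN0]
        congr 1
        rw [mul_pow, Real.sq_sqrt hN0, mul_div_assoc, mul_pow M]
        ring

theorem integrable_noiseVar (hκ : 0 ≤ κ₀) {M σ N : ℝ} (hM : 0 ≤ M)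
    (hnoise : NoiseCondition ρ A fdag M σ)
    (hN : effDim (covOp hK ρ.fst) lam ≤ ENNReal.ofReal N) (hN0 : 0 ≤ N) :
    Integrable (noiseVar hK ρ lam (A fdag)) ρ := by
  have h := lintegral_enorm_noiseVar_pow_le hK ρ hlam he hκ hM hnoise hN hN0 le_rfl
  have hm := (stronglyMeasurable_noiseVar (lam := lam) hK ρ (A fdag)).aestronglyMeasurable (μ := ρ)
  have h2 : MemLp (noiseVar hK ρ lam (A fdag)) 2 ρ := by
    refine ⟨hm, ?_⟩
    rw [eLpNorm_lt_top_iff_lintegral_rpow_enorm_lt_top two_ne_zero ENNReal.ofNat_ne_top]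
    refine lt_of_le_of_lt (le_of_eq ?_) (h.trans_lt ENNReal.ofReal_lt_top)
    refine lintegral_congr fun z => ?_
    rw [← ENNReal.rpow_natCast]
    norm_num
  exact h2.integrable (by norm_num)

theorem integral_noiseVar (hκ : 0 ≤ κ₀) {M σ N : ℝ} (hM : 0 ≤ M)
    (htrue : TrueSolution ρ A fdag) (hnoise : NoiseCondition ρ A fdag M σ)
    (hN : effDim (covOp hK ρ.fst) lam ≤ ENNReal.ofReal N) (hN0 : 0 ≤ N) :
    ∫ z, noiseVar hK ρ lam (A fdag) z ∂ρ = 0 := by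
  have hi := integrable_noiseVar hK ρ hlam he hκ hM hnoise hN hN0
  rw [← Measure.integral_condKernel hi]
  refine integral_eq_zero_of_ae ?_
  filter_upwards [htrue] with x hx
  have h1 : Integrable (fun y => y - A fdag x) (ρ.condKernel x) := hx.1.sub (integrable_const _)
  have h2 := ((resolventEmb (inclusion hK ρ.fst) lam) ∘L (RKHS.kerFun H₂ x)).integral_comp_comm h1
  have h3 : ∫ y, (y - A fdag x) ∂(ρ.condKernel x) = 0 := by
    rw [integral_sub hx.1 (integrable_const _), ← hx.2]
    simp
  rw [h3, map_zero] at h2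
  exact h2

/-- With probability at least `1 - δ` the whitened averaged noise is of the order of the effective
dimension, and the empirical covariance is close to the covariance operator. -/
theorem exists_good_event (hκ : 0 ≤ κ₀) {M σ N δ R ω : ℝ} (hM : 0 ≤ M)
    (htrue : TrueSolution ρ A fdag) (hnoise : NoiseCondition ρ A fdag M σ)
    (hN : effDim (covOp hK ρ.fst) lam ≤ ENNReal.ofReal N) (hN0 : 0 ≤ N) {n : ℕ} (hn : 0 < n)
    (hδ : 0 < δ) (hδ1 : δ ≤ 1) (hR : 0 < R) (hRM : 2 * (M * κ₀ / √lam) ≤ R)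
    (hRσ : n * (σ * √N) ^ 2 ≤ R ^ 2) (hω : 0 < ω) (hωN : 2 * κ₀ ^ 2 * N ≤ δ * n * ω ^ 2) :
    ∃ E : Set (Fin n → X × Y), MeasurableSet E ∧
      ENNReal.ofReal (1 - δ) ≤ Measure.pi (fun _ : Fin n => ρ) E ∧
      ∀ z ∈ E, ‖∑ j, noiseVar hK ρ lam (A fdag) (z j)‖ ≤ R * (2 * Real.log (6 / δ)) ∧
        ∀ h : H₂, ‖resolventEmb (inclusion hK ρ.fst) lam
          ((empCov H₂ z - covOp hK ρ.fst) h)‖ ≤ ω * ‖h‖ := by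
  set P := Measure.pi (fun _ : Fin n => ρ) with hP
  have hmξ := stronglyMeasurable_noiseVar (lam := lam) hK ρ (A fdag)
  set E₁ : Set (Fin n → X × Y) :=
    {z | R * (2 * Real.log (6 / δ)) ≤ ‖∑ j, noiseVar hK ρ lam (A fdag) (z j)‖} with hE₁
  set E₂ : Set (Fin n → X × Y) :=
    {z | ENNReal.ofReal (ω ^ 2) ≤ covDeviation hK ρ e l lam z} with hE₂
  have hm₁ : MeasurableSet E₁ := measurableSet_le measurable_const
    (Finset.stronglyMeasurable_fun_sum _ fun j _ =>
      hmξ.comp_measurable (measurable_pi_apply j)).norm.measurable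
  have hm₂ : MeasurableSet E₂ := measurableSet_le measurable_const
    (measurable_covDeviation hK ρ n)
  have hp₁ : P E₁ ≤ ENNReal.ofReal (δ / 2) :=
    measure_le_norm_sum_le hmξ (integrable_noiseVar hK ρ hlam he hκ hM hnoise hN hN0)
      (integral_noiseVar hK ρ hlam he hκ hM htrue hnoise hN hN0) (by positivity)
      (fun k hk => lintegral_enorm_noiseVar_pow_le hK ρ hlam he hκ hM hnoise hN hN0 hk)
      n hR hRM hRσ hδ hδ1
  -- Markov's inequality suffices here; it costs a factor `1 / δ`, harmless because `δ` stays above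
  -- `δ₀`.
  have hp₂ : P E₂ ≤ ENNReal.ofReal (δ / 2) := by
    have h1 := mul_meas_ge_le_lintegral (μ := P) (measurable_covDeviation (e := e) (l := l)
      (lam := lam) hK ρ n) (ENNReal.ofReal (ω ^ 2))
    have h2 := h1.trans ((lintegral_covDeviation_le hK ρ hlam he hn).trans
      (mul_le_mul_right hN _))
    rw [← ENNReal.ofReal_mul (by positivity)] at h2
    have hω2 : 0 < ω ^ 2 := by positivity
    rw [mul_comm, ← ENNReal.le_div_iff_mul_le (Or.inl (by simpa using hω2.ne')) (Or.inl (by simp)),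
      ← ENNReal.ofReal_div_of_pos hω2] at h2
    refine h2.trans (ENNReal.ofReal_le_ofReal ?_)
    have hn' : (0 : ℝ) < n := by exact_mod_cast hn
    rw [div_le_iff₀ hω2, div_mul_eq_mul_div, div_le_iff₀ hn']
    linarith
  refine ⟨(E₁ ∪ E₂)ᶜ, (hm₁.union hm₂).compl, ?_, ?_⟩
  · rw [prob_compl_eq_one_sub (hm₁.union hm₂), ENNReal.ofReal_sub _ hδ.le, ENNReal.ofReal_one]
    refine tsub_le_tsub_left ?_ _
    refine (measure_union_le _ _).trans ((add_le_add hp₁ hp₂).trans ?_)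
    rw [← ENNReal.ofReal_add (by positivity) (by positivity), add_halves]
  · intro z hz
    rw [Set.compl_union] at hz
    refine ⟨le_of_lt (not_le.1 hz.1), fun h => ?_⟩
    exact norm_resolventEmb_sub_le hK ρ hlam he z hω.le (le_of_lt (not_le.1 hz.2)) h

end Noise

/-! ### Gradient descent as a perturbed linear iteration -/

section Residual

variable {G H F : Type*} [NormedAddCommGroup G] [InnerProductSpace ℝ G] [CompleteSpace G]
  [NormedAddCommGroup H] [InnerProductSpace ℝ H] [CompleteSpace H]
  [NormedAddCommGroup F] [InnerProductSpace ℝ F] [CompleteSpace F]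

/-- Each of `Δ` and `ζ` is written as `S* S x + lam x` with `x` its resolvent, and `A'* S* = B* R*`
moves the first parts through `B*`. Replacing `R*` by the identity isolates the linear term `w` and
the noise `-S (resolvent S lam ζ)`, which depends neither on `R` nor on `A'`. -/
theorem adjoint_residual_eq (S : H →L[ℝ] F) (A' : G →L[ℝ] H) (B : G →L[ℝ] F) (R : F →L[ℝ] F)
    (hR : S ∘L A' = R ∘L B) {lam : ℝ} (hlam : 0 < lam) (h Δ ζ : H) (w : F) :
    A'.adjoint (S.adjoint (S h) + Δ - ζ)
      = B.adjoint (w + (-S (resolvent S lam ζ)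
          + ((R.adjoint - ContinuousLinearMap.id ℝ F) w + R.adjoint (S h - w)
            + (R.adjoint - ContinuousLinearMap.id ℝ F) (-S (resolvent S lam ζ))
            + R.adjoint (S (resolvent S lam Δ)))))
        + √lam • A'.adjoint (√lam • resolvent S lam Δ - √lam • resolvent S lam ζ) := by
  have hadj : ∀ w : F, A'.adjoint (S.adjoint w) = B.adjoint (R.adjoint w) := by
    intro w
    have := congrArg ContinuousLinearMap.adjoint hR
    rw [ContinuousLinearMap.adjoint_comp, ContinuousLinearMap.adjoint_comp] at this
    exact DFunLike.congr_fun this w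
  have h2 := adjoint_resolvent_add (S := S) hlam Δ
  have h3 := adjoint_resolvent_add (S := S) hlam ζ
  have h4 : √lam • A'.adjoint (√lam • resolvent S lam Δ - √lam • resolvent S lam ζ)
      = A'.adjoint (lam • resolvent S lam Δ) - A'.adjoint (lam • resolvent S lam ζ) := by
    rw [← map_smul, smul_sub, smul_smul, smul_smul, Real.mul_self_sqrt hlam.le, map_sub]
  rw [h4]
  nth_rewrite 1 [← h2, ← h3]
  simp only [map_add, map_sub, map_neg, hadj, sub_apply, ContinuousLinearMap.id_apply]
  abel

end Residual

section Descent

variable {X Y : Type*} [MeasurableSpace X]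
  [NormedAddCommGroup Y] [InnerProductSpace ℝ Y] [CompleteSpace Y]
  [SecondCountableTopology Y] [MeasurableSpace Y] [BorelSpace Y]
  {H₁ : Type*} [NormedAddCommGroup H₁] [InnerProductSpace ℝ H₁] [CompleteSpace H₁]
  {H₂ : Type*} [NormedAddCommGroup H₂] [InnerProductSpace ℝ H₂] [CompleteSpace H₂]
  [RKHS ℝ H₂ X Y] {κ₀ : ℝ}
  {A : H₁ → H₂} {dom : Set H₁} {fdag : H₁} {d ℓ : ℝ}

/-- The averaged noise `n⁻¹ ∑ j, K_{x_j} (y_j - f x_j)` in the reproducing kernel space. -/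
def empNoise (f : H₂) {n : ℕ} (z : Fin n → X × Y) : H₂ :=
  (n : ℝ)⁻¹ • ∑ j, RKHS.kerFun H₂ (z j).1 ((z j).2 - f (z j).1)

omit [MeasurableSpace X] [SecondCountableTopology Y] [MeasurableSpace Y] [BorelSpace Y] in
-- Writing `y_j` as `A f† (x_j)` plus noise separates the empirical covariance, applied to `A f - A
-- f†`, from noise independent of the iterate.
theorem gdStep_eq (η : ℝ) {n : ℕ} (z : Fin n → X × Y) (f : H₁) :
    gdStep A η z f = f - η • (fderiv ℝ A f).adjoint
      (empCov H₂ z (A f - A fdag) - empNoise (A fdag) z) := by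
  have h1 : ∀ j, (evalCLM H₂ (z j).1 ∘L fderiv ℝ A f).adjoint (A f (z j).1 - (z j).2)
      = (fderiv ℝ A f).adjoint (RKHS.kerFun H₂ (z j).1 (A f (z j).1 - (z j).2)) := by
    intro j
    rw [ContinuousLinearMap.adjoint_comp]
    rfl
  unfold gdStep
  rw [Finset.sum_congr rfl fun j _ => h1 j, ← map_sum, ← map_smul, empCov_apply, empNoise,
    ← smul_sub, ← Finset.sum_sub_distrib]
  have h2 : ∀ j, RKHS.kerFun H₂ (z j).1 ((A f - A fdag) (z j).1)
      - RKHS.kerFun H₂ (z j).1 ((z j).2 - A fdag (z j).1)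
      = RKHS.kerFun H₂ (z j).1 (A f (z j).1 - (z j).2) := by
    intro j
    rw [← map_sub, RKHS.coe_sub, Pi.sub_apply]
    congr 1
    abel
  rw [Finset.sum_congr rfl fun j _ => h2 j]

theorem resolventEmb_empNoise (hK : KernelCondition H₂ κ₀) (ρ : Measure (X × Y))
    [IsProbabilityMeasure ρ] {lam : ℝ} (f : H₂) {n : ℕ} (z : Fin n → X × Y) :
    resolventEmb (inclusion hK ρ.fst) lam (empNoise f z)
      = (n : ℝ)⁻¹ • ∑ j, noiseVar hK ρ lam f (z j) := by
  simp only [empNoise, map_smul, map_sum]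
  rfl

omit [CompleteSpace H₁] [CompleteSpace H₂] in
theorem FrechetCondition.norm_sub_le (hF : FrechetCondition A dom fdag d ℓ)
    (hdom : Metric.ball fdag d ⊆ dom) {f : H₁} (hf : f ∈ Metric.ball fdag d) :
    ‖A f - A fdag‖ ≤ ℓ * ‖f - fdag‖ := by
  refine (convex_ball fdag d).norm_image_sub_le_of_norm_fderiv_le (𝕜 := ℝ)
    (fun x hx => (hF x ⟨hx, hdom hx⟩).1) (fun x hx => (hF x ⟨hx, hdom hx⟩).2) ?_ hf
  exact Metric.mem_ball_self (dist_nonneg.trans_lt (Metric.mem_ball.1 hf))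

omit [CompleteSpace H₁] in
/-- The linearization error at `f†`, measured in `L²`. -/
theorem norm_inclusion_sub_linOp_le (hK : KernelCondition H₂ κ₀) (μ : Measure X)
    [IsProbabilityMeasure μ] (hF : FrechetCondition A dom fdag d ℓ)
    (hdom : Metric.ball fdag d ⊆ dom) {CR : ℝ} (hCR : 0 ≤ CR)
    {R : H₁ → Lp Y 2 μ →L[ℝ] Lp Y 2 μ}
    (hR : ∀ f ∈ Metric.ball fdag d, inclusion hK μ ∘L fderiv ℝ A f = R f ∘L linOp hK μ A fdag)
    (hR1 : ∀ f ∈ Metric.ball fdag d,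
      ‖R f - ContinuousLinearMap.id ℝ (Lp Y 2 μ)‖ ≤ CR * ‖f - fdag‖)
    {f : H₁} (hf : f ∈ Metric.ball fdag d) :
    ‖inclusion hK μ (A f - A fdag) - linOp hK μ A fdag (f - fdag)‖
      ≤ CR * ‖f - fdag‖ * ‖linOp hK μ A fdag (f - fdag)‖ := by
  set B := linOp hK μ A fdag
  set S := inclusion hK μ
  set e := f - fdag with he
  have hd : ‖e‖ < d := by rwa [he, ← dist_eq_norm]
  have hmem : ∀ s ∈ Set.Icc (0 : ℝ) 1, fdag + s • e ∈ Metric.ball fdag d := by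
    intro s hs
    rw [Metric.mem_ball, dist_eq_norm, add_sub_cancel_left, norm_smul, Real.norm_of_nonneg hs.1]
    exact (mul_le_of_le_one_left (norm_nonneg _) hs.2).trans_lt hd
  -- Along the segment range invariance turns the derivative of the linearization error into `(R -
  -- I) (B e)`; the mean value inequality then yields a bound containing `‖B e‖`.
  have hder : ∀ s ∈ Set.Icc (0 : ℝ) 1, HasDerivWithinAt (fun s : ℝ => S (A (fdag + s • e)) - s • B e)
      ((R (fdag + s • e) - ContinuousLinearMap.id ℝ (Lp Y 2 μ)) (B e)) (Set.Icc 0 1) s := by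
    intro s hs
    have h1 : HasDerivAt (fun s : ℝ => fdag + s • e) e s := by
      simpa using ((hasDerivAt_id s).smul_const e).const_add fdag
    have h2 := (hF _ ⟨hmem s hs, hdom (hmem s hs)⟩).1.hasFDerivAt
    have h3 := S.hasFDerivAt.comp_hasDerivAt s (h2.comp_hasDerivAt s h1)
    have h4 : HasDerivAt (fun s : ℝ => s • B e) (B e) s := by
      simpa using (hasDerivAt_id s).smul_const (B e)
    have h5 : S (fderiv ℝ A (fdag + s • e) e) = R (fdag + s • e) (B e) :=
      DFunLike.congr_fun (hR _ (hmem s hs)) e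
    have h6 := (h3.sub h4).hasDerivWithinAt (s := Set.Icc 0 1)
    rw [h5] at h6
    exact h6
  have hmain := norm_image_sub_le_of_norm_deriv_le_segment_01' (C := CR * ‖e‖ * ‖B e‖) hder ?_
  · refine le_trans (le_of_eq ?_) hmain
    have : fdag + e = f := by rw [he]; abel
    simp only [one_smul, zero_smul, add_zero, sub_zero, this, map_sub]
    congr 1
    abel
  · intro s hs
    refine ((_ : Lp Y 2 μ →L[ℝ] Lp Y 2 μ).le_opNorm _).trans ?_
    gcongr
    refine (hR1 _ (hmem s ⟨hs.1, hs.2.le⟩)).trans ?_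
    rw [add_sub_cancel_left, norm_smul, Real.norm_of_nonneg hs.1]
    gcongr
    exact mul_le_of_le_one_left (norm_nonneg _) hs.2.le

/-- One step of gradient descent in the form needed for `perturbed_landweber_bound`. -/
theorem exists_gdStep_decomposition (hK : KernelCondition H₂ κ₀) (μ : Measure X)
    [IsProbabilityMeasure μ] (hF : FrechetCondition A dom fdag d ℓ)
    (hdom : Metric.ball fdag d ⊆ dom) {CRt CR : ℝ} (hCRt : 0 ≤ CRt) (hCR : 0 ≤ CR)
    (hRI : RangeInvariance hK μ A dom fdag d CRt CR) (η : ℝ) (hℓ : 0 ≤ ℓ)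
    {lam : ℝ} (hlam : 0 < lam) {n : ℕ} {z : Fin n → X × Y} {N ω : ℝ} (hω : 0 ≤ ω)
    (hN : ‖resolventEmb (inclusion hK μ) lam (empNoise (A fdag) z)‖ ≤ N)
    (hcov : ∀ h : H₂, ‖resolventEmb (inclusion hK μ) lam
      ((empCov H₂ z - covOp hK μ) h)‖ ≤ ω * ‖h‖)
    {f : H₁} (hf : f ∈ Metric.ball fdag d) :
    ∃ (y : Lp Y 2 μ) (p : H₁),
      gdStep A η z f - fdag
        = ((1 : H₁ →L[ℝ] H₁) - η • ((linOp hK μ A fdag).adjoint ∘L linOp hK μ A fdag)) (f - fdag)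
          - η • ((linOp hK μ A fdag).adjoint
            (-inclusion hK μ (resolvent (inclusion hK μ) lam (empNoise (A fdag) z)) + y)
            + √lam • p) ∧
      ‖y‖ ≤ (CR + CRt * CR) * ‖f - fdag‖ * ‖linOp hK μ A fdag (f - fdag)‖
        + (CR * N + CRt * ℓ * ω) * ‖f - fdag‖ ∧
      ‖p‖ ≤ ℓ * N + ℓ ^ 2 * ω * ‖f - fdag‖ := by
  obtain ⟨R, hR⟩ := hRI
  have hR0 : ∀ f ∈ Metric.ball fdag d,
      inclusion hK μ ∘L fderiv ℝ A f = R f ∘L linOp hK μ A fdag :=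
    fun f hf => (hR f ⟨hf, hdom hf⟩).1
  have hR1 := fun f hf => (hR f ⟨hf, hdom hf⟩).2.2
  have hlin := norm_inclusion_sub_linOp_le hK μ hF hdom hCR hR0 hR1 hf
  have hh := hF.norm_sub_le hdom hf
  have hA := (hF f ⟨hf, hdom hf⟩).2
  have hRt : ‖(R f).adjoint‖ ≤ CRt := by
    rw [LinearIsometryEquiv.norm_map]; exact (hR f ⟨hf, hdom hf⟩).2.1
  have hRI1 : ‖(R f).adjoint - ContinuousLinearMap.id ℝ (Lp Y 2 μ)‖ ≤ CR * ‖f - fdag‖ := by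
    refine le_trans (le_of_eq ?_) (hR1 f hf)
    rw [← LinearIsometryEquiv.norm_map ContinuousLinearMap.adjoint
      (R f - ContinuousLinearMap.id ℝ (Lp Y 2 μ)), map_sub]
    congr 2
    exact (ContinuousLinearMap.adjoint_id).symm
  set S := inclusion hK μ with hS
  set B := linOp hK μ A fdag with hB
  set e := f - fdag with he
  set h := A f - A fdag with hh'
  set ζ := empNoise (A fdag) z with hζ
  set Δ := (empCov H₂ z - covOp hK μ) h with hΔ
  have hΔN : ‖resolventEmb S lam Δ‖ ≤ ω * (ℓ * ‖e‖) := (hcov h).trans (by gcongr)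
  have hN0 : 0 ≤ N := (norm_nonneg _).trans hN
  set q := S h - B e with hq
  -- The four parts of `y`: the change of `R` acting on `B e`, the linearization error, the change
  -- of `R` acting on the noise, and the smoothed covariance error.
  refine ⟨((R f).adjoint - ContinuousLinearMap.id ℝ (Lp Y 2 μ)) (B e) + (R f).adjoint q
      + ((R f).adjoint - ContinuousLinearMap.id ℝ (Lp Y 2 μ)) (-S (resolvent S lam ζ))
      + (R f).adjoint (S (resolvent S lam Δ)),
    (fderiv ℝ A f).adjoint (√lam • resolvent S lam Δ - √lam • resolvent S lam ζ), ?_, ?_, ?_⟩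
  · have h1 : empCov H₂ z h = S.adjoint (S h) + Δ := by
      rw [hΔ, sub_apply]
      change _ = S.adjoint (S h) + (empCov H₂ z h - S.adjoint (S h))
      abel
    have h2 := adjoint_residual_eq S (fderiv ℝ A f) B (R f) (hR0 f hf) hlam h Δ ζ (B e)
    rw [gdStep_eq (fdag := fdag), ← hh', ← hζ, h1, h2, map_add, hq, he]
    simp only [sub_apply, smul_apply, one_apply_eq_self, ContinuousLinearMap.comp_apply, smul_add]
    abel
  · have hv : ‖S (resolvent S lam ζ)‖ ≤ N := (norm_apply_resolvent_le ζ).trans hN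
    have hu : ‖S (resolvent S lam Δ)‖ ≤ ω * (ℓ * ‖e‖) := (norm_apply_resolvent_le Δ).trans hΔN
    have b1 := (((R f).adjoint - ContinuousLinearMap.id ℝ (Lp Y 2 μ)).le_of_opNorm_le hRI1 (B e))
    have b2 := ((R f).adjoint.le_of_opNorm_le hRt q)
    have b3 := (((R f).adjoint - ContinuousLinearMap.id ℝ (Lp Y 2 μ)).le_of_opNorm_le hRI1
      (-S (resolvent S lam ζ)))
    have b4 := ((R f).adjoint.le_of_opNorm_le hRt (S (resolvent S lam Δ)))
    rw [norm_neg] at b3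
    have b2' : CRt * ‖q‖ ≤ CRt * (CR * ‖e‖ * ‖B e‖) := by gcongr
    have b3' : CR * ‖e‖ * ‖S (resolvent S lam ζ)‖ ≤ CR * ‖e‖ * N := by gcongr
    have b4' : CRt * ‖S (resolvent S lam Δ)‖ ≤ CRt * (ω * (ℓ * ‖e‖)) := by gcongr
    refine (norm_add_le _ _).trans ?_
    refine (add_le_add_left (norm_add₃_le) _).trans ?_
    linarith
  · have hv := (norm_sqrt_smul_resolvent_le (S := S) (lam := lam) ζ).trans hN
    have hu := (norm_sqrt_smul_resolvent_le (S := S) (lam := lam) Δ).trans hΔN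
    have hA' : ‖(fderiv ℝ A f).adjoint‖ ≤ ℓ := by
      rw [LinearIsometryEquiv.norm_map]; exact hA
    refine ((fderiv ℝ A f).adjoint.le_of_opNorm_le hA' _).trans ?_
    calc _ ≤ ℓ * (ω * (ℓ * ‖e‖) + N) := by
          gcongr
          exact (norm_sub_le _ _).trans (add_le_add hu hv)
      _ = _ := by ring

end Descent

/-! ### The choice of parameters -/

section Parameters

/-- The amplitude of the error bound per unit of `(D + M + σ) log (6 / δ)`; `a` stands for
`min r (1 / 2)`. -/
def amplitude (r a κ₀ ℓ CR Cν : ℝ) : ℝ :=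
  2 * (((κ₀ * ℓ) ^ 2) ^ (r - a)
    + (2 + 2 * zetaSum (a / 2) * CR + 2 * ℓ) * (2 * (2 * κ₀ + Cν + 1)))

theorem amplitude_pos {r a κ₀ ℓ CR Cν : ℝ} (hκ : 0 < κ₀) (hℓ : 0 < ℓ) (hCR : 0 < CR)
    (hCν : 0 < Cν) : 0 < amplitude r a κ₀ ℓ CR Cν := by
  have := zetaSum_nonneg (a / 2)
  unfold amplitude
  positivity

theorem one_le_log_six_div {δ : ℝ} (hδ : 0 < δ) (hδ1 : δ ≤ 1) : 1 ≤ Real.log (6 / δ) := by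
  rw [Real.le_log_iff_exp_le (by positivity), le_div_iff₀ hδ]
  nlinarith [Real.exp_one_lt_d9, Real.exp_pos 1]

/-- `deltaZero` is the level at which this inequality becomes an equality. -/
theorem mul_log_le_of_deltaZero_le {C d η r δ : ℝ} (hC : 0 < C)
    (hδ : deltaZero C d η r ≤ δ) : C * Real.log (6 / δ) ≤ d * η ^ min r (1 / 2) := by
  have h0 : 0 < deltaZero C d η r := by unfold deltaZero; positivity
  have h1 : 6 / δ ≤ Real.exp (d / C * η ^ min r (1 / 2)) := by
    rw [div_le_iff₀ (h0.trans_le hδ)]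
    calc (6 : ℝ) = Real.exp (d / C * η ^ min r (1 / 2)) * deltaZero C d η r := by
          rw [deltaZero, mul_left_comm, ← Real.exp_add, neg_mul, add_neg_cancel, Real.exp_zero,
            mul_one]
      _ ≤ _ := by gcongr
  have h2 := (Real.log_le_iff_le_exp (div_pos (by norm_num) (h0.trans_le hδ))).2 h1
  calc _ ≤ C * (d / C * η ^ min r (1 / 2)) := by gcongr
    _ = _ := by field_simp

/-- The rate `n ^ (-1 / (2 a + ν + 1))` of the regularization parameter. -/
theorem regularization_rate {a ν : ℝ} (ha : 0 < a) (hν : 0 < ν) {n : ℕ} (hn : 0 < n) {lam : ℝ}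
    (hlam : lam = (n : ℝ) ^ (-(1 / (2 * a + ν + 1)))) :
    0 < lam ∧ lam ^ (-ν) = n * (lam ^ (a + 1 / 2)) ^ 2 ∧ 1 / √lam ≤ n * lam ^ (a + 1 / 2) := by
  have hn0 : (0 : ℝ) < n := by exact_mod_cast hn
  have hn1 : (1 : ℝ) ≤ n := by exact_mod_cast hn
  have hs : 0 < 2 * a + ν + 1 := by positivity
  have h0 : 0 < lam := by rw [hlam]; positivity
  have h1 : lam ≤ 1 := by
    rw [hlam]
    exact Real.rpow_le_one_of_one_le_of_nonpos hn1 (by rw [neg_nonpos]; positivity)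
  -- Expressing `n` as a power of `lam` reduces both claims to exponents: the first balances
  -- variance and rate, the second says that the Bernstein remainder does not dominate.
  have hnl : (n : ℝ) = lam ^ (-(2 * a + ν + 1)) := by
    rw [hlam, ← Real.rpow_mul hn0.le]
    rw [neg_mul_neg, one_div_mul_cancel hs.ne', Real.rpow_one]
  refine ⟨h0, ?_, ?_⟩
  · rw [hnl, ← Real.rpow_natCast, ← Real.rpow_mul h0.le, ← Real.rpow_add h0]
    congr 1
    push_cast
    ring
  · rw [hnl, ← Real.rpow_add h0, Real.sqrt_eq_rpow, one_div, ← Real.rpow_neg h0.le]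
    exact Real.rpow_le_rpow_of_exponent_ge h0 h1 (by linarith)

/-- The spare factor `lam ^ (a / 2)` tends to zero and absorbs any fixed `C`, in particular the one
from Markov's inequality. -/
theorem exists_sample_size {a ν : ℝ} (ha : 0 < a) (hν : 0 < ν) (C : ℝ) :
    ∃ n₀ : ℕ, 0 < n₀ ∧ ∀ n : ℕ, n₀ ≤ n →
      C * ((n : ℝ) ^ (-(1 / (2 * a + ν + 1)))) ^ (a / 2) ≤ 1 / 4 := by
  have hs : 0 < 2 * a + ν + 1 := by positivity
  have h1 : Filter.Tendsto (fun n : ℕ => ((n : ℝ) ^ (-(1 / (2 * a + ν + 1)))) ^ (a / 2))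
      Filter.atTop (nhds 0) := by
    have := ((tendsto_rpow_neg_atTop (one_div_pos.2 hs)).comp
      tendsto_natCast_atTop_atTop).rpow_const (p := a / 2) (Or.inr (by positivity))
    rw [Real.zero_rpow (by positivity)] at this
    exact this
  have h2 := h1.const_mul C
  rw [mul_zero] at h2
  obtain ⟨n₀, hn₀⟩ := Filter.eventually_atTop.1
    ((h2.eventually_le_const (show (0 : ℝ) < 1 / 4 by norm_num)))
  exact ⟨n₀ + 1, Nat.succ_pos _, fun n hn => hn₀ n (by omega)⟩

/-- The closing inequality of the error recursion. -/
theorem amplitude_closes {r a η κ₀ ℓ CRt CR Cν ω₁ D eps c d : ℝ} (hη : 0 < η)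
    (hκ : 0 < κ₀) (hℓ : 0 < ℓ) (hCRt : 0 < CRt) (hCR : 0 < CR) (hCν : 0 < Cν) (heps : 0 < eps)
    (hDeps : D ≤ eps)
    (hc : c = 1 + amplitude r a κ₀ ℓ CR Cν
      + 16 * zetaSum (a / 2) * (CR + CRt * CR) * amplitude r a κ₀ ℓ CR Cν)
    (hd : 0 < d) (hsmall : c * max 1 d * eps ≤ d * η ^ a)
    (hω₁ : 4 * zetaSum (a / 2) * (CRt * ℓ + ℓ ^ 2) * η ^ (-(a / 2)) * ω₁ ≤ 1 / 4) :
    ((κ₀ * ℓ) ^ 2) ^ (r - a) * D + 2 * (2 * (2 * κ₀ + Cν + 1) * eps)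
      + 4 * zetaSum (a / 2) * (CR + CRt * CR) * (amplitude r a κ₀ ℓ CR Cν * eps) ^ 2 * η ^ (-a)
      + 2 * zetaSum (a / 2) * CR * (amplitude r a κ₀ ℓ CR Cν * eps) * η ^ (-a)
        * (2 * (2 * κ₀ + Cν + 1) * eps)
      + 4 * zetaSum (a / 2) * (CRt * ℓ) * η ^ (-(a / 2)) * ω₁ * (amplitude r a κ₀ ℓ CR Cν * eps)
      + 2 * ℓ * (2 * (2 * κ₀ + Cν + 1) * eps)
      + 4 * zetaSum (a / 2) * ℓ ^ 2 * η ^ (-(a / 2)) * ω₁ * (amplitude r a κ₀ ℓ CR Cν * eps)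
        ≤ amplitude r a κ₀ ℓ CR Cν * eps ∧
    amplitude r a κ₀ ℓ CR Cν * eps * η ^ (-a) < d := by
  have hZ := zetaSum_nonneg (a / 2)
  have hA : 0 < amplitude r a κ₀ ℓ CR Cν := amplitude_pos hκ hℓ hCR hCν
  have hAdef : amplitude r a κ₀ ℓ CR Cν = 2 * (((κ₀ * ℓ) ^ 2) ^ (r - a)
    + (2 + 2 * zetaSum (a / 2) * CR + 2 * ℓ) * (2 * (2 * κ₀ + Cν + 1))) := rfl
  set Am := amplitude r a κ₀ ℓ CR Cν
  set Z := zetaSum (a / 2)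
  set Kp := ((κ₀ * ℓ) ^ 2) ^ (r - a)
  have hKp : 0 ≤ Kp := by positivity
  set c₂ := 2 * (2 * κ₀ + Cν + 1) with hc₂
  have hc₂0 : 0 < c₂ := by positivity
  have hW : 0 ≤ 16 * Z * (CR + CRt * CR) * Am := by positivity
  set x := Am * eps * η ^ (-a) with hx
  have hx0 : 0 < x := by positivity
  have hc0 : 0 < c := by rw [hc]; positivity
  have hηa : 0 < η ^ a := by positivity
  -- The quotient `d / max 1 d` is `min 1 d`: this single smallness condition serves the quadratic
  -- term and the radius.
  have hy : c * (eps * η ^ (-a)) ≤ d / max 1 d := by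
    rw [le_div_iff₀ (by positivity), Real.rpow_neg hη.le]
    calc _ = c * max 1 d * eps * (η ^ a)⁻¹ := by ring
      _ ≤ d * η ^ a * (η ^ a)⁻¹ := by gcongr
      _ = d := by field_simp
  set w := eps * η ^ (-a) with hw
  have hw0 : 0 < w := by positivity
  have hxw : x = Am * w := by rw [hx, hw]; ring
  have hy1 : c * w ≤ 1 := hy.trans (by rw [div_le_one (by positivity)]; exact le_max_right _ _)
  have hyd : c * w ≤ d := hy.trans (div_le_self hd.le (le_max_left _ _))
  -- The three summands of `c`: `16 Z (CR + CRt * CR) Am` reduces the quadratic term to a quarter,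
  -- `Am` gives `x ≤ 1`, and `1` makes `x < d` strict.
  have hcw : c * w = w + x + 16 * Z * (CR + CRt * CR) * x := by rw [hc, hxw]; ring
  have hW' : 0 ≤ 16 * Z * (CR + CRt * CR) * x := by positivity
  have hx1 : x ≤ 1 := by linarith
  refine ⟨?_, by linarith⟩
  have t1 : Kp * D ≤ Kp * eps := by gcongr
  have t2 : 4 * Z * (CR + CRt * CR) * (Am * eps) ^ 2 * η ^ (-a) ≤ 1 / 4 * (Am * eps) := by
    have : 4 * Z * (CR + CRt * CR) * (Am * eps) ^ 2 * η ^ (-a)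
        = 4 * Z * (CR + CRt * CR) * x * (Am * eps) := by rw [hx]; ring
    rw [this]
    gcongr
    linarith
  have t3 : 2 * Z * CR * (Am * eps) * η ^ (-a) * (c₂ * eps) ≤ 2 * Z * CR * (c₂ * eps) := by
    have : 2 * Z * CR * (Am * eps) * η ^ (-a) * (c₂ * eps) = 2 * Z * CR * (c₂ * eps) * x := by
      rw [hx]; ring
    rw [this]
    exact mul_le_of_le_one_right (by positivity) hx1
  have t4 : 4 * Z * (CRt * ℓ) * η ^ (-(a / 2)) * ω₁ * (Am * eps)
      + 4 * Z * ℓ ^ 2 * η ^ (-(a / 2)) * ω₁ * (Am * eps) ≤ 1 / 4 * (Am * eps) := by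
    calc _ = 4 * Z * (CRt * ℓ + ℓ ^ 2) * η ^ (-(a / 2)) * ω₁ * (Am * eps) := by ring
      _ ≤ _ := by gcongr
  -- Half of `Am * eps` covers the linear terms; the quarters from `t2` and `t4` fill the other
  -- half.
  have t5 : Am * eps = 2 * (Kp * eps) + 2 * ((2 + 2 * Z * CR + 2 * ℓ) * (c₂ * eps)) := by
    rw [hAdef]; ring
  linarith

/-- The thresholds for the averaged noise and for the empirical covariance that belong to the
regularization parameter `lam`, with `q = lam ^ (a + 1 / 2)`. -/
theorem noise_thresholds {κ₀ Cν M σ D lam q n' V δ₀ δ : ℝ} (hκ : 0 < κ₀) (hCν : 0 < Cν)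
    (hM : 0 ≤ M) (hσ : 0 ≤ σ) (hD : 0 < D) (hq : 0 < q) (hn : 0 < n') (hV : V = n' * q ^ 2)
    (hlam : 1 / √lam ≤ n' * q) (hδ₀ : 0 < δ₀) (hδ : δ₀ ≤ δ) :
    2 * (M * κ₀ / √lam) ≤ n' * q * (2 * M * κ₀ + σ * Cν + D) ∧
    n' * (σ * √(Cν ^ 2 * V)) ^ 2 ≤ (n' * q * (2 * M * κ₀ + σ * Cν + D)) ^ 2 ∧
    2 * κ₀ ^ 2 * (Cν ^ 2 * V) ≤ δ * n' * (q * √(2 * κ₀ ^ 2 * Cν ^ 2 / δ₀)) ^ 2 ∧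
    2 * M * κ₀ + σ * Cν + D ≤ (2 * κ₀ + Cν + 1) * (D + M + σ) := by
  have h1 := mul_nonneg hσ hCν.le
  have h2 := mul_nonneg hM hκ.le
  subst hV
  refine ⟨?_, ?_, ?_, ?_⟩
  · calc 2 * (M * κ₀ / √lam) = 1 / √lam * (2 * M * κ₀) := by ring
      _ ≤ n' * q * (2 * M * κ₀ + σ * Cν + D) :=
        mul_le_mul hlam (by linarith) (by linarith) (by positivity)
  · rw [mul_pow, Real.sq_sqrt (by positivity)]
    calc _ = (n' * q * (σ * Cν)) ^ 2 := by ring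
      _ ≤ _ := by
        gcongr
        linarith
  · rw [mul_pow, Real.sq_sqrt (by positivity)]
    calc _ = δ₀ * (n' * (q ^ 2 * (2 * κ₀ ^ 2 * Cν ^ 2 / δ₀))) := by field_simp
      _ ≤ δ * (n' * (q ^ 2 * (2 * κ₀ ^ 2 * Cν ^ 2 / δ₀))) := by gcongr
      _ = _ := by ring
  · linarith [mul_nonneg hM hCν.le, mul_nonneg hσ hκ.le, mul_nonneg hD.le hκ.le,
        mul_nonneg hD.le hCν.le]

theorem mul_stopTime_le {a r ν η lam : ℝ} (hη : 0 < η) (ha : a = min r (1 / 2)) {n k : ℕ}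
    (hn : 0 < n) (hlam : lam = (n : ℝ) ^ (-(1 / (2 * a + ν + 1))))
    (hk : k + 1 ≤ stopTime η r ν n) : lam * (η * ((k : ℝ) + 1)) ≤ 1 := by
  have h2a : min (2 * r) 1 = 2 * a := by
    rw [ha, mul_min_of_nonneg _ _ (by norm_num : (0 : ℝ) ≤ 2)]
    norm_num
  have hnR : (0 : ℝ) < n := by exact_mod_cast hn
  have h1 := (Nat.le_floor_iff (by positivity)).1 hk
  rw [h2a] at h1
  push_cast at h1
  have h2 : η * ((k : ℝ) + 1) ≤ (n : ℝ) ^ (1 / (2 * a + ν + 1)) := by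
    calc _ ≤ η * (η⁻¹ * (n : ℝ) ^ (1 / (2 * a + ν + 1))) := by gcongr
      _ = _ := by field_simp
  calc _ ≤ lam * (n : ℝ) ^ (1 / (2 * a + ν + 1)) := by
        gcongr
        rw [hlam]
        positivity
    _ = 1 := by rw [hlam, ← Real.rpow_add hnR, neg_add_cancel, Real.rpow_zero]

end Parameters

/-! ### Combining the deterministic and the probabilistic bounds -/

section Main

variable {X Y : Type*} [MeasurableSpace X]
  [NormedAddCommGroup Y] [InnerProductSpace ℝ Y] [CompleteSpace Y]
  [SecondCountableTopology Y] [MeasurableSpace Y] [BorelSpace Y]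
  {H₁ : Type*} [NormedAddCommGroup H₁] [InnerProductSpace ℝ H₁] [CompleteSpace H₁]
  {H₂ : Type*} [NormedAddCommGroup H₂] [InnerProductSpace ℝ H₂] [CompleteSpace H₂]
  [RKHS ℝ H₂ X Y] {κ₀ : ℝ}
  {A : H₁ → H₂} {dom : Set H₁} {fdag g₁ : H₁} {d ℓ : ℝ}

/-- The error bound for the iterates on the event where the averaged noise and the deviation of
the empirical covariance are small. -/
theorem norm_gdIter_sub_le [SecondCountableTopology H₂]
    (hK : KernelCondition H₂ κ₀) (μ : Measure X) [IsProbabilityMeasure μ]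
    (hκ : 0 < κ₀) (hF : FrechetCondition A dom fdag d ℓ) (hdom : Metric.ball fdag d ⊆ dom)
    {CRt CR : ℝ} (hCRt : 0 ≤ CRt) (hCR : 0 ≤ CR)
    (hRI : RangeInvariance hK μ A dom fdag d CRt CR) (hℓ : 0 < ℓ) (hd : 0 < d)
    {η a r D lam N P ω ν₁ ω₁ : ℝ} (kmax : ℕ) (hη : 0 < η) (hη' : η < 1 / (κ₀ * ℓ) ^ 2)
    (ha : 0 < a) (ha' : a ≤ 1 / 2) (har : a ≤ r) (hlam : 0 < lam) (hP0 : 0 ≤ P) (hω0 : 0 ≤ ω)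
    (hsource : SourceCondition (tangentOp hK μ A fdag) fdag g₁ r D)
    (hlamτ : lam * (η * ((kmax : ℝ) + 1)) ≤ 1)
    (hNν : N * (η * ((kmax : ℝ) + 1)) ^ (a + 1 / 2) ≤ ν₁)
    (hω : ω * (η * ((kmax : ℝ) + 1)) ^ (1 / 2 + a / 2) ≤ ω₁)
    (hP : ((κ₀ * ℓ) ^ 2) ^ (r - a) * D + 2 * ν₁
      + 4 * zetaSum (a / 2) * (CR + CRt * CR) * P ^ 2 * η ^ (-a)
      + 2 * zetaSum (a / 2) * CR * P * η ^ (-a) * ν₁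
      + 4 * zetaSum (a / 2) * (CRt * ℓ) * η ^ (-(a / 2)) * ω₁ * P
      + 2 * ℓ * ν₁ + 4 * zetaSum (a / 2) * ℓ ^ 2 * η ^ (-(a / 2)) * ω₁ * P ≤ P)
    (hPd : P * η ^ (-a) < d)
    {n : ℕ} {z : Fin n → X × Y}
    (hN : ‖resolventEmb (inclusion hK μ) lam (empNoise (A fdag) z)‖ ≤ N)
    (hcov : ∀ h : H₂, ‖resolventEmb (inclusion hK μ) lam
      ((empCov H₂ z - covOp hK μ) h)‖ ≤ ω * ‖h‖) :
    ∀ k ≤ kmax, gdIter A η g₁ z (k + 1) ∈ Metric.ball fdag d ∧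
      ∀ u : ℝ, u = 0 ∨ u = 1 / 2 →
        ‖opPow (tangentOp hK μ A fdag) u (gdIter A η g₁ z (k + 1) - fdag)‖
          ≤ P * (η * ((k : ℝ) + 1)) ^ (-(a + u)) := by
  have hfd := hF fdag ⟨Metric.mem_ball_self hd, hdom (Metric.mem_ball_self hd)⟩
  set B := linOp hK μ A fdag with hB
  have hT : tangentOp hK μ A fdag = B.adjoint ∘L B := rfl
  have hBn : ‖B‖ ≤ κ₀ * ℓ := by
    refine (ContinuousLinearMap.opNorm_comp_le _ _).trans ?_
    exact mul_le_mul (norm_inclusion_le hK μ hκ.le) hfd.2 (norm_nonneg _) hκ.le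
  have hTc : IsCompactOperator (B.adjoint ∘L B) :=
    ((isCompactOperator_inclusion hK μ).comp_clm (fderiv ℝ A fdag)).clm_comp B.adjoint
  obtain ⟨ι, b, m, hb⟩ := exists_eigenbasis hTc (isSymmetric_adjoint_comp_self B)
  have hKpos : 0 < (κ₀ * ℓ) ^ 2 := by positivity
  have hmK : ∀ i, m i ≤ (κ₀ * ℓ) ^ 2 := fun i =>
    (eigenvalue_le hb i).trans (pow_le_pow_left₀ (norm_nonneg _) hBn 2)
  -- The step size condition places the spectrum of `η T` in `[0, 1]`.
  have hηm : ∀ i, η * m i ≤ 1 := fun i => by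
    calc η * m i ≤ η * (κ₀ * ℓ) ^ 2 := by gcongr; exact hmK i
      _ ≤ 1 := by rw [← le_div_iff₀ hKpos]; exact hη'.le
  obtain ⟨g, hg, hgD⟩ := hsource
  rw [hT] at hg
  have hN0 : 0 ≤ N := (norm_nonneg _).trans hN
  have hmain := perturbed_landweber_bound hb (e := fun k => gdIter A η g₁ z (k + 1) - fdag)
    (v := -inclusion hK μ (resolvent (inclusion hK μ) lam (empNoise (A fdag) z)))
    (D := D) (C₁ := CRt * ℓ) (C₂ := ℓ ^ 2) (Cw := CR + CRt * CR) (N := N) (ω := ω) (CR := CR)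
    (ℓ := ℓ) kmax hη hηm hKpos hmK ha ha' har hlam hN0 hP0 hω0 (by positivity) hCR (by positivity)
    (by positivity) hℓ.le hlamτ hNν hω hP le_rfl hgD (by
      change g₁ - fdag = _
      rw [← hg, neg_sub])
    (by rw [norm_neg]; exact (norm_apply_resolvent_le _).trans hN)
    (fun s _ hs => exists_gdStep_decomposition hK μ hF hdom hCRt hCR hRI η hℓ.le hlam hω0 hN hcov
      (by rw [Metric.mem_ball, dist_eq_norm]; exact hs.trans_lt hPd))
  intro k hk
  obtain ⟨h0, h1⟩ := hmain k hk
  refine ⟨?_, ?_⟩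
  · rw [Metric.mem_ball, dist_eq_norm]
    refine (h0.trans (mul_le_mul_of_nonneg_left ?_ hP0)).trans_lt hPd
    refine Real.rpow_le_rpow_of_nonpos hη ?_ (by linarith)
    nlinarith [(Nat.cast_nonneg k : (0 : ℝ) ≤ k)]
  · rintro u (rfl | rfl)
    · rw [hT, norm_opPow_zero hb, add_zero]
      exact h0
    · rw [hT, norm_opPow_half hb]
      exact h1

/-- The error bound with high probability, for a sample size for which the deviation of the
empirical covariance is negligible. -/
theorem exists_event_norm_gdIter_sub_le [SecondCountableTopology H₂]
    (hK : KernelCondition H₂ κ₀) (ρ : Measure (X × Y)) [IsProbabilityMeasure ρ]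
    (hκ : 0 < κ₀) (hF : FrechetCondition A dom fdag d ℓ) (hdom : Metric.ball fdag d ⊆ dom)
    {CRt CR : ℝ} (hCRt : 0 < CRt) (hCR : 0 < CR)
    (hRI : RangeInvariance hK ρ.fst A dom fdag d CRt CR) (hℓ : 0 < ℓ) (hd : 0 < d)
    {η a r ν D M σ Cν lam δ₀ δ c eps : ℝ} (hη : 0 < η) (hη' : η < 1 / (κ₀ * ℓ) ^ 2)
    (ha : 0 < a) (ha' : a ≤ 1 / 2) (har : a ≤ r) (hν : 0 < ν) (hCν : 0 < Cν)
    (hD : 0 < D) (hM : 0 ≤ M) (hσ : 0 ≤ σ)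
    (hsource : SourceCondition (tangentOp hK ρ.fst A fdag) fdag g₁ r D)
    (heff : EffDimCondition (covOp hK ρ.fst) ν Cν)
    (htrue : TrueSolution ρ A fdag) (hnoise : NoiseCondition ρ A fdag M σ)
    (hδ₀ : 0 < δ₀) (hδ : δ₀ ≤ δ) (hδ1 : δ ≤ 1)
    (hc : c = 1 + amplitude r a κ₀ ℓ CR Cν
      + 16 * zetaSum (a / 2) * (CR + CRt * CR) * amplitude r a κ₀ ℓ CR Cν)
    (heps : eps = (D + M + σ) * Real.log (6 / δ))
    (hsmall : c * max 1 d * eps ≤ d * η ^ a)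
    {n : ℕ} (hn : 0 < n) (hlam : lam = (n : ℝ) ^ (-(1 / (2 * a + ν + 1))))
    (hω₁ : 4 * zetaSum (a / 2) * (CRt * ℓ + ℓ ^ 2) * η ^ (-(a / 2))
      * (√(2 * κ₀ ^ 2 * Cν ^ 2 / δ₀) * lam ^ (a / 2)) ≤ 1 / 4) :
    ∃ E : Set (Fin n → X × Y), MeasurableSet E ∧
      ENNReal.ofReal (1 - δ) ≤ Measure.pi (fun _ : Fin n => ρ) E ∧
      ∀ z ∈ E, ∀ k : ℕ, lam * (η * ((k : ℝ) + 1)) ≤ 1 →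
        gdIter A η g₁ z (k + 1) ∈ Metric.ball fdag d ∧
        ∀ u : ℝ, u = 0 ∨ u = 1 / 2 →
          ‖opPow (tangentOp hK ρ.fst A fdag) u (gdIter A η g₁ z (k + 1) - fdag)‖
            ≤ amplitude r a κ₀ ℓ CR Cν * eps * (η * ((k : ℝ) + 1)) ^ (-(a + u)) := by
  have hδ0 : 0 < δ := hδ₀.trans_le hδ
  have hnR : (0 : ℝ) < n := by exact_mod_cast hn
  have hAm0 : 0 < amplitude r a κ₀ ℓ CR Cν := amplitude_pos hκ hℓ hCR hCν
  have hΛ1 : 1 ≤ Real.log (6 / δ) := one_le_log_six_div hδ0 hδ1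
  have heps0 : 0 < eps := by rw [heps]; positivity
  have hDeps : D ≤ eps := by
    have h1 : D ≤ D + M + σ := by linarith
    rw [heps]
    exact h1.trans (le_mul_of_one_le_right (by positivity) hΛ1)
  obtain ⟨hlam0, hlamν, hlamsqrt⟩ := regularization_rate ha hν hn hlam
  set q := lam ^ (a + 1 / 2) with hq
  have hq0 : 0 < q := by positivity
  obtain ⟨hclose, hPd⟩ := amplitude_closes (r := r) (a := a) (d := d) (D := D)
    hη hκ hℓ hCRt hCR hCν heps0 hDeps hc hd hsmall hω₁
  obtain ⟨hs1, hs2, hs3, hs4⟩ := noise_thresholds (M := M) (σ := σ) hκ hCν hM hσ hD hq0 hnR hlamν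
    hlamsqrt hδ₀ hδ
  -- Defined with `δ₀` in place of `δ`, so that the sample size can be fixed before `δ`.
  set ω₀ := √(2 * κ₀ ^ 2 * Cν ^ 2 / δ₀) with hω₀
  have hω₀0 : 0 < ω₀ := by positivity
  obtain ⟨ι, e, l, he⟩ := exists_eigenbasis
    (((isCompactOperator_inclusion hK ρ.fst)).clm_comp (inclusion hK ρ.fst).adjoint)
    (isSymmetric_adjoint_comp_self (inclusion hK ρ.fst))
  -- Here `R = n q (2 M κ₀ + σ Cν + D)` and `ω = q ω₀`. The summand `D` keeps `R` positive when
  -- there is no noise.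
  obtain ⟨E, hE, hprob, hgood⟩ := exists_good_event hK ρ hlam0 he hκ.le hM
    htrue hnoise (heff lam hlam0) (by positivity) hn hδ0 hδ1 (by positivity) hs1 hs2
    (mul_pos hq0 hω₀0) hs3
  refine ⟨E, hE, hprob, fun z hz k hlamτ => ?_⟩
  obtain ⟨hz1, hz2⟩ := hgood z hz
  have hτ0 : 0 < η * ((k : ℝ) + 1) := by positivity
  have hpow : ∀ s : ℝ, 0 ≤ s → lam ^ s * (η * ((k : ℝ) + 1)) ^ s ≤ 1 := by
    intro s hs
    rw [← Real.mul_rpow hlam0.le hτ0.le]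
    exact Real.rpow_le_one (by positivity) hlamτ hs
  have hnoiseN : ‖resolventEmb (inclusion hK ρ.fst) lam (empNoise (A fdag) z)‖
      ≤ 2 * (2 * κ₀ + Cν + 1) * eps * q := by
    rw [resolventEmb_empNoise, norm_smul, norm_inv, Real.norm_of_nonneg hnR.le,
      inv_mul_le_iff₀ hnR]
    refine hz1.trans ?_
    calc _ ≤ n * q * ((2 * κ₀ + Cν + 1) * (D + M + σ)) * (2 * Real.log (6 / δ)) := by gcongr
      _ = _ := by rw [heps]; ring
  have hN1 : 2 * (2 * κ₀ + Cν + 1) * eps * q * (η * ((k : ℝ) + 1)) ^ (a + 1 / 2)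
      ≤ 2 * (2 * κ₀ + Cν + 1) * eps := by
    rw [mul_assoc]
    exact mul_le_of_le_one_right (by positivity) (hpow _ (by positivity))
  -- One half power, `lam ^ (a / 2)`, of `q` is not consumed by `τ`; it is the spare factor.
  have hω1 : q * ω₀ * (η * ((k : ℝ) + 1)) ^ (1 / 2 + a / 2) ≤ ω₀ * lam ^ (a / 2) := by
    rw [hq, show a + 1 / 2 = a / 2 + (1 / 2 + a / 2) by ring, Real.rpow_add hlam0]
    calc _ = ω₀ * lam ^ (a / 2)
          * (lam ^ (1 / 2 + a / 2) * (η * ((k : ℝ) + 1)) ^ (1 / 2 + a / 2)) := by ring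
      _ ≤ _ := mul_le_of_le_one_right (by positivity) (hpow _ (by positivity))
  -- The deterministic bound is applied with `kmax = k`; the event does not depend on `k`.
  exact norm_gdIter_sub_le hK ρ.fst hκ hF hdom hCRt.le hCR.le hRI hℓ hd k hη hη' ha ha' har hlam0
    (mul_pos hAm0 heps0).le (mul_pos hq0 hω₀0).le hsource hlamτ hN1 hω1 hclose hPd hnoiseN hz2 k
    le_rfl

end Main

end InverseLearning

end

theorem theorem1
    (r ν η κ₀ ℓ α CRt CR Cν : ℝ) (hr : 0 < r) (hν : 0 < ν) (hν' : ν < 1)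
    (hκ : 0 < κ₀) (hℓ : 0 < ℓ) (hη : 0 < η) (hη' : η < 1 / (κ₀ * ℓ) ^ 2)
    (hα : 0 < α) (hα' : α < 1 / 2) (hCRt : 0 < CRt) (hCR : 0 < CR) (hCν : 0 < Cν) :
    ∃ c : ℝ, 0 < c ∧
      ∀ d D M σ : ℝ, 0 < d → 0 < D → 0 ≤ M → 0 ≤ σ →
        ∃ n₀ : ℕ, ∀ δ : ℝ,
          InverseLearning.deltaZero (InverseLearning.constStar c d D M σ) d η r ≤ δ → δ ≤ 1 →
          ∀ (X : Type*) [TopologicalSpace X] [PolishSpace X] [MeasurableSpace X] [BorelSpace X]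
            (Y : Type*) [NormedAddCommGroup Y] [InnerProductSpace ℝ Y] [CompleteSpace Y]
            [SecondCountableTopology Y] [MeasurableSpace Y] [BorelSpace Y]
            (H₁ : Type*) [NormedAddCommGroup H₁] [InnerProductSpace ℝ H₁] [CompleteSpace H₁]
            [SecondCountableTopology H₁]
            (H₂ : Type*) [NormedAddCommGroup H₂] [InnerProductSpace ℝ H₂] [CompleteSpace H₂]
            [SecondCountableTopology H₂] [RKHS ℝ H₂ X Y]
            (hK : InverseLearning.KernelCondition H₂ κ₀)
            (ρ : Measure (X × Y)) [IsProbabilityMeasure ρ]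
            (A : H₁ → H₂) (dom : Set H₁) (fdag g₁ : H₁),
            Metric.ball fdag d ⊆ dom →
            g₁ ∈ dom →
            InverseLearning.TrueSolution ρ A fdag →
            InverseLearning.NoiseCondition ρ A fdag M σ →
            InverseLearning.FrechetCondition A dom fdag d ℓ →
            InverseLearning.TangentialCone hK ρ.fst A dom fdag d α →
            InverseLearning.RangeInvariance hK ρ.fst A dom fdag d CRt CR →
            InverseLearning.SourceCondition
              (InverseLearning.tangentOp hK ρ.fst A fdag) fdag g₁ r D →
            InverseLearning.EffDimCondition (InverseLearning.covOp hK ρ.fst) ν Cν →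
            ∀ n : ℕ, n₀ ≤ n →
              ∃ E : Set (Fin n → X × Y), MeasurableSet E ∧
                ENNReal.ofReal (1 - δ) ≤ Measure.pi (fun _ : Fin n => ρ) E ∧
                ∀ z ∈ E, ∀ t : ℕ, 1 ≤ t → t ≤ InverseLearning.stopTime η r ν n →
                  InverseLearning.gdIter A η g₁ z t ∈ Metric.ball fdag d ∩ dom ∧
                  ∀ u : ℝ, u = 0 ∨ u = 1 / 2 →
                    ‖InverseLearning.opPow (InverseLearning.tangentOp hK ρ.fst A fdag) u
                        (InverseLearning.gdIter A η g₁ z t - fdag)‖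
                      ≤ InverseLearning.constStar c d D M σ *
                          (η * t) ^ (-(min r (1 / 2) + u)) * Real.log (6 / δ) := by
  set a := min r (1 / 2) with ha_def
  have ha : 0 < a := lt_min hr (by norm_num)
  have hZ := InverseLearning.zetaSum_nonneg (a / 2)
  set Am := InverseLearning.amplitude r a κ₀ ℓ CR Cν with hAm
  have hAm0 : 0 < Am := InverseLearning.amplitude_pos hκ hℓ hCR hCν
  obtain ⟨c, hc⟩ : ∃ c : ℝ, c = 1 + Am
      + 16 * InverseLearning.zetaSum (a / 2) * (CR + CRt * CR) * Am := ⟨_, rfl⟩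
  have hW : 0 ≤ 16 * InverseLearning.zetaSum (a / 2) * (CR + CRt * CR) * Am := by positivity
  have hc0 : 0 < c := by rw [hc]; positivity
  have hcA : Am ≤ c := by rw [hc]; linarith
  refine ⟨c, hc0, fun d D M σ hd hD hM hσ => ?_⟩
  have hC0 : 0 < InverseLearning.constStar c d D M σ :=
    mul_pos (mul_pos hc0 (lt_max_of_lt_left one_pos)) (by positivity)
  have hδ₀ : 0 < InverseLearning.deltaZero (InverseLearning.constStar c d D M σ) d η r :=
    mul_pos (by norm_num) (Real.exp_pos _)
  -- The argument involves `δ₀` but neither `δ` nor the spaces, so `n₀` may precede both.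
  obtain ⟨n₀, hn₀0, hn₀⟩ := InverseLearning.exists_sample_size ha hν
    (4 * InverseLearning.zetaSum (a / 2) * (CRt * ℓ + ℓ ^ 2) * η ^ (-(a / 2))
      * √(2 * κ₀ ^ 2 * Cν ^ 2
        / InverseLearning.deltaZero (InverseLearning.constStar c d D M σ) d η r))
  refine ⟨n₀, ?_⟩
  intro δ hδ hδ1 X _ _ _ _ Y _ _ _ _ _ _ H₁ _ _ _ _ H₂ _ _ _ _ _ hK ρ _ A dom fdag g₁ hdom _
    htrue hnoise hF _ hRI hsource heff n hn
  have hn0 : 0 < n := hn₀0.trans_le hn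
  have hlog := InverseLearning.mul_log_le_of_deltaZero_le hC0 hδ
  have hΛ1 := InverseLearning.one_le_log_six_div (hδ₀.trans_le hδ) hδ1
  rw [InverseLearning.constStar, mul_assoc] at hlog
  have hω₁ := hn₀ n hn
  rw [mul_assoc (4 * InverseLearning.zetaSum (a / 2) * (CRt * ℓ + ℓ ^ 2) * η ^ (-(a / 2)))] at hω₁
  obtain ⟨E, hE, hprob, hgood⟩ := InverseLearning.exists_event_norm_gdIter_sub_le hK ρ hκ hF hdom
    hCRt hCR hRI hℓ hd hη hη' ha (min_le_right _ _) (min_le_left _ _) hν hCν hD hM hσ hsource heff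
    htrue hnoise hδ₀ hδ hδ1 hc rfl hlog hn0 rfl hω₁
  refine ⟨E, hE, hprob, fun z hz t ht1 ht => ?_⟩
  -- Errors are indexed from `0` and iterates from `1`, so `η (k + 1)` is `η t`.
  obtain ⟨k, rfl⟩ : ∃ k, t = k + 1 := ⟨t - 1, by omega⟩
  obtain ⟨hball, hbound⟩ := hgood z hz k (InverseLearning.mul_stopTime_le hη ha_def hn0 rfl ht)
  refine ⟨⟨hball, hdom hball⟩, fun u hu => (hbound u hu).trans ?_⟩
  have hAC : Am ≤ c * max 1 d := hcA.trans (le_mul_of_one_le_right hc0.le (le_max_left _ _))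
  rw [InverseLearning.constStar, Nat.cast_add, Nat.cast_one]
  calc _ ≤ c * max 1 d * ((D + M + σ) * Real.log (6 / δ))
        * (η * ((k : ℝ) + 1)) ^ (-(a + u)) := by gcongr
    _ = _ := by ring
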